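/- A \emph{machine} with $m$ inputs is a deterministic machine with a finite control, $m$ one-directional read-only input tapes with end markers, a one-directional write-only output tape, and two binary stacks with the requests push, pop and isempty. It \emph{uses space} $s$ on given inputs if during its computation the sum of the sizes of the two stacks is always at most $s$. For a machine $V$ with two inputs (a program and an auxiliary string) and strings $x_1,y_1,\dots,x_r,y_r$, let $C_V^s(x_1{\leftarrow}y_1;\dots;x_r{\leftarrow}y_r)$ be the minimal length $|p|$ of a program $p$ such that for all $j\le r$, $V$ on input $(p,y_j)$ halts with output $x_j$ using space $s$ (and $+\infty$ if there is no such $p$). Let $U$ be an optimal machine: for every machine $V$ with two inputs there is a constant $c_V$ such that $C_U^{s+c_V}(x_1{\leftarrow}y_1;\dots;x_r{\leftarrow}y_r)\le C_V^{s}(x_1{\leftarrow}y_1;\dots;x_r{\leftarrow}y_r)+c_V$ for all $s$, $r$ and all strings $x_1,y_1,\dots,x_r,y_r$. Write $C^s(x)=C_U^s(x{\leftarrow}\text{empty string})$. Then there exist a machine $M$ with three inputs and a constant $c$ such that for every binary string $x$ and all natural numbers $k,s\ge 0$, the machine $M$ on input $x,k,s$ (each on its own input tape, $k$ and $s$ in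 binary, least significant bit first) halts and decides whether $C^s(x)<k$ (it outputs $1$ if this holds and $0$ otherwise), using space at most $s+2|x|+c\log(|x|+2)$, where $\log$ is the binary logarithm rounded down. -/

import Mathlib

/-- The requests that a machine with `m` input tapes and control states `Q` can make.
An answer `none` to `read i` means that the head is on the end marker of tape `i`;
an answer `none` to `pop j` means that stack `j` is empty. -/
inductive Request (m : ℕ) (Q : Type) : Type where
  /-- stop -/
  | halt : Request m Q
  /-- read the symbol under the head of input tape `i` and, unless it is the end marker,
  move this head one cell to the right -/
  | read (i : Fin m) (next : Option Bool → Q) : Request m Q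
  /-- write a bit on the output tape -/
  | write (b : Bool) (next : Q) : Request m Q
  /-- push a bit on stack `j` -/
  | push (j : Fin 2) (b : Bool) (next : Q) : Request m Q
  /-- remove the top of stack `j` and receive it -/
  | pop (j : Fin 2) (next : Option Bool → Q) : Request m Q
  /-- ask whether stack `j` is empty -/
  | isEmpty (j : Fin 2) (next : Bool → Q) : Request m Q

/-- A deterministic machine with `m` one-directional read-only input tapes with end markers,
a one-directional write-only output tape, two binary stacks and a finite control. -/
structure Machine (m : ℕ) : Type 1 where
  State : Type
  finite_state : Finite State
  init : State
  request : State → Request m State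

/-- A configuration: control state, unread part of every input tape, the two stacks (top
first), and the output written so far (first bit first). -/
structure Config (m : ℕ) (Q : Type) : Type where
  state : Q
  unread : Fin m → List Bool
  stack : Fin 2 → List Bool
  output : List Bool

namespace Config

/-- The total size of the two stacks. -/
def space {m : ℕ} {Q : Type} (c : Config m Q) : ℕ :=
  (c.stack 0).length + (c.stack 1).length

end Config

namespace Machine

/-- The initial configuration on given inputs. -/
def initial {m : ℕ} (M : Machine m) (input : Fin m → List Bool) : Config m M.State where
  state := M.init
  unread := input
  stack := fun _ => []
  output := []

/-- One step of computation; a halted configuration does not change. -/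
def step {m : ℕ} (M : Machine m) (c : Config m M.State) : Config m M.State :=
  match M.request c.state with
  | .halt => c
  | .read i next =>
      { c with
        state := next (c.unread i).head?
        unread := Function.update c.unread i (c.unread i).tail }
  | .write b next => { c with state := next, output := c.output ++ [b] }
  | .push j b next =>
      { c with
        state := next
        stack := Function.update c.stack j (b :: c.stack j) }
  | .pop j next =>
      { c with
        state := next (c.stack j).head?
        stack := Function.update c.stack j (c.stack j).tail }
  | .isEmpty j next => { c with state := next (c.stack j).isEmpty }

/-- The configuration after `t` steps. -/
def configAt {m : ℕ} (M : Machine m) (input : Fin m → List Bool) (t : ℕ) :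
    Config m M.State :=
  M.step^[t] (M.initial input)

/-- `M` uses space (at most) `s` on the given inputs: the sum of the sizes of the two stacks
is always at most `s`. -/
def UsesSpace {m : ℕ} (M : Machine m) (input : Fin m → List Bool) (s : ℕ) : Prop :=
  ∀ t, (M.configAt input t).space ≤ s

/-- `M` halts on the given inputs with output `out`. -/
def Outputs {m : ℕ} (M : Machine m) (input : Fin m → List Bool) (out : List Bool) : Prop :=
  ∃ t, M.request (M.configAt input t).state = .halt ∧ (M.configAt input t).output = out

/-- On the given inputs, `M` decides whether `P` holds: it halts with output `1` if `P` is true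
and with output `0` if `P` is false. -/
def Decides {m : ℕ} (M : Machine m) (input : Fin m → List Bool) (P : Prop) : Prop :=
  (P → M.Outputs input [true]) ∧ (¬P → M.Outputs input [false])

/-- Kolmogorov complexity of the tasks `x₁ ← y₁; …; xₖ ← yₖ` (a list of pairs `(xⱼ, yⱼ)`) with
space bound `s` relative to the machine `V`: the minimal length of a program `p` such that, for
all `j`, `V` on input `(p, yⱼ)` outputs `xⱼ` using space `s`. It is `⊤` if there is none. -/
noncomputable def taskComplexity (V : Machine 2) (s : ℕ)
    (tasks : List (List Bool × List Bool)) : ℕ∞ :=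
  ⨅ (p : List Bool)
    (_ : ∀ a ∈ tasks, V.Outputs ![p, a.2] a.1 ∧ V.UsesSpace ![p, a.2] s), (p.length : ℕ∞)

/-- `U` is optimal: for every machine `V` there is a constant `c` such that for all `s` and all
tasks, the complexity with space bound `s + c` relative to `U` exceeds the complexity with space
bound `s` relative to `V` by at most `c`. -/
def IsOptimal (U : Machine 2) : Prop :=
  ∀ V : Machine 2, ∃ c : ℕ, ∀ (s : ℕ) (tasks : List (List Bool × List Bool)),
    U.taskComplexity (s + c) tasks ≤ V.taskComplexity s tasks + c

/-- The Kolmogorov complexity of `x` with space bound `s` (relative to `U`). -/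
noncomputable def complexity (U : Machine 2) (s : ℕ) (x : List Bool) : ℕ∞ :=
  U.taskComplexity s [(x, [])]

end Machine

/-! The question is whether some program `p` with `|p| < k` makes `U` output `x` in space `s`.
Comparing `U` with a machine that copies its program gives a constant `B` such that, for `s ≥ B`,
some program of length at most `|x| + B` works (`IsOptimal.exists_accepts`). Hence `k` may be
replaced by its minimum with `|x| + B + 1`, and it suffices to run through all programs below that
length, keeping `p`, `x` and the simulated stacks in memory. This accounts for `s + 2|x| + O(1)`
bits.

Two difficulties remain for `s ≥ B`. The simulation may run forever, and a clock would need about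
`s` further bits. Instead the graph of configurations is searched backwards from the unique
accepting one. Every vertex has at most one outgoing edge, so the configurations leading to the
accepting one form a finite tree. This tree can be traversed depth first while storing only the
current vertex and a constant amount of data: the way back is the forward step
(`FuncGraph.search_subtree`). Every simulated step is therefore given as a guarded instruction with
an inverse, and output bits are compared with `x` instead of being written.

The second difficulty is that storing `s` would cost `log s` bits, which need not be `O(log |x|)`.
Only the amount `g` of free space is stored. The counters take a constant multiple of `log g` bits
for it, which is at most `g + O(1)`, so this counter fits into the very space it measures
(`exists_mul_size_le`, `Mem.Fits.le_bound`). All other counters are bounded by a constant multiple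
of `|x| + 2`.

For the finitely many `s < B` there is no bound on the length of programs in terms of `|x|` from
optimality. Here the computations in space `s` are the runs of a finite transducer that guesses the
program, each guessed bit having cost one (`exists_accepts_iff`). The cost of a cheapest run with
output `x` is smaller than the number of states times `|x| + 1` (`Transducer.Cost.exists_lt`), so
`k` can again be capped. The cheapest costs are computed with logarithmic counters by relaxing
transitions until nothing changes.

All this is programmed in a small structured language, which is compiled to machines together with
its space bounds (`Exec.outputs_and_usesSpace`). -/

set_option linter.unusedSectionVars false

/-! ### Structured programs and their compilation to machines -/

/-- The requests of a machine other than `halt`. -/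
inductive Act (m : ℕ) (Q : Type) : Type where
  | read (i : Fin m) (next : Option Bool → Q) : Act m Q
  | write (b : Bool) (next : Q) : Act m Q
  | push (j : Fin 2) (b : Bool) (next : Q) : Act m Q
  | pop (j : Fin 2) (next : Option Bool → Q) : Act m Q
  | isEmpty (j : Fin 2) (next : Bool → Q) : Act m Q

namespace Act

variable {m : ℕ} {Q Q' Q'' : Type}

def toRequest : Act m Q → Request m Q
  | read i next => .read i next
  | write b next => .write b next
  | push j b next => .push j b next
  | pop j next => .pop j next
  | isEmpty j next => .isEmpty j next

def map (f : Q → Q') : Act m Q → Act m Q'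
  | read i next => read i fun a => f (next a)
  | write b next => write b (f next)
  | push j b next => push j b (f next)
  | pop j next => pop j fun a => f (next a)
  | isEmpty j next => isEmpty j fun a => f (next a)

/-- The effect of an action; the new control state is determined by the answer alone. -/
def run (r : Act m Q') (c : Config m Q) : Config m Q' :=
  match r with
  | read i next =>
      ⟨next (c.unread i).head?, Function.update c.unread i (c.unread i).tail, c.stack, c.output⟩
  | write b next => ⟨next, c.unread, c.stack, c.output ++ [b]⟩
  | push j b next => ⟨next, c.unread, Function.update c.stack j (b :: c.stack j), c.output⟩
  | pop j next =>
      ⟨next (c.stack j).head?, c.unread, Function.update c.stack j (c.stack j).tail, c.output⟩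
  | isEmpty j next => ⟨next (c.stack j).isEmpty, c.unread, c.stack, c.output⟩

end Act

/-- Change of the control state of a configuration. -/
def Config.mapState {m : ℕ} {Q Q' : Type} (f : Q → Q') (c : Config m Q) : Config m Q' :=
  ⟨f c.state, c.unread, c.stack, c.output⟩

/-- The effect of an action on tapes and stacks does not depend on the control state. This is what
allows a program to be placed inside a larger one by relabelling its control points. -/
theorem Act.run_map_mapState {m : ℕ} {P Q Q' Q'' : Type} (r : Act m Q') (f : Q' → Q'')
    (g : Q → P) (c : Config m Q) : (r.map f).run (c.mapState g) = (r.run c).mapState f := by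
  cases r <;> rfl

/-- Structured programs for two-stack machines, with a finite store `σ`. -/
inductive Cmd (m : ℕ) (σ : Type) : Type 1 where
  | act (r : σ → Act m σ) : Cmd m σ
  | seq (a b : Cmd m σ) : Cmd m σ
  | switch {κ : Type} (hκ : Finite κ) (sel : σ → κ) (body : κ → Cmd m σ) : Cmd m σ
  | loop (p : σ → Bool) (a : Cmd m σ) : Cmd m σ

namespace Cmd

variable {m : ℕ} {σ : Type}

/-- The control states of a program. -/
def Pos : Cmd m σ → Type
  | act _ => σ
  | seq a b => a.Pos ⊕ b.Pos
  | switch (κ := κ) _ _ body => Σ k : κ, (body k).Pos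
  | loop _ a => a.Pos ⊕ σ

theorem finite_pos [Finite σ] : ∀ c : Cmd m σ, Finite c.Pos
  | act _ => inferInstanceAs (Finite σ)
  | seq a b => by
      have := finite_pos a
      have := finite_pos b
      exact inferInstanceAs (Finite (a.Pos ⊕ b.Pos))
  | switch (κ := κ) hκ _ body => by
      have := fun k => finite_pos (body k)
      exact inferInstanceAs (Finite (Σ k : κ, (body k).Pos))
  | loop _ a => by
      have := finite_pos a
      exact inferInstanceAs (Finite (a.Pos ⊕ σ))

def entry : (c : Cmd m σ) → σ → c.Pos
  | act _, s => s
  | seq a _, s => .inl (a.entry s)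
  | switch _ sel body, s => ⟨sel s, (body (sel s)).entry s⟩
  | loop _ _, s => .inr s

/-- The action in a control state; an answer in the right summand means that the program
terminates with that store. -/
def next : (c : Cmd m σ) → c.Pos → Act m (c.Pos ⊕ σ)
  | act r, s => (r s).map .inr
  | seq a b, .inl q => (a.next q).map (Sum.elim (fun q => .inl (.inl q))
      fun s => .inl (.inr (b.entry s)))
  | seq _ b, .inr q => (b.next q).map (Sum.elim (fun q => .inl (.inr q)) .inr)
  | switch _ _ body, ⟨k, q⟩ => ((body k).next q).map (Sum.elim (fun q => .inl ⟨k, q⟩) .inr)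
  | loop _ a, .inl q => (a.next q).map (Sum.elim (fun q => .inl (.inl q)) fun s => .inl (.inr s))
  -- The loop test depends on the store alone; the request `isEmpty` only serves as a step without
  -- effect.
  | loop p a, .inr s => .isEmpty 0 fun _ => if p s then .inl (.inl (a.entry s)) else .inr s

/-- The program terminates, turning the first configuration into the second one, and the space
used never exceeds `B`. -/
inductive Exec (B : ℕ) : Cmd m σ → Config m σ → Config m σ → Prop
  | act {r : σ → Act m σ} {c : Config m σ} (h : c.space ≤ B)
      (h' : ((r c.state).run c).space ≤ B) : Exec B (.act r) c ((r c.state).run c)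
  | seq {a b : Cmd m σ} {c d e : Config m σ} (h : Exec B a c d) (h' : Exec B b d e) :
      Exec B (.seq a b) c e
  | switch {κ : Type} {hκ : Finite κ} {sel : σ → κ} {body : κ → Cmd m σ} {c d : Config m σ}
      (h : Exec B (body (sel c.state)) c d) : Exec B (.switch hκ sel body) c d
  | loop_done {p : σ → Bool} {a : Cmd m σ} {c : Config m σ} (h : c.space ≤ B)
      (hp : p c.state = false) : Exec B (.loop p a) c c
  | loop_next {p : σ → Bool} {a : Cmd m σ} {c d e : Config m σ} (hp : p c.state = true)
      (h : Exec B a c d) (h' : Exec B (.loop p a) d e) : Exec B (.loop p a) c e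

theorem Exec.space_le {B : ℕ} {a : Cmd m σ} {c d : Config m σ} (h : Exec B a c d) :
    c.space ≤ B ∧ d.space ≤ B := by
  induction h with
  | act h h' => exact ⟨h, h'⟩
  | seq _ _ ih ih' => exact ⟨ih.1, ih'.2⟩
  | switch _ ih => exact ih
  | loop_done h _ => exact ⟨h, h⟩
  | loop_next _ _ _ ih ih' => exact ⟨ih.1, ih'.2⟩

/-- One step of the compiled program within space `B`. -/
def Link (c : Cmd m σ) (B : ℕ) (x y : Config m (c.Pos ⊕ σ)) : Prop :=
  ∃ q, x.state = .inl q ∧ y = (c.next q).run x ∧ x.space ≤ B ∧ y.space ≤ B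

/-- Runs of a part are runs of the whole as soon as the relabelling `φ` respects the next actions;
termination of the part may be sent to any control point of the whole. -/
theorem Link.lift {a c : Cmd m σ} {B : ℕ} (φ : a.Pos ⊕ σ → c.Pos ⊕ σ)
    (hφ : ∀ q, ∃ q', φ (.inl q) = .inl q' ∧ c.next q' = (a.next q).map φ)
    {x y : Config m (a.Pos ⊕ σ)} (h : Relation.ReflTransGen (a.Link B) x y) :
    Relation.ReflTransGen (c.Link B) (x.mapState φ) (y.mapState φ) := by
  refine Relation.ReflTransGen.lift (Config.mapState φ) ?_ _ _ h
  rintro x y ⟨q, hq, rfl, hx, hy⟩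
  obtain ⟨q', hq', hn⟩ := hφ q
  refine ⟨q', ?_, ?_, hx, hy⟩
  · simp [Config.mapState, hq, hq']
  · rw [hn, Act.run_map_mapState]

/-- A derivation of `Exec` is finite, so it unfolds into a finite chain of single steps; every
intermediate configuration inherits the space bound. -/
theorem Exec.trace {B : ℕ} {c : Cmd m σ} {x y : Config m σ} (h : Exec B c x y) :
    Relation.ReflTransGen (c.Link B) (x.mapState fun s => .inl (c.entry s))
      (y.mapState .inr) := by
  induction h with
  | @act r c h h' =>
    refine Relation.ReflTransGen.single ⟨c.state, rfl, ?_, h, h'⟩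
    exact (Act.run_map_mapState _ _ _ _).symm
  | @seq a b c d e _ _ ih ih' =>
    have h1 := Link.lift (c := .seq a b) (Sum.elim (fun q => .inl (.inl q))
      fun s => .inl (.inr (b.entry s))) (fun q => ⟨_, rfl, rfl⟩) ih
    have h2 := Link.lift (c := .seq a b) (Sum.elim (fun q => .inl (.inr q)) .inr)
      (fun q => ⟨_, rfl, rfl⟩) ih'
    exact h1.trans h2
  | @switch κ hκ sel body c d _ ih =>
    exact Link.lift (c := .switch hκ sel body)
      (Sum.elim (fun q => .inl ⟨sel c.state, q⟩) .inr) (fun q => ⟨_, rfl, rfl⟩) ih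
  | @loop_done p a c h hp =>
    refine Relation.ReflTransGen.single ⟨.inr c.state, rfl, ?_, h, h⟩
    simp [next, Act.run, Config.mapState, hp]
  | @loop_next p a c d e hp h _ ih ih' =>
    have h1 := Link.lift (c := .loop p a) (Sum.elim (fun q => .inl (.inl q))
      fun s => .inl (.inr s)) (fun q => ⟨_, rfl, rfl⟩) ih
    refine Relation.ReflTransGen.head ?_ (h1.trans ih')
    refine ⟨.inr c.state, rfl, ?_, h.space_le.1, h.space_le.1⟩
    simp [next, Act.run, Config.mapState, hp]

/-- The machine that executes a program with initial store `s`. -/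
def toMachine [Finite σ] (c : Cmd m σ) (s : σ) : Machine m where
  State := c.Pos ⊕ σ
  finite_state := by
    have := c.finite_pos
    infer_instance
  init := .inl (c.entry s)
  request
    | .inl q => (c.next q).toRequest
    | .inr _ => .halt

theorem step_toMachine [Finite σ] (c : Cmd m σ) (s : σ) {B : ℕ}
    {x y : Config m (c.Pos ⊕ σ)} (h : c.Link B x y) : (c.toMachine s).step x = y := by
  obtain ⟨q, hq, rfl, -, -⟩ := h
  have : (c.toMachine s).request x.state = (c.next q).toRequest := by rw [hq]; rfl
  unfold Machine.step
  rw [this]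
  cases c.next q <;> rfl

/-- Turns a chain of links into a number of machine steps; `P` carries the space bound along all
intermediate configurations. -/
theorem exists_iterate {α : Type*} {r : α → α → Prop} {f : α → α} {P : α → Prop}
    (hr : ∀ x y, r x y → f x = y ∧ P x) {x y : α} (h : Relation.ReflTransGen r x y) (hy : P y) :
    ∃ t, f^[t] x = y ∧ ∀ t' ≤ t, P (f^[t'] x) := by
  induction h using Relation.ReflTransGen.head_induction_on with
  | refl => exact ⟨0, rfl, fun t' ht => by rw [Nat.le_zero.1 ht]; exact hy⟩
  | @head x z h _ ih =>
    obtain ⟨t, ht, hs⟩ := ih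
    obtain ⟨h1, h2⟩ := hr _ _ h
    refine ⟨t + 1, by rw [Function.iterate_succ_apply, h1, ht], fun t' ht' => ?_⟩
    cases t' with
    | zero => exact h2
    | succ t' =>
      rw [Function.iterate_succ_apply, h1]
      exact hs t' (by omega)

/-- The compiled machine stays in its halting configuration, so the bound for the steps of the trace
is a bound for all times. -/
theorem Exec.outputs_and_usesSpace [Finite σ] {B : ℕ} {c : Cmd m σ} {s : σ}
    {input : Fin m → List Bool} {y : Config m σ}
    (h : Exec B c ⟨s, input, fun _ => [], []⟩ y) :
    (c.toMachine s).Outputs input y.output ∧ (c.toMachine s).UsesSpace input B := by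
  obtain ⟨t, ht, hs⟩ := exists_iterate (f := (c.toMachine s).step) (P := fun z => z.space ≤ B)
    (fun x y hxy => ⟨step_toMachine c s hxy, by obtain ⟨q, -, -, hx, -⟩ := hxy; exact hx⟩)
    h.trace h.space_le.2
  change (c.toMachine s).configAt input t = _ at ht
  have hfix : (c.toMachine s).step (y.mapState .inr) = y.mapState .inr := rfl
  refine ⟨⟨t, ?_, ?_⟩, fun t' => ?_⟩
  · rw [ht]; rfl
  · rw [ht]; rfl
  · rcases le_total t' t with h1 | h1
    · exact hs t' h1
    · obtain ⟨r, rfl⟩ := Nat.exists_eq_add_of_le h1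
      have : (c.toMachine s).configAt input (t + r) = y.mapState .inr := by
        unfold Machine.configAt at ht ⊢
        rw [Nat.add_comm, Function.iterate_add_apply, ht]
        exact Function.iterate_fixed hfix r
      rw [this]
      exact h.space_le.2

end Cmd

/-! ### Basic commands on two stacks -/

/-- The pair of stacks in which stack `j` is `a` and the other one is `b`. -/
def twoStacks (j : Fin 2) (a b : List Bool) : Fin 2 → List Bool := fun k => if k = j then a else b

@[simp] theorem twoStacks_self (j : Fin 2) (a b : List Bool) : twoStacks j a b j = a := by
  simp [twoStacks]

@[simp] theorem twoStacks_succ (j : Fin 2) (a b : List Bool) : twoStacks j a b (j + 1) = b := by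
  fin_cases j <;> rfl

theorem twoStacks_swap (j : Fin 2) (a b : List Bool) :
    twoStacks (j + 1) b a = twoStacks j a b := by
  funext k; fin_cases j <;> fin_cases k <;> rfl

@[simp] theorem update_twoStacks_self (j : Fin 2) (a b c : List Bool) :
    Function.update (twoStacks j a b) j c = twoStacks j c b := by
  funext k; fin_cases j <;> fin_cases k <;> rfl

@[simp] theorem update_twoStacks_succ (j : Fin 2) (a b c : List Bool) :
    Function.update (twoStacks j a b) (j + 1) c = twoStacks j a c := by
  funext k; fin_cases j <;> fin_cases k <;> rfl

@[simp] theorem space_twoStacks {m : ℕ} {Q : Type} (s : Q) (u : Fin m → List Bool) (j : Fin 2)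
    (a b o : List Bool) :
    (Config.mk s u (twoStacks j a b) o).space = a.length + b.length := by
  fin_cases j <;> simp [Config.space, twoStacks, Nat.add_comm]

namespace Cmd

variable {m : ℕ} {σ : Type}

/-- Assignment to the finite store. -/
def assign (f : σ → σ) : Cmd m σ := .act fun s => .isEmpty 0 fun _ => f s

theorem Exec.assign {B : ℕ} {f : σ → σ} {s : σ} {u : Fin m → List Bool}
    {st : Fin 2 → List Bool} {o : List Bool} (h : (Config.mk s u st o).space ≤ B) :
    Exec B (Cmd.assign f) ⟨s, u, st, o⟩ ⟨f s, u, st, o⟩ :=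
  Exec.act (r := fun s => .isEmpty 0 fun _ => f s) h h

def push (j : Fin 2) (v : σ → Bool) (f : σ → σ) : Cmd m σ := .act fun s => .push j (v s) (f s)

theorem Exec.push {B : ℕ} {j : Fin 2} {v : σ → Bool} {f : σ → σ} {s : σ}
    {u : Fin m → List Bool} {a b o : List Bool} (h : a.length + b.length + 1 ≤ B) :
    Exec B (Cmd.push j v f) ⟨s, u, twoStacks j a b, o⟩ ⟨f s, u, twoStacks j (v s :: a) b, o⟩ := by
  have := Exec.act (B := B) (r := fun s => Act.push j (v s) (f s))
    (c := ⟨s, u, twoStacks j a b, o⟩) (by simp; omega) (by simp [Act.run]; omega)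
  simpa [Act.run, Cmd.push] using this

theorem Exec.push_succ {B : ℕ} {j : Fin 2} {v : σ → Bool} {f : σ → σ} {s : σ}
    {u : Fin m → List Bool} {a b o : List Bool} (h : a.length + b.length + 1 ≤ B) :
    Exec B (Cmd.push (j + 1) v f) ⟨s, u, twoStacks j a b, o⟩
      ⟨f s, u, twoStacks j a (v s :: b), o⟩ := by
  rw [← twoStacks_swap j a, ← twoStacks_swap j a]
  exact Exec.push (by omega)

def pop (j : Fin 2) (f : σ → Option Bool → σ) : Cmd m σ := .act fun s => .pop j (f s)

theorem Exec.pop {B : ℕ} {j : Fin 2} {f : σ → Option Bool → σ} {s : σ}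
    {u : Fin m → List Bool} {a b o : List Bool} (h : a.length + b.length ≤ B) :
    Exec B (Cmd.pop j f) ⟨s, u, twoStacks j a b, o⟩
      ⟨f s a.head?, u, twoStacks j a.tail b, o⟩ := by
  have := Exec.act (B := B) (r := fun s => Act.pop j (f s))
    (c := ⟨s, u, twoStacks j a b, o⟩) (by simpa using h) (by simp [Act.run]; omega)
  simpa [Act.run, Cmd.pop] using this

/-- Case distinction. -/
def ite (p : σ → Bool) (a b : Cmd m σ) : Cmd m σ :=
  .switch (κ := Bool) inferInstance p fun v => if v = true then a else b

theorem Exec.ite {B : ℕ} {p : σ → Bool} {a b : Cmd m σ} {c d : Config m σ}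
    (h : Exec B (if p c.state then a else b) c d) : Exec B (Cmd.ite p a b) c d :=
  Exec.switch (body := fun v => if v = true then a else b) h

end Cmd

/-! ### Counters -/

section Cells

variable {ι : Type}

/-- The number whose binary digits, least significant first, stand in track `i`. -/
def trackVal (i : ι) : List (ι → Bool) → ℕ
  | [] => 0
  | d :: l => (d i).toNat + 2 * trackVal i l

open Classical in
/-- Removal of the leading zeros. -/
noncomputable def trimCells : List (ι → Bool) → List (ι → Bool)
  | [] => []
  | d :: l => if trimCells l = [] ∧ d = fun _ => false then [] else d :: trimCells l

theorem trimCells_eq_nil (l : List (ι → Bool)) :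
    trimCells l = [] ↔ ∀ i, trackVal i l = 0 := by
  induction l with
  | nil => simp [trimCells, trackVal]
  | cons d l ih =>
    simp only [trimCells, trackVal]
    split_ifs with h
    · simp only [true_iff]
      intro i
      simp [h.2, ih.1 h.1 i]
    · simp only [false_iff]
      intro h'
      refine h ⟨ih.2 fun i => ?_, ?_⟩
      · have := h' i; omega
      · funext i
        have := h' i
        cases hd : d i
        · rfl
        · rw [hd] at this; simp at this

theorem trackVal_trimCells (i : ι) (l : List (ι → Bool)) :
    trackVal i (trimCells l) = trackVal i l := by
  induction l with
  | nil => rfl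
  | cons d l ih =>
    simp only [trimCells]
    split_ifs with h
    · have := (trimCells_eq_nil l).1 h.1 i
      simp [trackVal, h.2, this]
    · simp [trackVal, ih]

/-- Without leading zeros the digits are determined by the numbers. Thus the bits on the stack are a
function of the counter values, and no history of the operations has to be tracked. -/
theorem trimCells_congr (l l' : List (ι → Bool)) (h : ∀ i, trackVal i l = trackVal i l') :
    trimCells l = trimCells l' := by
  induction l generalizing l' with
  | nil =>
    rw [(trimCells_eq_nil []).2 fun _ => rfl, eq_comm, trimCells_eq_nil]
    exact fun i => (h i).symm
  | cons d l ih =>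
    cases l' with
    | nil =>
      rw [(trimCells_eq_nil []).2 fun _ => rfl, trimCells_eq_nil]
      exact h
    | cons d' l' =>
      simp only [trackVal] at h
      have hd : d = d' := by
        funext i
        have := h i
        cases h1 : d i <;> cases h2 : d' i <;> simp [h1, h2] at this ⊢ <;> omega
      subst hd
      rw [trimCells, trimCells, ih l' fun i => by have := h i; omega]

theorem length_trimCells_le (l : List (ι → Bool)) : (trimCells l).length ≤ l.length := by
  induction l with
  | nil => simp [trimCells]
  | cons d l ih => simp only [trimCells]; split_ifs <;> simp [ih]

def digitCells (c : ι → ℕ) : ℕ → List (ι → Bool)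
  | 0 => []
  | w + 1 => (fun i => (c i).bodd) :: digitCells (fun i => (c i).div2) w

theorem trackVal_digitCells (w : ℕ) (c : ι → ℕ) (i : ι) (h : c i < 2 ^ w) :
    trackVal i (digitCells c w) = c i := by
  induction w generalizing c with
  | zero => simp at h; simp [digitCells, trackVal, h]
  | succ w ih =>
    have h1 := Nat.bodd_add_div2 (c i)
    rw [pow_succ] at h
    simp only [digitCells, trackVal]
    rw [ih _ (by omega)]
    exact h1

theorem length_digitCells (w : ℕ) (c : ι → ℕ) : (digitCells c w).length = w := by
  induction w generalizing c with
  | zero => rfl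
  | succ w ih => simp [digitCells, ih]

variable [Fintype ι]

/-- The canonical digits of a family of numbers. -/
noncomputable def cellsOf (c : ι → ℕ) : List (ι → Bool) :=
  -- Any sufficient width would do, because trimming makes the result independent of it; the sum of
  -- all numbers is one.
  trimCells (digitCells c (∑ i, c i))

theorem trackVal_cellsOf (c : ι → ℕ) (i : ι) : trackVal i (cellsOf c) = c i := by
  rw [cellsOf, trackVal_trimCells, trackVal_digitCells]
  exact (Finset.single_le_sum (f := c) (fun _ _ => Nat.zero_le _) (Finset.mem_univ i)).trans_lt
    Nat.lt_two_pow_self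

theorem trimCells_eq_cellsOf (l : List (ι → Bool)) (c : ι → ℕ) (h : ∀ i, trackVal i l = c i) :
    trimCells l = cellsOf c := by
  rw [← trimCells_congr (cellsOf c) l fun i => by rw [trackVal_cellsOf, h i], cellsOf]
  refine trimCells_congr _ _ fun i => ?_
  rw [trackVal_trimCells]

theorem length_cellsOf_le (c : ι → ℕ) (w : ℕ) (h : ∀ i, c i < 2 ^ w) :
    (cellsOf c).length ≤ w := by
  rw [← trimCells_eq_cellsOf (digitCells c w) c fun i => trackVal_digitCells w c i (h i)]
  exact (length_trimCells_le _).trans (length_digitCells w c).le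

/-- The bits that represent a list of cells on a stack. -/
noncomputable def cellCode : List (ι → Bool) → List Bool
  | [] => []
  -- A bit `true` announces a cell. The list of cells is closed by a bit `false`, added wherever the
  -- code is used.
  | d :: l => true :: (Finset.univ.toList.map d ++ cellCode l)

theorem length_cellCode (l : List (ι → Bool)) :
    (cellCode l).length = (Fintype.card ι + 1) * l.length := by
  induction l with
  | nil => rfl
  | cons d l ih => simp [cellCode, ih]; ring

end Cells

/-- The store of a program with counters: its own variables and those used for moving the
counters between the stacks. -/
structure Store (ρ ι : Type) : Type where
  ctl : ρ
  cell : ι → Bool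
  flag : Bool
  carry : Bool

instance {ρ ι : Type} [Finite ρ] [Finite ι] : Finite (Store ρ ι) :=
  Finite.of_injective (fun s : Store ρ ι => (s.ctl, s.cell, s.flag, s.carry)) fun s t h => by
    cases s; cases t; simp_all

/-- The run of a transducer with two states on a list. -/
def transduce {γ : Type} (f : Bool → γ → Bool × Option γ) : Bool → List γ → Bool × List γ
  | v, [] => (v, [])
  | v, d :: l =>
      let r := transduce f (f v d).1 l
      (r.1, (f v d).2.toList ++ r.2)

theorem transduce_append {γ : Type} (f : Bool → γ → Bool × Option γ) (v : Bool) (l l' : List γ) :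
    transduce f v (l ++ l') =
      ((transduce f (transduce f v l).1 l').1,
        (transduce f v l).2 ++ (transduce f (transduce f v l).1 l').2) := by
  induction l generalizing v with
  | nil => rfl
  | cons d l ih => simp [transduce, ih]

open Classical in
/-- The transducer that removes the zero cells at the beginning. -/
noncomputable def trimStep {ι : Type} (v : Bool) (d : ι → Bool) : Bool × Option (ι → Bool) :=
  if v = true ∧ d = fun _ => false then (true, none) else (false, some d)

/-- On the way back the most significant cell comes first, so leading zeros can be dropped on the
fly; the state tells whether only zeros have been seen. -/
theorem transduce_trimStep {ι : Type} (l : List (ι → Bool)) :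
    transduce trimStep true l.reverse = (decide (trimCells l = []), (trimCells l).reverse) := by
  induction l with
  | nil => simp [transduce, trimCells]
  | cons d l ih =>
    rw [List.reverse_cons, transduce_append, ih]
    by_cases h1 : trimCells l = [] <;> by_cases h2 : d = fun _ => false <;>
      simp [transduce, trimStep, trimCells, h1, h2]

namespace Cmd

variable {m : ℕ} {ρ ι : Type} [Fintype ι]

open Classical in
noncomputable def popBits (j : Fin 2) : List ι → Cmd m (Store ρ ι)
  | [] => assign id
  | i :: l => .seq (pop j fun s v => { s with cell := Function.update s.cell i (v.getD false) })
      (popBits j l)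

def pushBits (j : Fin 2) : List ι → Cmd m (Store ρ ι)
  | [] => assign id
  -- The rest is pushed before the bit of `i`, so that popping meets the bits in the order of the
  -- list.
  | i :: l => .seq (pushBits j l) (push j (fun s => s.cell i) id)

open Classical in
theorem exec_popBits {B : ℕ} (j : Fin 2) (l : List ι) (d : ι → Bool) (s : Store ρ ι)
    (u : Fin m → List Bool) (a b o : List Bool) (h : l.length + a.length + b.length ≤ B) :
    Exec B (popBits j l) ⟨s, u, twoStacks j (l.map d ++ a) b, o⟩
      ⟨{ s with cell := fun i => if i ∈ l then d i else s.cell i }, u, twoStacks j a b, o⟩ := by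
  induction l generalizing s with
  | nil =>
    simpa [popBits] using Exec.assign (f := id) (by simpa using h)
  | cons i l ih =>
    have h1 := ih { s with cell := Function.update s.cell i (d i) }
      (by simp at h ⊢; omega)
    have h2 : (fun k => if k ∈ i :: l then d k else s.cell k) =
        fun k => if k ∈ l then d k else Function.update s.cell i (d i) k := by
      funext k
      by_cases h1 : k ∈ l
      · simp [h1]
      · by_cases h2 : k = i
        · subst h2; simp
        · simp [h1, h2]
    rw [h2]
    refine Exec.seq (Exec.pop ?_) h1
    simp at h ⊢; omega

theorem exec_pushBits {B : ℕ} (j : Fin 2) (l : List ι) (s : Store ρ ι)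
    (u : Fin m → List Bool) (a b o : List Bool) (h : l.length + a.length + b.length ≤ B) :
    Exec B (pushBits j l) ⟨s, u, twoStacks j a b, o⟩
      ⟨s, u, twoStacks j (l.map s.cell ++ a) b, o⟩ := by
  induction l with
  | nil =>
    refine Exec.assign ?_
    simp at h ⊢; omega
  | cons i l ih =>
    refine Exec.seq (ih (by simp at h; omega)) (Exec.push ?_)
    simp at h ⊢; omega

/-- Fetch the flag of the next cell. -/
def popFlag (j : Fin 2) : Cmd m (Store ρ ι) :=
  pop j fun s v => { s with flag := v.getD false, cell := fun _ => false }

noncomputable def pushCell (j : Fin 2) : Cmd m (Store ρ ι) :=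
  .seq (pushBits j Finset.univ.toList) (push j (fun _ => true) id)

noncomputable def sweepBody (j : Fin 2) (f : Bool → (ι → Bool) → Bool × Option (ι → Bool)) :
    Cmd m (Store ρ ι) :=
  .seq (popBits j Finset.univ.toList)
    (.seq (assign fun s => { s with
        carry := (f s.carry s.cell).1
        flag := (f s.carry s.cell).2.isSome
        cell := (f s.carry s.cell).2.getD fun _ => false })
      (.seq (ite Store.flag (pushCell (j + 1)) (assign id)) (popFlag j)))

/-- Move the cells on stack `j` to the other stack, applying a transducer. -/
noncomputable def sweep (j : Fin 2) (f : Bool → (ι → Bool) → Bool × Option (ι → Bool)) :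
    Cmd m (Store ρ ι) :=
  .seq (push (j + 1) (fun _ => false) id)
    (.seq (popFlag j) (.loop Store.flag (sweepBody j f)))

theorem exec_pushCell {B : ℕ} (j : Fin 2) (s : Store ρ ι) (u : Fin m → List Bool)
    (a b o : List Bool) (l : List (ι → Bool))
    (h : (cellCode [s.cell]).length + a.length + (cellCode l).length + b.length ≤ B) :
    Exec B (pushCell (j + 1)) ⟨s, u, twoStacks j a (cellCode l ++ b), o⟩
      ⟨s, u, twoStacks j a (cellCode (s.cell :: l) ++ b), o⟩ := by
  rw [← twoStacks_swap j a, ← twoStacks_swap j a]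
  refine Exec.seq (exec_pushBits _ _ _ _ _ _ _ ?_) ?_
  · simp [cellCode] at h ⊢; omega
  · rw [cellCode, List.cons_append, List.append_assoc]
    refine Exec.push ?_
    simp [cellCode] at h ⊢; omega

theorem exec_sweepBody {B : ℕ} (j : Fin 2) (f : Bool → (ι → Bool) → Bool × Option (ι → Bool))
    (c : ρ) (d e : ι → Bool) (g v : Bool) (u : Fin m → List Bool) (a b o : List Bool)
    (l : List (ι → Bool))
    (h : Fintype.card ι + 1 + a.length + (cellCode l).length + b.length ≤ B) :
    Exec B (sweepBody j f)
      ⟨⟨c, e, g, v⟩, u, twoStacks j (Finset.univ.toList.map d ++ a) (cellCode l ++ b), o⟩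
      ⟨⟨c, fun _ => false, a.head?.getD false, (f v d).1⟩, u,
        twoStacks j a.tail (cellCode ((f v d).2.toList ++ l) ++ b), o⟩ := by
  simp only [length_cellCode] at h
  have h1 := exec_popBits (B := B) j Finset.univ.toList d ⟨c, e, g, v⟩ u a (cellCode l ++ b) o
    (by simp [length_cellCode]; omega)
  have h2 : Exec B (ite Store.flag (pushCell (j + 1)) (assign id))
      ⟨⟨c, (f v d).2.getD fun _ => false, (f v d).2.isSome, (f v d).1⟩, u,
        twoStacks j a (cellCode l ++ b), o⟩
      ⟨⟨c, (f v d).2.getD fun _ => false, (f v d).2.isSome, (f v d).1⟩, u,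
        twoStacks j a (cellCode ((f v d).2.toList ++ l) ++ b), o⟩ := by
    refine Exec.ite ?_
    rcases (f v d).2 with _ | d'
    · refine Exec.assign ?_
      simp [length_cellCode]; omega
    · refine exec_pushCell _ _ _ _ _ _ _ ?_
      simp [length_cellCode]; omega
  simp only [Finset.mem_toList, Finset.mem_univ, if_true] at h1
  refine Exec.seq h1 (Exec.seq (Exec.assign ?_) (Exec.seq h2 (Exec.pop ?_)))
  · simp [length_cellCode]; omega
  · simpa using h2.space_le.2

/-- Invariant of the loop: the announcing bit of the next cell has already been popped into `flag`,
and the cells handled so far lie in reverse order on the other stack. -/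
theorem exec_sweep_loop {B : ℕ} (j : Fin 2) (f : Bool → (ι → Bool) → Bool × Option (ι → Bool))
    (c : ρ) (u : Fin m → List Bool) (a b o : List Bool) (cells l : List (ι → Bool)) (v : Bool)
    (h : (cellCode cells).length + (cellCode l).length + 1 + a.length + b.length ≤ B) :
    Exec B (.loop Store.flag (sweepBody j f))
      ⟨⟨c, fun _ => false, (cellCode cells ++ false :: a).head?.getD false, v⟩, u,
        twoStacks j (cellCode cells ++ false :: a).tail (cellCode l ++ b), o⟩
      ⟨⟨c, fun _ => false, false, (transduce f v cells).1⟩, u,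
        twoStacks j a (cellCode ((transduce f v cells).2.reverse ++ l) ++ b), o⟩ := by
  induction cells generalizing l v with
  | nil =>
    refine Exec.loop_done ?_ rfl
    simp [cellCode] at h ⊢; omega
  | cons d cells ih =>
    have hc : cellCode (d :: cells) ++ false :: a =
        true :: (Finset.univ.toList.map d ++ (cellCode cells ++ false :: a)) := by
      simp [cellCode]
    rw [hc]
    have hm : (Fintype.card ι + 1) * (cells.length + 1) =
      (Fintype.card ι + 1) * cells.length + (Fintype.card ι + 1) := by ring
    simp only [length_cellCode, List.length_cons] at h
    refine Exec.loop_next rfl (exec_sweepBody j f c d _ _ v u _ b o l ?_) ?_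
    · simp [length_cellCode]; omega
    · have h1 : (transduce f v (d :: cells)).2.reverse ++ l =
          (transduce f (f v d).1 cells).2.reverse ++ ((f v d).2.toList ++ l) := by
        rcases hf : (f v d).2 with _ | d' <;> simp [transduce, hf]
      rw [h1]
      refine ih ((f v d).2.toList ++ l) (f v d).1 ?_
      have h2 : (cellCode ((f v d).2.toList ++ l)).length ≤
          (Fintype.card ι + 1) * l.length + (Fintype.card ι + 1) := by
        rcases (f v d).2 with _ | d' <;> simp [length_cellCode, Nat.mul_add]
      simp only [length_cellCode] at h2 ⊢
      omega

/-- One sweep reverses the list of cells. The summand 2 in the space bound pays for an end mark on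
each of the two stacks. -/
theorem exec_sweep {B : ℕ} (j : Fin 2) (f : Bool → (ι → Bool) → Bool × Option (ι → Bool))
    (c : ρ) (d : ι → Bool) (g v : Bool) (u : Fin m → List Bool) (a b o : List Bool)
    (cells : List (ι → Bool)) (h : (cellCode cells).length + 2 + a.length + b.length ≤ B) :
    Exec B (sweep j f) ⟨⟨c, d, g, v⟩, u, twoStacks j (cellCode cells ++ false :: a) b, o⟩
      ⟨⟨c, fun _ => false, false, (transduce f v cells).1⟩, u,
        twoStacks j a (cellCode (transduce f v cells).2.reverse ++ false :: b), o⟩ := by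
  refine Exec.seq (Exec.push_succ ?_) (Exec.seq (Exec.pop ?_) ?_)
  · simp; omega
  · simp; omega
  · simpa [cellCode] using exec_sweep_loop (B := B) j f c u a (false :: b) o cells [] v
      (by simp [cellCode]; omega)

end Cmd

/-! ### Memory with counters on top of stack `0` -/

/-- The abstract memory of a program with counters: its variables, its counters, and what is
left of the configuration once the counters are removed from the stacks. -/
@[ext]
structure Mem (m : ℕ) (ρ ι : Type) : Type where
  ctl : ρ
  cnt : ι → ℕ
  inp : Fin m → List Bool
  fst : List Bool
  snd : List Bool
  out : List Bool

namespace Mem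

variable {m : ℕ} {ρ ι : Type} [Fintype ι]

/-- The configuration that represents a memory; the counters lie on top of stack `0`. -/
noncomputable def conf (a : Mem m ρ ι) : Config m (Store ρ ι) :=
  ⟨⟨a.ctl, fun _ => false, false, false⟩, a.inp,
    twoStacks 0 (cellCode (cellsOf a.cnt) ++ false :: a.fst) a.snd, a.out⟩

end Mem

/-- The space needed for operating on counters. -/
noncomputable def counterCost {ι : Type} [Fintype ι] (c : ι → ℕ) : ℕ :=
  -- One additional cell may be needed for the final carry, and two bits for the end marks on both
  -- stacks.
  (Fintype.card ι + 1) * ((cellsOf c).length + 1) + 2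

namespace Cmd

variable {m : ℕ} {ρ ι : Type} [Fintype ι]

theorem length_transduce_some {γ : Type} (f : Bool → γ → Bool × γ) (v : Bool) (l : List γ) :
    (transduce (fun v d => ((f v d).1, some (f v d).2)) v l).2.length = l.length := by
  induction l generalizing v with
  | nil => rfl
  | cons d l ih => simp [transduce, ih]

/-- Apply a transducer to the counters, with an action that sees its final state. -/
noncomputable def counterOp (init : Bool) (f : Bool → (ι → Bool) → Bool × (ι → Bool))
    (fin : Bool → ι → Bool) (mid : ρ → Bool → Act m ρ) : Cmd m (Store ρ ι) :=
  .seq (assign fun s => { s with carry := init })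
    (.seq (sweep 0 fun v d => ((f v d).1, some (f v d).2))
      (.seq (assign fun s => { s with cell := fin s.carry })
        (.seq (pushCell (0 + 1))
          (.seq (.act fun s => (mid s.ctl s.carry).map fun c => ⟨c, fun _ => false, false, true⟩)
            (.seq (sweep (0 + 1) trimStep) (assign fun s => { s with carry := false }))))))

/-- The sweep to stack `1` meets the least significant digits first, as arithmetic with carries
requires; a last cell receives the final carry, and the sweep back restores the order and trims
zeros. Between the sweeps the counters are on stack `1`, so the action `mid` can reach the bits that
they normally cover on stack `0`. It must leave stack `1` alone, whence the quantifier over `X`. -/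
theorem exec_counterOp {B : ℕ} (init : Bool) (f : Bool → (ι → Bool) → Bool × (ι → Bool))
    (fin : Bool → ι → Bool) (mid : ρ → Bool → Act m ρ) (a a' : Mem m ρ ι) (v : Bool)
    (l : List (ι → Bool))
    (hl : transduce (fun v d => ((f v d).1, some (f v d).2)) init (cellsOf a.cnt) = (v, l))
    (hval : ∀ i, trackVal i (l ++ [fin v]) = a'.cnt i)
    (hmid : ∀ X, (mid a.ctl v).run
      (Config.mk a.ctl a.inp (twoStacks 0 a.fst X) a.out) =
        ⟨a'.ctl, a'.inp, twoStacks 0 a'.fst X, a'.out⟩)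
    (hsnd : a'.snd = a.snd)
    (h : a.fst.length + a.snd.length + counterCost a.cnt ≤ B)
    (h' : a'.fst.length + a.snd.length + counterCost a.cnt ≤ B) :
    Exec B (counterOp init f fin mid) a.conf a'.conf := by
  have hlen : l.length = (cellsOf a.cnt).length := by
    have := length_transduce_some f init (cellsOf a.cnt)
    rwa [hl] at this
  have hm : (Fintype.card ι + 1) * ((cellsOf a.cnt).length + 1) =
      (Fintype.card ι + 1) * (cellsOf a.cnt).length + (Fintype.card ι + 1) := by ring
  simp only [counterCost] at h h'
  have h1 := exec_sweep (B := B) 0 (fun v d => ((f v d).1, some (f v d).2)) a.ctl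
    (fun _ => false) false init a.inp a.fst a.snd a.out (cellsOf a.cnt)
    (by rw [length_cellCode]; omega)
  rw [hl] at h1
  have h2 := exec_pushCell (B := B) 0 (⟨a.ctl, fin v, false, v⟩ : Store ρ ι) a.inp a.fst
    (false :: a.snd) a.out l.reverse (by simp [length_cellCode, hlen]; omega)
  have h3 := exec_sweep (B := B) (0 + 1) trimStep a'.ctl
    (fun _ => false) false true a'.inp a.snd a'.fst a'.out (fin v :: l.reverse)
    (by simp [length_cellCode, hlen]; omega)
  have h4 : fin v :: l.reverse = (l ++ [fin v]).reverse := by simp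
  rw [h4, transduce_trimStep] at h3
  simp only [twoStacks_swap, List.reverse_reverse] at h3
  rw [trimCells_eq_cellsOf _ _ hval] at h3
  have h5 : ((mid a.ctl v).map (fun c => (⟨c, fun _ => false, false, true⟩ : Store ρ ι))).run
      ⟨(⟨a.ctl, fin v, false, v⟩ : Store ρ ι), a.inp,
        twoStacks 0 a.fst (cellCode (fin v :: l.reverse) ++ false :: a.snd), a.out⟩ =
      ⟨⟨a'.ctl, fun _ => false, false, true⟩, a'.inp,
        twoStacks 0 a'.fst (cellCode (fin v :: l.reverse) ++ false :: a.snd), a'.out⟩ := by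
    have := Act.run_map_mapState (mid a.ctl v)
      (fun c => (⟨c, fun _ => false, false, true⟩ : Store ρ ι))
      (fun _ => (⟨a.ctl, fin v, false, v⟩ : Store ρ ι))
      (Config.mk a.ctl a.inp
        (twoStacks 0 a.fst (cellCode (fin v :: l.reverse) ++ false :: a.snd)) a.out)
    rw [hmid] at this
    exact this
  have h6 : (cellCode (fin v :: l.reverse)).length =
      (Fintype.card ι + 1) * ((cellsOf a.cnt).length + 1) := by
    simp [length_cellCode, hlen]
  refine Exec.seq (Exec.assign ?_) (Exec.seq h1 (Exec.seq (Exec.assign ?_) (Exec.seq h2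
    (Exec.seq ?_ (Exec.seq h3 ?_)))))
  · simp [length_cellCode]; omega
  · simp [length_cellCode, hlen]; omega
  · rw [← h4, ← h5]
    refine Exec.act (r := fun s : Store ρ ι => (mid s.ctl s.carry).map fun c =>
      (⟨c, fun _ => false, false, true⟩ : Store ρ ι)) ?_ ?_
    · simp [h6]; omega
    · simp only [h5]
      simp [h6]; omega
  · rw [Mem.conf, ← hsnd]
    refine Exec.assign ?_
    have := h3.space_le.2
    simp only [space_twoStacks, hsnd] at this ⊢
    exact this

/-- An action that does not concern stack `0`. -/
def direct (r : ρ → Act m ρ) : Cmd m (Store ρ ι) :=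
  .act fun s => (r s.ctl).map fun c => { s with ctl := c }

theorem exec_direct {B : ℕ} (r : ρ → Act m ρ) (a a' : Mem m ρ ι)
    (hr : ∀ X, (r a.ctl).run (Config.mk a.ctl a.inp (twoStacks 0 X a.snd) a.out) =
        ⟨a'.ctl, a'.inp, twoStacks 0 X a'.snd, a'.out⟩)
    (hcnt : a'.cnt = a.cnt) (hfst : a'.fst = a.fst)
    (h : a.fst.length + a.snd.length + counterCost a.cnt ≤ B)
    (h' : a.fst.length + a'.snd.length + counterCost a.cnt ≤ B) :
    Exec B (direct r) a.conf a'.conf := by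
  have hm : (Fintype.card ι + 1) * ((cellsOf a.cnt).length + 1) =
      (Fintype.card ι + 1) * (cellsOf a.cnt).length + (Fintype.card ι + 1) := by ring
  simp only [counterCost] at h h'
  have h5 : ((r a.conf.state.ctl).map (fun c => { a.conf.state with ctl := c })).run a.conf =
      a'.conf := by
    have := Act.run_map_mapState (r a.ctl)
      (fun c => (⟨c, fun _ => false, false, false⟩ : Store ρ ι))
      (fun _ => (⟨a.ctl, fun _ => false, false, false⟩ : Store ρ ι))
      (Config.mk a.ctl a.inp (twoStacks 0 (cellCode (cellsOf a.cnt) ++ false :: a.fst) a.snd)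
        a.out)
    rw [hr] at this
    rw [Mem.conf, Mem.conf, hcnt, hfst]
    exact this
  have h6 : a.conf.space ≤ B := by simp [Mem.conf, length_cellCode]; omega
  have h7 : a'.conf.space ≤ B := by simp [Mem.conf, length_cellCode, hcnt, hfst]; omega
  have := Exec.act (B := B)
    (r := fun s : Store ρ ι => (r s.ctl).map fun c => { s with ctl := c }) h6
    (by rw [h5]; exact h7)
  rw [h5] at this
  exact this

end Cmd

/-! ### Space bounds -/

/-- A linear function of `t` exceeds `2 ^ t` by at most a constant. For large `t`, one half of the
exponent dominates `t` and the other half dominates `a`; the constant covers small `t`. -/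
theorem mul_le_two_pow_add (a t : ℕ) : a * t ≤ 2 ^ t + 2 ^ (2 * a) * a * 4 := by
  rcases le_or_gt t (4 * 2 ^ (2 * a)) with h | h
  · calc a * t ≤ a * (4 * 2 ^ (2 * a)) := Nat.mul_le_mul_left _ h
      _ = 2 ^ (2 * a) * a * 4 := by ring
      _ ≤ _ := Nat.le_add_left _ _
  · have h1 : a < 2 ^ a := Nat.lt_two_pow_self
    have h2 : t ≤ 2 ^ (t / 2) * 2 := by
      have := Nat.lt_two_pow_self (n := t / 2)
      omega
    have h3 : 2 * a < t / 2 := by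
      have := Nat.lt_two_pow_self (n := 2 * a)
      omega
    have h4 : 2 ^ (a + 1) ≤ 2 ^ (t / 2) := Nat.pow_le_pow_right (by norm_num) (by omega)
    calc a * t ≤ 2 ^ a * (2 ^ (t / 2) * 2) := Nat.mul_le_mul h1.le h2
      _ = 2 ^ (a + 1) * 2 ^ (t / 2) := by ring
      _ ≤ 2 ^ (t / 2) * 2 ^ (t / 2) := Nat.mul_le_mul_right _ h4
      _ = 2 ^ (t / 2 + t / 2) := (pow_add _ _ _).symm
      _ ≤ 2 ^ t := Nat.pow_le_pow_right (by norm_num) (by omega)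
      _ ≤ _ := Nat.le_add_right _ _

/-- This is what removes `log s` from the space bound: a number `g` of free bits can be written
down, even with a constant factor of redundancy, inside `g` bits and a constant number of others. -/
theorem exists_mul_size_le (a : ℕ) : ∃ k, ∀ g : ℕ, a * Nat.size g ≤ g + k := by
  refine ⟨2 ^ (2 * (2 * a)) * (2 * a) * 4 + 1, fun g => ?_⟩
  have hg : 2 ^ g.size ≤ 2 * g + 1 := by
    rcases Nat.eq_zero_or_pos g with rfl | h
    · simp
    · have h2 : 0 < g.size := Nat.size_pos.2 h
      have : 2 ^ (g.size - 1) ≤ g := Nat.lt_size.1 (by omega)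
      have h3 : 2 ^ g.size = 2 ^ (g.size - 1) * 2 := by rw [← pow_succ]; congr 1; omega
      omega
  -- The factor is doubled because `2 ^ g.size` can be as large as about `2 * g`; halving at the end
  -- gives the coefficient one for `g`.
  have key := mul_le_two_pow_add (2 * a) g.size
  have h5 : 2 * a * g.size = 2 * (a * g.size) := by ring
  omega

/-- Bounds on the memory: all counters but one are small, and the remaining one has at most the
size of the unused part of the stacks. -/
structure Limits (ι : Type) : Type where
  big : ι
  small : ℕ
  total : ℕ

namespace Limits

variable {m : ℕ} {ρ ι : Type} [Fintype ι]

/-- The constant overhead of operating on counters indexed by `ι`. -/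
noncomputable def overhead (ι : Type) [Fintype ι] : ℕ :=
  (exists_mul_size_le (Fintype.card ι + 1)).choose + (Fintype.card ι + 1) + 2

/-- The space that suffices for a program that respects the limits. -/
noncomputable def bound (L : Limits ι) : ℕ :=
  L.total + (Fintype.card ι + 1) * L.small.size + overhead ι

end Limits

/-- The memory respects the limits. -/
structure Mem.Fits {m : ℕ} {ρ ι : Type} (L : Limits ι) (a : Mem m ρ ι) : Prop where
  small : ∀ i, i ≠ L.big → a.cnt i ≤ L.small
  total : a.fst.length + a.snd.length + a.cnt L.big ≤ L.total

/-- The number of cells is at most the sum of the binary lengths of `small` and of the big counter.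
The first part is the logarithmic overhead; the second is paid for by the value of the big counter,
which `total` already includes. -/
theorem Mem.Fits.le_bound {m : ℕ} {ρ ι : Type} [Fintype ι] {L : Limits ι} {a : Mem m ρ ι}
    (h : a.Fits L) : a.fst.length + a.snd.length + counterCost a.cnt ≤ L.bound := by
  obtain ⟨h1, h2⟩ := h
  have h3 : (cellsOf a.cnt).length ≤ L.small.size + (a.cnt L.big).size := by
    refine length_cellsOf_le _ _ fun i => ?_
    by_cases hi : i = L.big
    · subst hi
      exact (Nat.lt_size_self _).trans_le (Nat.pow_le_pow_right (by norm_num) (by omega))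
    · exact ((h1 i hi).trans_lt (Nat.lt_size_self _)).trans_le
        (Nat.pow_le_pow_right (by norm_num) (by omega))
  have h4 := (exists_mul_size_le (Fintype.card ι + 1)).choose_spec (a.cnt L.big)
  have h5 := Nat.mul_le_mul_left (Fintype.card ι + 1) h3
  rw [Nat.mul_add] at h5
  have h6 : (Fintype.card ι + 1) * ((cellsOf a.cnt).length + 1) =
      (Fintype.card ι + 1) * (cellsOf a.cnt).length + (Fintype.card ι + 1) := by ring
  unfold counterCost Limits.bound Limits.overhead
  omega

/-! ### Programs on abstract memories, arithmetic of counters -/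

namespace Cmd

variable {m : ℕ} {ρ ι : Type} [Fintype ι]

/-- The program turns the first memory into the second one, within the space given by `L`. -/
def Run (L : Limits ι) (c : Cmd m (Store ρ ι)) (a b : Mem m ρ ι) : Prop :=
  Exec L.bound c a.conf b.conf

variable {L : Limits ι}

theorem Run.seq {c d : Cmd m (Store ρ ι)} {a b e : Mem m ρ ι} (h : Run L c a b)
    (h' : Run L d b e) : Run L (.seq c d) a e := Exec.seq h h'

/-- Case distinction on the variables. -/
def cond (p : ρ → Bool) (c d : Cmd m (Store ρ ι)) : Cmd m (Store ρ ι) :=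
  ite (fun s => p s.ctl) c d

theorem Run.cond {p : ρ → Bool} {c d : Cmd m (Store ρ ι)} {a b : Mem m ρ ι}
    (h : Run L (if p a.ctl then c else d) a b) : Run L (Cmd.cond p c d) a b := Exec.ite h

theorem Run.cond_true {p : ρ → Bool} {c d : Cmd m (Store ρ ι)} {a b : Mem m ρ ι}
    (hp : p a.ctl = true) (h : Run L c a b) : Run L (Cmd.cond p c d) a b :=
  Run.cond (by rwa [if_pos hp])

theorem Run.cond_false {p : ρ → Bool} {c d : Cmd m (Store ρ ι)} {a b : Mem m ρ ι}
    (hp : p a.ctl = false) (h : Run L d a b) : Run L (Cmd.cond p c d) a b :=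
  Run.cond (by rwa [if_neg (by simp [hp])])

/-- Distinction of finitely many cases on the variables. -/
def cases {κ : Type} [hκ : Finite κ] (sel : ρ → κ) (body : κ → Cmd m (Store ρ ι)) :
    Cmd m (Store ρ ι) := .switch hκ (fun s => sel s.ctl) body

theorem Run.cases {κ : Type} [Finite κ] {sel : ρ → κ} {body : κ → Cmd m (Store ρ ι)}
    {a b : Mem m ρ ι} (h : Run L (body (sel a.ctl)) a b) : Run L (Cmd.cases sel body) a b :=
  Exec.switch h

/-- Repetition as long as the variables satisfy a condition. -/
def whileDo (p : ρ → Bool) (c : Cmd m (Store ρ ι)) : Cmd m (Store ρ ι) :=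
  .loop (fun s => p s.ctl) c

theorem space_conf_le {a : Mem m ρ ι} (h : a.Fits L) : a.conf.space ≤ L.bound := by
  have h1 := h.le_bound
  have h6 : (Fintype.card ι + 1) * ((cellsOf a.cnt).length + 1) =
      (Fintype.card ι + 1) * (cellsOf a.cnt).length + (Fintype.card ι + 1) := by ring
  simp only [counterCost] at h1
  simp [Mem.conf, length_cellCode]
  omega

theorem Run.whileDo_done {p : ρ → Bool} {c : Cmd m (Store ρ ι)} {a : Mem m ρ ι} (h : a.Fits L)
    (hp : p a.ctl = false) : Run L (Cmd.whileDo p c) a a :=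
  Exec.loop_done (space_conf_le h) hp

theorem Run.whileDo_next {p : ρ → Bool} {c : Cmd m (Store ρ ι)} {a b d : Mem m ρ ι}
    (hp : p a.ctl = true) (h : Run L c a b) (h' : Run L (Cmd.whileDo p c) b d) :
    Run L (Cmd.whileDo p c) a d :=
  Exec.loop_next hp h h'

/-- Change of the variables. -/
def modify (f : ρ → ρ) : Cmd m (Store ρ ι) := direct fun c => .isEmpty 1 fun _ => f c

theorem Run.modify {f : ρ → ρ} {a : Mem m ρ ι} (h : a.Fits L) :
    Run L (Cmd.modify f) a { a with ctl := f a.ctl } :=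
  exec_direct _ _ _ (fun _ => rfl) rfl rfl h.le_bound h.le_bound

/-- The empty program. -/
def skip : Cmd m (Store ρ ι) := modify id

theorem Run.skip {a : Mem m ρ ι} (h : a.Fits L) : Run L Cmd.skip a a := Run.modify (f := id) h

def readInput (i : Fin m) (f : ρ → Option Bool → ρ) : Cmd m (Store ρ ι) :=
  direct fun c => .read i (f c)

theorem Run.readInput {i : Fin m} {f : ρ → Option Bool → ρ} {a : Mem m ρ ι} (h : a.Fits L) :
    Run L (Cmd.readInput i f) a { a with
      ctl := f a.ctl (a.inp i).head?
      inp := Function.update a.inp i (a.inp i).tail } :=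
  exec_direct _ _ _ (fun _ => rfl) rfl rfl h.le_bound h.le_bound

def emitBit (v : ρ → Bool) : Cmd m (Store ρ ι) := direct fun c => .write (v c) c

theorem Run.emitBit {v : ρ → Bool} {a : Mem m ρ ι} (h : a.Fits L) :
    Run L (Cmd.emitBit v) a { a with out := a.out ++ [v a.ctl] } :=
  exec_direct _ _ _ (fun _ => rfl) rfl rfl h.le_bound h.le_bound

theorem update_twoStacks_one (a b c : List Bool) :
    Function.update (twoStacks 0 a b) 1 c = twoStacks 0 a c :=
  update_twoStacks_succ 0 a b c

theorem twoStacks_one (a b : List Bool) : twoStacks 0 a b 1 = b := twoStacks_succ 0 a b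

def pushSnd (v : ρ → Bool) (f : ρ → ρ) : Cmd m (Store ρ ι) := direct fun c => .push 1 (v c) (f c)

theorem Run.pushSnd {v : ρ → Bool} {f : ρ → ρ} {a : Mem m ρ ι} (h : a.Fits L)
    (h' : a.fst.length + a.snd.length + 1 + a.cnt L.big ≤ L.total) :
    Run L (Cmd.pushSnd v f) a { a with ctl := f a.ctl, snd := v a.ctl :: a.snd } := by
  have h2 : Mem.Fits L { a with ctl := f a.ctl, snd := v a.ctl :: a.snd } :=
    ⟨h.small, by simp; omega⟩
  exact exec_direct _ _ _ (fun X => by simp [Act.run, twoStacks_one, update_twoStacks_one])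
    rfl rfl h.le_bound h2.le_bound

def popSnd (f : ρ → Option Bool → ρ) : Cmd m (Store ρ ι) := direct fun c => .pop 1 (f c)

theorem Run.popSnd {f : ρ → Option Bool → ρ} {a : Mem m ρ ι} (h : a.Fits L) :
    Run L (Cmd.popSnd f) a { a with ctl := f a.ctl a.snd.head?, snd := a.snd.tail } := by
  have h2 : Mem.Fits L { a with ctl := f a.ctl a.snd.head?, snd := a.snd.tail } :=
    ⟨h.small, by have := h.total; simp; omega⟩
  exact exec_direct _ _ _ (fun X => by simp [Act.run, twoStacks_one, update_twoStacks_one])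
    rfl rfl h.le_bound h2.le_bound

/-! Operations on counters and on stack `0`. -/

theorem transduce_const_snd (v : Bool) (l : List (ι → Bool)) :
    transduce (fun v d => (v, some d)) v l = (v, l) := by
  induction l with
  | nil => rfl
  | cons d l ih => simp [transduce, ih]

theorem trackVal_append_zero (i : ι) (l : List (ι → Bool)) :
    trackVal i (l ++ [fun _ => false]) = trackVal i l := by
  induction l with
  | nil => simp [trackVal]
  | cons d l ih => simp [trackVal, ih]

/-- The bits of stack `0` lie beneath the counters, so the counters are swept aside unchanged while
the action takes place. -/
noncomputable def onFst (r : ρ → Act m ρ) : Cmd m (Store ρ ι) :=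
  counterOp false (fun v d => (v, d)) (fun _ _ => false) fun c _ => r c

theorem Run.onFst {r : ρ → Act m ρ} {a b : Mem m ρ ι} (h : a.Fits L) (h' : b.Fits L)
    (hr : ∀ X, (r a.ctl).run (Config.mk a.ctl a.inp (twoStacks 0 a.fst X) a.out) =
        ⟨b.ctl, b.inp, twoStacks 0 b.fst X, b.out⟩)
    (hcnt : b.cnt = a.cnt) (hsnd : b.snd = a.snd) : Run L (Cmd.onFst r) a b := by
  have h2 := h'.le_bound
  rw [hcnt, hsnd] at h2
  refine exec_counterOp _ _ _ _ _ _ false (cellsOf a.cnt) (transduce_const_snd _ _) ?_ hr hsnd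
    h.le_bound h2
  intro i
  rw [trackVal_append_zero, trackVal_cellsOf, hcnt]

noncomputable def pushFst (v : ρ → Bool) (f : ρ → ρ) : Cmd m (Store ρ ι) :=
  onFst fun c => .push 0 (v c) (f c)

theorem Run.pushFst {v : ρ → Bool} {f : ρ → ρ} {a : Mem m ρ ι} (h : a.Fits L)
    (h' : a.fst.length + a.snd.length + 1 + a.cnt L.big ≤ L.total) :
    Run L (Cmd.pushFst v f) a { a with ctl := f a.ctl, fst := v a.ctl :: a.fst } :=
  Run.onFst h ⟨h.small, by simp; omega⟩ (fun X => by simp [Act.run]) rfl rfl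

noncomputable def popFst (f : ρ → Option Bool → ρ) : Cmd m (Store ρ ι) :=
  onFst fun c => .pop 0 (f c)

theorem Run.popFst {f : ρ → Option Bool → ρ} {a : Mem m ρ ι} (h : a.Fits L) :
    Run L (Cmd.popFst f) a { a with ctl := f a.ctl a.fst.head?, fst := a.fst.tail } :=
  Run.onFst h ⟨h.small, by have := h.total; simp; omega⟩ (fun X => by simp [Act.run]) rfl rfl

variable [DecidableEq ι]

/-- Set a counter to the sum of two counters and a bit. -/
noncomputable def add (i j k : ι) (b : Bool) : Cmd m (Store ρ ι) :=
  counterOp b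
    (fun v d => ((d j && d k) || (d j && v) || (d k && v),
      Function.update d i (xor (xor (d j) (d k)) v)))
    (fun v => Function.update (fun _ => false) i v) fun c _ => .isEmpty 0 fun _ => c

/-- Each cell is read completely before track `i` is overwritten, so the three counters may
coincide; copying, incrementing and doubling are all instances. -/
theorem Run.add {i j k : ι} {b : Bool} {a : Mem m ρ ι} (h : a.Fits L) :
    Run L (Cmd.add i j k b) a
      { a with cnt := Function.update a.cnt i (a.cnt j + a.cnt k + b.toNat) } := by
  refine exec_counterOp _ _ _ _ _ _ _ _ rfl ?_ (fun X => rfl) rfl h.le_bound h.le_bound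
  -- School addition with an arbitrary incoming carry `v`, the outgoing carry being put into the
  -- additional cell.
  have key : ∀ (l : List (ι → Bool)) (v : Bool) (t : ι),
      trackVal t ((transduce (fun v d => ((d j && d k) || (d j && v) || (d k && v),
        some (Function.update d i (xor (xor (d j) (d k)) v)))) v l).2 ++
        [Function.update (fun _ => false) i (transduce (fun v d =>
          ((d j && d k) || (d j && v) || (d k && v),
          some (Function.update d i (xor (xor (d j) (d k)) v)))) v l).1]) =
      if t = i then trackVal j l + trackVal k l + v.toNat else trackVal t l := by
    intro l
    induction l with
    | nil =>
      intro v t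
      by_cases ht : t = i <;> simp [transduce, trackVal, ht]
    | cons d l ih =>
      intro v t
      simp only [transduce, Option.toList, List.cons_append, trackVal, ih, List.nil_append]
      by_cases ht : t = i
      · subst ht
        simp only [Function.update_self, if_true]
        cases d j <;> cases d k <;> cases v <;> simp <;> omega
      · simp [ht]
  intro t
  simp only [key, trackVal_cellsOf, Function.update_apply]

/-- Decrease a positive counter. -/
noncomputable def dec (i : ι) : Cmd m (Store ρ ι) :=
  counterOp true (fun v d => (!d i && v, Function.update d i (xor (d i) v)))
    (fun _ _ => false) fun c _ => .isEmpty 0 fun _ => c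

theorem Run.dec {i : ι} {a : Mem m ρ ι} (h : a.Fits L) (hi : 0 < a.cnt i) :
    Run L (Cmd.dec i) a { a with cnt := Function.update a.cnt i (a.cnt i - 1) } := by
  refine exec_counterOp _ _ _ _ _ _ _ _ rfl ?_ (fun X => rfl) rfl h.le_bound h.le_bound
  -- The incoming borrow never exceeds the remaining number; in particular no borrow is left at the
  -- end and the additional cell is zero.
  have key : ∀ (l : List (ι → Bool)) (v : Bool) (t : ι), v.toNat ≤ trackVal i l →
      trackVal t (transduce (fun v d => (!d i && v, some (Function.update d i (xor (d i) v))))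
        v l).2 = if t = i then trackVal i l - v.toNat else trackVal t l := by
    intro l
    induction l with
    | nil =>
      intro v t hv
      by_cases ht : t = i <;> simp [transduce, trackVal, ht]
    | cons d l ih =>
      intro v t hv
      simp only [trackVal] at hv
      simp only [transduce, Option.toList, List.cons_append, trackVal, List.nil_append]
      rw [ih _ _ (by cases h1 : d i <;> cases v <;> simp [h1] at hv ⊢; omega)]
      by_cases ht : t = i
      · subst ht
        simp only [Function.update_self, if_true]
        cases h1 : d t <;> cases v <;> simp [h1] at hv ⊢
        omega
      · simp [ht]
  intro t
  rw [trackVal_append_zero, key _ _ _ (by rw [trackVal_cellsOf]; exact hi)]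
  simp only [trackVal_cellsOf, Function.update_apply, Bool.toNat_true]

/-- Compare two counters. -/
noncomputable def less (i j : ι) (f : ρ → Bool → ρ) : Cmd m (Store ρ ι) :=
  counterOp false (fun v d => (if d i = d j then v else d j, d))
    (fun _ _ => false) fun c v => .isEmpty 0 fun _ => f c v

/-- Digits come least significant first, so a differing digit overrides the verdict of all earlier
ones, and an equal digit keeps it. -/
theorem Run.less {i j : ι} {f : ρ → Bool → ρ} {a : Mem m ρ ι} (h : a.Fits L) :
    Run L (Cmd.less i j f) a
      { a with ctl := f a.ctl (decide (a.cnt i < a.cnt j)) } := by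
  have key : ∀ (l : List (ι → Bool)) (v : Bool),
      transduce (fun v d => (if d i = d j then v else d j, some d)) v l =
        (decide (trackVal i l < trackVal j l ∨ trackVal i l = trackVal j l ∧ v = true), l) := by
    intro l
    induction l with
    | nil => intro v; simp [transduce, trackVal]
    | cons d l ih =>
      intro v
      simp only [transduce, ih, trackVal]
      refine Prod.ext ?_ rfl
      simp only
      congr 1
      cases d i <;> cases d j <;> cases v <;> simp <;> omega
  refine exec_counterOp _ _ _ _ _ _ (decide (a.cnt i < a.cnt j)) (cellsOf a.cnt) ?_ ?_
    (fun X => rfl) rfl h.le_bound h.le_bound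
  · rw [key]; simp [trackVal_cellsOf]
  · intro t
    rw [trackVal_append_zero, trackVal_cellsOf]

end Cmd

/-! ### Access to the array and the simulated stacks -/

/-- Names of counters: `I`, `J` are positions in the array on stack `1` (program and output),
`L` is the length of the program, `N` the length of the array, `G` the amount of free space,
`T` a temporary counter, `K` a bound, `C` a cap, `P` a power of two, `Z` is always zero. -/
inductive Name : Type where
  | I | J | L | N | G | T | K | C | P | Z
deriving DecidableEq

instance : Fintype Name := ⟨{.I, .J, .L, .N, .G, .T, .K, .C, .P, .Z}, fun x => by cases x <;> decide⟩

/-- Variables with finitely many values. -/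
structure Vars (κ : Type) : Type where
  ok : Bool
  buf : Bool
  val : Option Bool
  res : Bool
  more : Bool
  ctl : κ

instance {κ : Type} [Finite κ] : Finite (Vars κ) :=
  Finite.of_injective (fun s : Vars κ => (s.ok, s.buf, s.val, s.res, s.more, s.ctl))
    fun s t h => by cases s; cases t; simp_all

namespace Cmd

variable {κ F : Type} [Fintype F] [DecidableEq F] {L : Limits (Name ⊕ F)}

/-- Programs of the kind used for deciding complexity. -/
abbrev Prog (κ F : Type) : Type 1 := Cmd 3 (Store (Vars κ) (Name ⊕ F))

theorem Run.of_eq {c : Prog κ F} {a b b' : Mem 3 (Vars κ) (Name ⊕ F)} (h : Run L c a b)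
    (hb : b = b') : Run L c a b' := hb ▸ h

theorem update_cancel {ι : Type} [DecidableEq ι] (c : ι → ℕ) (i : ι) (v w : ℕ) (h : c i = w) :
    Function.update (Function.update c i v) i w = c := by
  rw [Function.update_idem, ← h, Function.update_eq_self]

/-- Test whether a counter is less than another one. -/
noncomputable def test (i j : Name ⊕ F) : Prog κ F := less i j fun v b => { v with ok := b }

theorem Run.test {i j : Name ⊕ F} {a : Mem 3 (Vars κ) (Name ⊕ F)} (h : a.Fits L) :
    Run L (Cmd.test i j) a
      { a with ctl := { a.ctl with ok := decide (a.cnt i < a.cnt j) } } :=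
  Run.less h

theorem fits_congr {a b : Mem 3 (Vars κ) (Name ⊕ F)} (h : a.Fits L) (hc : b.cnt = a.cnt)
    (ht : b.fst.length + b.snd.length ≤ a.fst.length + a.snd.length) : b.Fits L :=
  ⟨fun i hi => hc ▸ h.small i hi, by rw [hc]; have := h.total; omega⟩

theorem fits_update {a b : Mem 3 (Vars κ) (Name ⊕ F)} {i : Name ⊕ F} {n : ℕ} (h : a.Fits L)
    (hi : i ≠ L.big) (hn : n ≤ L.small) (hc : b.cnt = Function.update a.cnt i n)
    (ht : b.fst.length + b.snd.length ≤ a.fst.length + a.snd.length) : b.Fits L := by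
  refine ⟨fun j hj => ?_, ?_⟩
  · rw [hc, Function.update_apply]
    split_ifs
    · exact hn
    · exact h.small j hj
  · rw [hc, Function.update_of_ne hi.symm]
    have := h.total; omega

/-- Move as many bits as counter `T` says from stack `0` to stack `1`. -/
noncomputable def flushToSnd : Prog κ F :=
  .seq (test (.inl .Z) (.inl .T)) (whileDo Vars.ok
    (.seq (popFst fun v b => { v with buf := b.getD false })
      (.seq (pushSnd Vars.buf fun v => { v with buf := false })
        (.seq (dec (.inl .T)) (test (.inl .Z) (.inl .T))))))

/-- Move as many bits as counter `T` says from stack `1` to stack `0`. -/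
noncomputable def flushToFst : Prog κ F :=
  .seq (test (.inl .Z) (.inl .T)) (whileDo Vars.ok
    (.seq (popSnd fun v b => { v with buf := b.getD false })
      (.seq (pushFst Vars.buf fun v => { v with buf := false })
        (.seq (dec (.inl .T)) (test (.inl .Z) (.inl .T))))))

theorem Run.flushToSnd (hL : L.big ≠ .inl .T) {v : Vars κ} {c : Name ⊕ F → ℕ}
    {inp : Fin 3 → List Bool} {l fst snd out : List Bool}
    (hf : Mem.Fits L ⟨v, c, inp, l ++ fst, snd, out⟩)
    (hZ : c (.inl .Z) = 0) (hT : c (.inl .T) = l.length) (hv : v.buf = false) :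
    Run L Cmd.flushToSnd ⟨v, c, inp, l ++ fst, snd, out⟩
      ⟨{ v with ok := false }, Function.update c (.inl .T) 0, inp, fst, l.reverse ++ snd, out⟩ := by
  refine Run.seq (Run.test hf) ?_
  simp only
  induction l generalizing snd c v with
  | nil =>
    simp only [hZ, hT, List.length_nil, lt_self_iff_false, decide_false, List.nil_append,
      List.reverse_nil]
    rw [show (0 : ℕ) = c (.inl .T) by rw [hT]; rfl, Function.update_eq_self]
    exact Run.whileDo_done (fits_congr hf rfl (by simp)) rfl
  | cons b l ih =>
    have h1 : decide (c (.inl .Z) < c (.inl .T)) = true := by simp [hZ, hT]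
    rw [h1]
    have hc : Function.update c (.inl .T) (c (.inl .T) - 1) (.inl .T) = l.length := by simp [hT]
    have hf2 : Mem.Fits L ⟨{ v with ok := true, buf := false },
        Function.update c (.inl .T) (c (.inl .T) - 1), inp, l ++ fst, b :: snd, out⟩ := by
      refine fits_update hf hL.symm (n := c (.inl .T) - 1) ?_ rfl (by simp; omega)
      exact (Nat.sub_le _ _).trans (hf.small (.inl .T) hL.symm)
    refine Run.whileDo_next rfl (Run.seq (Run.popFst (fits_congr hf rfl (by simp)))
      (Run.seq (Run.pushSnd ?_ ?_) (Run.seq (Run.dec ?_ ?_) (Run.test ?_)))) ?_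
    · exact fits_congr hf rfl (by simp)
    · have := hf.total; simp at this ⊢; omega
    · exact fits_congr hf rfl (by simp; omega)
    · simp [hT]
    · refine fits_congr hf2 rfl (by simp)
    · have := ih (v := { v with ok := true, buf := false }) (snd := b :: snd) hf2
        (by simp [hZ]) hc rfl
      simp only [Function.update_idem] at this
      simpa [hv] using this

theorem Run.flushToFst (hL : L.big ≠ .inl .T) {v : Vars κ} {c : Name ⊕ F → ℕ}
    {inp : Fin 3 → List Bool} {l fst snd out : List Bool}
    (hf : Mem.Fits L ⟨v, c, inp, fst, l ++ snd, out⟩)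
    (hZ : c (.inl .Z) = 0) (hT : c (.inl .T) = l.length) (hv : v.buf = false) :
    Run L Cmd.flushToFst ⟨v, c, inp, fst, l ++ snd, out⟩
      ⟨{ v with ok := false }, Function.update c (.inl .T) 0, inp, l.reverse ++ fst, snd, out⟩ := by
  refine Run.seq (Run.test hf) ?_
  simp only
  induction l generalizing fst c v with
  | nil =>
    simp only [hZ, hT, List.length_nil, lt_self_iff_false, decide_false, List.nil_append,
      List.reverse_nil]
    rw [show (0 : ℕ) = c (.inl .T) by rw [hT]; rfl, Function.update_eq_self]
    exact Run.whileDo_done (fits_congr hf rfl (by simp)) rfl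
  | cons b l ih =>
    have h1 : decide (c (.inl .Z) < c (.inl .T)) = true := by simp [hZ, hT]
    rw [h1]
    have hc : Function.update c (.inl .T) (c (.inl .T) - 1) (.inl .T) = l.length := by simp [hT]
    have hf2 : Mem.Fits L ⟨{ v with ok := true, buf := false },
        Function.update c (.inl .T) (c (.inl .T) - 1), inp, b :: fst, l ++ snd, out⟩ := by
      refine fits_update hf hL.symm (n := c (.inl .T) - 1) ?_ rfl (by simp; omega)
      exact (Nat.sub_le _ _).trans (hf.small (.inl .T) hL.symm)
    refine Run.whileDo_next rfl (Run.seq (Run.popSnd (fits_congr hf rfl (by simp)))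
      (Run.seq (Run.pushFst ?_ ?_) (Run.seq (Run.dec ?_ ?_) (Run.test ?_)))) ?_
    · exact fits_congr hf rfl (by simp)
    · have := hf.total; simp at this ⊢; omega
    · exact fits_congr hf rfl (by simp; omega)
    · simp [hT]
    · refine fits_congr hf2 rfl (by simp)
    · have := ih (v := { v with ok := true, buf := false }) (fst := b :: fst) hf2
        (by simp [hZ]) hc rfl
      simp only [Function.update_idem] at this
      simpa [hv] using this

/-- Copy a counter. -/
noncomputable def copy (i j : Name ⊕ F) : Prog κ F := add i j (.inl .Z) false

noncomputable def inc (i : Name ⊕ F) : Prog κ F := add i i (.inl .Z) true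

theorem Run.copy {i j : Name ⊕ F} {a : Mem 3 (Vars κ) (Name ⊕ F)} (h : a.Fits L)
    (hZ : a.cnt (.inl .Z) = 0) :
    Run L (Cmd.copy i j) a { a with cnt := Function.update a.cnt i (a.cnt j) } :=
  (Run.add h).of_eq (by simp [hZ])

theorem Run.inc {i : Name ⊕ F} {a : Mem 3 (Vars κ) (Name ⊕ F)} (h : a.Fits L)
    (hZ : a.cnt (.inl .Z) = 0) :
    Run L (Cmd.inc i) a { a with cnt := Function.update a.cnt i (a.cnt i + 1) } :=
  (Run.add h).of_eq (by simp [hZ])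

/-- The copy in `T` is counted down to zero, so counter `i` survives and `T` is ready for the next
use. Moving bits between the stacks does not change the total size. -/
noncomputable def moveToSnd (i : Name ⊕ F) : Prog κ F := .seq (copy (.inl .T) i) flushToSnd

noncomputable def moveToFst (i : Name ⊕ F) : Prog κ F := .seq (copy (.inl .T) i) flushToFst

theorem Run.moveToSnd (hL : L.big ≠ .inl .T) {i : Name ⊕ F} (hi : i ≠ L.big)
    {v : Vars κ} {c : Name ⊕ F → ℕ}
    {inp : Fin 3 → List Bool} {l fst snd out : List Bool}
    (hf : Mem.Fits L ⟨v, c, inp, l ++ fst, snd, out⟩)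
    (hZ : c (.inl .Z) = 0) (hT : c (.inl .T) = 0) (hl : c i = l.length) (hv : v.buf = false) :
    Run L (Cmd.moveToSnd i) ⟨v, c, inp, l ++ fst, snd, out⟩
      ⟨{ v with ok := false }, c, inp, fst, l.reverse ++ snd, out⟩ := by
  refine Run.seq (Run.copy hf hZ) ?_
  refine (Run.flushToSnd hL (v := v) (c := Function.update c (.inl .T) (c i)) ?_
    (by simp [hZ]) (by simp [hl]) hv).of_eq (by rw [update_cancel _ _ _ _ hT])
  exact fits_update hf hL.symm (hf.small i hi) rfl le_rfl

theorem Run.moveToFst (hL : L.big ≠ .inl .T) {i : Name ⊕ F} (hi : i ≠ L.big)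
    {v : Vars κ} {c : Name ⊕ F → ℕ}
    {inp : Fin 3 → List Bool} {l fst snd out : List Bool}
    (hf : Mem.Fits L ⟨v, c, inp, fst, l ++ snd, out⟩)
    (hZ : c (.inl .Z) = 0) (hT : c (.inl .T) = 0) (hl : c i = l.length) (hv : v.buf = false) :
    Run L (Cmd.moveToFst i) ⟨v, c, inp, fst, l ++ snd, out⟩
      ⟨{ v with ok := false }, c, inp, l.reverse ++ fst, snd, out⟩ := by
  refine Run.seq (Run.copy hf hZ) ?_
  refine (Run.flushToFst hL (v := v) (c := Function.update c (.inl .T) (c i)) ?_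
    (by simp [hZ]) (by simp [hl]) hv).of_eq (by rw [update_cancel _ _ _ _ hT])
  exact fits_update hf hL.symm (hf.small i hi) rfl le_rfl

/-- Fetch the bit at position `i` of the array on stack `1`. -/
noncomputable def fetch (i : Name ⊕ F) : Prog κ F :=
  .seq (moveToFst i) (.seq (popSnd fun v b => { v with val := b })
    (.seq (pushSnd (fun v => v.val.getD false) id) (moveToSnd i)))

theorem Run.fetch (hL : L.big ≠ .inl .T) {i : Name ⊕ F} (hi : i ≠ L.big)
    {v : Vars κ} {c : Name ⊕ F → ℕ}
    {inp : Fin 3 → List Bool} {fst snd out : List Bool}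
    (hf : Mem.Fits L ⟨v, c, inp, fst, snd, out⟩)
    (hZ : c (.inl .Z) = 0) (hT : c (.inl .T) = 0) (hl : c i < snd.length) (hv : v.buf = false) :
    Run L (Cmd.fetch i) ⟨v, c, inp, fst, snd, out⟩
      ⟨{ v with ok := false, val := snd[c i]? }, c, inp, fst, snd, out⟩ := by
  obtain ⟨l, b, r, rfl, hlen⟩ : ∃ l b r, snd = l ++ b :: r ∧ c i = l.length := by
    refine ⟨snd.take (c i), snd[c i], snd.drop (c i + 1), ?_, by simp; omega⟩
    rw [List.getElem_cons_drop, List.take_append_drop]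
  have hf0 := hf.total
  simp only [List.length_append, List.length_cons] at hf0
  refine Run.seq (Run.moveToFst hL hi hf hZ hT hlen hv) (Run.seq (Run.popSnd ?_)
    (Run.seq (Run.pushSnd ?_ ?_) ?_))
  · exact fits_congr hf rfl (by simp; omega)
  · exact ⟨hf.small, by simp; omega⟩
  · simp; omega
  · refine (Run.moveToSnd hL hi (l := l.reverse) (v := { v with ok := false, val := some b }) (fits_congr hf rfl (by simp; omega)) hZ hT
      (by simp [hlen]) hv).of_eq ?_
    simp [hlen]

/-- Push the bit `val` on stack `t` of the machine that is simulated. -/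
noncomputable def stackPush (t : Fin 2) : Prog κ F :=
  if t = 0 then pushFst (fun v => v.val.getD false) fun v => { v with ok := false, val := none }
  -- The simulated stack `1` lies beneath the array of `N` bits, which is moved aside and put back.
  else .seq (moveToFst (.inl .N))
    (.seq (pushSnd (fun v => v.val.getD false) fun v => { v with ok := false, val := none })
      (moveToSnd (.inl .N)))

/-- Pop a bit from stack `t` of the machine that is simulated. -/
noncomputable def stackPop (t : Fin 2) : Prog κ F :=
  if t = 0 then popFst fun v b => { v with ok := false, val := b }
  else .seq (moveToFst (.inl .N))
    (.seq (popSnd fun v b => { v with ok := false, val := b }) (moveToSnd (.inl .N)))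

theorem Run.stackPush (hL : L.big ≠ .inl .T) (hN : .inl .N ≠ L.big) (t : Fin 2) {b : Bool}
    {v : Vars κ} {c : Name ⊕ F → ℕ}
    {inp : Fin 3 → List Bool} {st : Fin 2 → List Bool} {l out : List Bool}
    (hf : Mem.Fits L ⟨v, c, inp, st 0, l ++ st 1, out⟩)
    (hf' : (st 0).length + (l.length + (st 1).length) + 1 + c L.big ≤ L.total)
    (hZ : c (.inl .Z) = 0) (hT : c (.inl .T) = 0) (hl : c (.inl .N) = l.length)
    (hv : v.buf = false) (hb : v.val = some b) :
    Run L (Cmd.stackPush t) ⟨v, c, inp, st 0, l ++ st 1, out⟩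
      ⟨{ v with ok := false, val := none }, c, inp, Function.update st t (b :: st t) 0,
        l ++ Function.update st t (b :: st t) 1, out⟩ := by
  unfold Cmd.stackPush
  obtain rfl | rfl : t = 0 ∨ t = 1 := by fin_cases t <;> simp
  · rw [if_pos rfl]
    refine (Run.pushFst hf (by simpa [add_assoc] using hf')).of_eq ?_
    simp [hb]
  · rw [if_neg (by simp)]
    refine Run.seq (Run.moveToFst hL hN hf hZ hT hl hv) (Run.seq (Run.pushSnd ?_ ?_) ?_)
    · exact fits_congr hf rfl (by simp; omega)
    · simp; omega
    · refine (Run.moveToSnd hL hN (l := l.reverse)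
        (v := { v with ok := false, val := none }) ?_ hZ hT (by simp [hl]) hv).of_eq ?_
      · exact ⟨hf.small, by simp; omega⟩
      · simp [hb]

theorem Run.stackPop (hL : L.big ≠ .inl .T) (hN : .inl .N ≠ L.big) (t : Fin 2)
    {v : Vars κ} {c : Name ⊕ F → ℕ}
    {inp : Fin 3 → List Bool} {st : Fin 2 → List Bool} {l out : List Bool}
    (hf : Mem.Fits L ⟨v, c, inp, st 0, l ++ st 1, out⟩)
    (hZ : c (.inl .Z) = 0) (hT : c (.inl .T) = 0) (hl : c (.inl .N) = l.length)
    (hv : v.buf = false) :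
    Run L (Cmd.stackPop t) ⟨v, c, inp, st 0, l ++ st 1, out⟩
      ⟨{ v with ok := false, val := (st t).head? }, c, inp, Function.update st t (st t).tail 0,
        l ++ Function.update st t (st t).tail 1, out⟩ := by
  unfold Cmd.stackPop
  obtain rfl | rfl : t = 0 ∨ t = 1 := by fin_cases t <;> simp
  · rw [if_pos rfl]
    refine (Run.popFst hf).of_eq ?_
    simp
  · rw [if_neg (by simp)]
    refine Run.seq (Run.moveToFst hL hN hf hZ hT hl hv) (Run.seq (Run.popSnd ?_) ?_)
    · exact fits_congr hf rfl (by simp; omega)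
    · refine (Run.moveToSnd hL hN (l := l.reverse)
        (v := { v with ok := false, val := (st 1).head? }) (fits_congr hf rfl (by simp; omega)) hZ hT
        (by simp [hl]) hv).of_eq ?_
      simp

end Cmd

/-! ### Reversible instructions and their implementation -/

/-- Reversible guarded instructions. The flag `o` tells the output string from the program. -/
inductive Instr : Type where
  | adv (o b : Bool)
  | ret (o b : Bool)
  | eof
  | push (t : Fin 2) (b : Bool)
  | pop (t : Fin 2) (b : Bool)
  | empty (t : Fin 2) (b : Bool)
  | start
  | nop
  | fail

/-- The data of a configuration of the simulated machine: the number of bits read from the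
program and written on the output tape, and the stacks. -/
@[ext]
structure Dat : Type where
  pos : Bool → ℕ
  st : Fin 2 → List Bool

def Dat.space (d : Dat) : ℕ := (d.st 0).length + (d.st 1).length

/-- The data occur in a computation with program `W false` and output `W true` in space `s`. -/
structure Dat.Valid (W : Bool → List Bool) (s : ℕ) (d : Dat) : Prop where
  pos_le : ∀ o, d.pos o ≤ (W o).length
  space_le : d.space ≤ s

namespace Instr

/-- The guards contain the answers, so every instruction is injective on valid data where it is
defined. Writing an output bit becomes `adv true b`, a comparison with the expected output, so that
the output is never stored twice and the step can be undone. -/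
def sem (W : Bool → List Bool) (s : ℕ) : Instr → Dat → Option Dat
  | adv o b, d => if (W o)[d.pos o]? = some b then
      some { d with pos := Function.update d.pos o (d.pos o + 1) } else none
  | ret o b, d => if 0 < d.pos o ∧ (W o)[d.pos o - 1]? = some b then
      some { d with pos := Function.update d.pos o (d.pos o - 1) } else none
  | eof, d => if d.pos false = (W false).length then some d else none
  | push t b, d => if d.space < s then
      some { d with st := Function.update d.st t (b :: d.st t) } else none
  | pop t b, d => if (d.st t).head? = some b then
      some { d with st := Function.update d.st t (d.st t).tail } else none
  | empty t b, d => if (d.st t).isEmpty = b then some d else none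
  | start, d => if d.st 0 = [] ∧ d.st 1 = [] ∧ d.pos false = 0 ∧ d.pos true = 0 then some d
      else none
  | nop, d => some d
  | fail, _ => none

/-- The remaining instructions are partial identities and therefore their own inverses. -/
def inv : Instr → Instr
  | adv o b => ret o b
  | ret o b => adv o b
  | push t b => pop t b
  | pop t b => push t b
  | i => i

end Instr

theorem Dat.space_update (d : Dat) (t : Fin 2) (l : List Bool) :
    (Dat.mk d.pos (Function.update d.st t l)).space + (d.st t).length = d.space + l.length := by
  obtain rfl | rfl : t = 0 ∨ t = 1 := by fin_cases t <;> simp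
  · simp [Dat.space]; omega
  · simp [Dat.space]; omega

theorem Instr.sem_valid {W : Bool → List Bool} {s : ℕ} {i : Instr} {d e : Dat}
    (hd : d.Valid W s) (h : i.sem W s d = some e) : e.Valid W s := by
  have hlt : ∀ {l : List Bool} {k : ℕ} {b : Bool}, l[k]? = some b → k < l.length := by
    intro l k b h
    by_contra hk
    rw [List.getElem?_eq_none (by omega)] at h
    cases h
  cases i with
  | adv o b =>
    simp only [sem, Option.ite_none_right_eq_some, Option.some.injEq] at h
    obtain ⟨h1, rfl⟩ := h
    refine ⟨fun o' => ?_, hd.space_le⟩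
    simp only [Function.update_apply]
    split_ifs with ho
    · subst ho; exact hlt h1
    · exact hd.pos_le o'
  | ret o b =>
    simp only [sem, Option.ite_none_right_eq_some, Option.some.injEq] at h
    obtain ⟨h1, rfl⟩ := h
    refine ⟨fun o' => ?_, hd.space_le⟩
    simp only [Function.update_apply]
    have := hd.pos_le o'
    split_ifs with ho
    · subst ho; omega
    · exact this
  | push t b =>
    simp only [sem, Option.ite_none_right_eq_some, Option.some.injEq] at h
    obtain ⟨h1, rfl⟩ := h
    refine ⟨hd.pos_le, ?_⟩
    have := d.space_update t (b :: d.st t)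
    simp at this; omega
  | pop t b =>
    simp only [sem, Option.ite_none_right_eq_some, Option.some.injEq] at h
    obtain ⟨h1, rfl⟩ := h
    refine ⟨hd.pos_le, ?_⟩
    have := d.space_update t (d.st t).tail
    have := hd.space_le
    simp at *; omega
  | eof => simp only [sem, Option.ite_none_right_eq_some, Option.some.injEq] at h; exact h.2 ▸ hd
  | empty t b =>
    simp only [sem, Option.ite_none_right_eq_some, Option.some.injEq] at h; exact h.2 ▸ hd
  | start =>
    simp only [sem, Option.ite_none_right_eq_some, Option.some.injEq] at h; exact h.2 ▸ hd
  | nop => simp only [sem, Option.some.injEq] at h; exact h ▸ hd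
  | fail => simp [sem] at h

theorem Instr.inv_inv (i : Instr) : i.inv.inv = i := by cases i <;> rfl

/-- Validity matters only for `pop`: its inverse `push` asks for free space, which exists because
the data before the `pop` respected the bound. -/
theorem Instr.sem_inv_of_sem {W : Bool → List Bool} {s : ℕ} {i : Instr} {d e : Dat}
    (hd : d.Valid W s) (h : i.sem W s d = some e) : i.inv.sem W s e = some d := by
  cases i with
  | adv o b =>
    simp only [sem, Option.ite_none_right_eq_some, Option.some.injEq] at h
    obtain ⟨h1, rfl⟩ := h
    simp [inv, sem, h1]
  | ret o b =>
    simp only [sem, Option.ite_none_right_eq_some, Option.some.injEq] at h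
    obtain ⟨h1, rfl⟩ := h
    have h2 : d.pos o - 1 + 1 = d.pos o := by omega
    simp [inv, sem, h1.2, h2]
  | push t b =>
    simp only [sem, Option.ite_none_right_eq_some, Option.some.injEq] at h
    obtain ⟨h1, rfl⟩ := h
    simp [inv, sem]
  | pop t b =>
    simp only [sem, Option.ite_none_right_eq_some, Option.some.injEq] at h
    obtain ⟨h1, rfl⟩ := h
    obtain ⟨l, hl⟩ : ∃ l, d.st t = b :: l := by
      cases hs : d.st t with
      | nil => simp [hs] at h1
      | cons c l => simp [hs] at h1; exact ⟨l, by rw [h1]⟩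
    have h2 := d.space_update t l
    have h3 := hd.space_le
    simp only [hl, List.length_cons] at h2
    simp only [inv, sem, hl, List.tail_cons, Function.update_self, Function.update_idem]
    rw [if_pos (by omega), ← hl, Function.update_eq_self]
  | eof | empty t b | start =>
    have h' := h
    simp only [sem, Option.ite_none_right_eq_some, Option.some.injEq] at h'
    obtain ⟨-, rfl⟩ := h'
    exact h
  | nop => simp only [sem, Option.some.injEq] at h; subst h; rfl
  | fail => simp [sem] at h

theorem Instr.sem_inv_iff {W : Bool → List Bool} {s : ℕ} {i : Instr} {d e : Dat}
    (hd : d.Valid W s) (he : e.Valid W s) :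
    i.sem W s d = some e ↔ i.inv.sem W s e = some d := by
  refine ⟨sem_inv_of_sem hd, fun h => ?_⟩
  have := sem_inv_of_sem he h
  rwa [inv_inv] at this

/-- What does not change during the search for a computation. -/
structure Env (F : Type) : Type where
  W : Bool → List Bool
  s : ℕ
  k : ℕ
  c : ℕ
  pw : ℕ
  dp : F → ℕ
  inp : Fin 3 → List Bool
  out : List Bool

namespace Env

variable {κ F : Type}

/-- Program and expected output form one array, so output positions are shifted by the length of the
program. The space bound itself is not stored, only its difference from the space in use. -/
def cnt (Γ : Env F) (d : Dat) : Name ⊕ F → ℕ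
  | .inl .I => d.pos false
  | .inl .J => (Γ.W false).length + d.pos true
  | .inl .L => (Γ.W false).length
  | .inl .N => (Γ.W false).length + (Γ.W true).length
  | .inl .G => Γ.s - d.space
  | .inl .T => 0
  | .inl .K => Γ.k
  | .inl .C => Γ.c
  | .inl .P => Γ.pw
  | .inl .Z => 0
  | .inr f => Γ.dp f

def mem (Γ : Env F) (v : Vars κ) (d : Dat) : Mem 3 (Vars κ) (Name ⊕ F) :=
  ⟨v, Γ.cnt d, Γ.inp, d.st 0, (Γ.W false ++ Γ.W true) ++ d.st 1, Γ.out⟩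

structure Fits (Γ : Env F) (L : Limits (Name ⊕ F)) : Prop where
  big : L.big = .inl .G
  length_le : (Γ.W false).length + (Γ.W true).length ≤ L.small
  k_le : Γ.k ≤ L.small
  c_le : Γ.c ≤ L.small
  pw_le : Γ.pw ≤ L.small
  dp_le : ∀ f, Γ.dp f ≤ L.small
  total : Γ.s + ((Γ.W false).length + (Γ.W true).length) ≤ L.total

/-- The simulated stacks and the counter `G` always add up to `s`, so the total is the same for all
valid data. -/
theorem Fits.mem {Γ : Env F} {L : Limits (Name ⊕ F)} (h : Γ.Fits L) {d : Dat}
    (hd : d.Valid Γ.W Γ.s) (v : Vars κ) : (Γ.mem v d).Fits L := by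
  have h1 := hd.pos_le false
  have h2 := hd.pos_le true
  have h3 := h.length_le
  refine ⟨?_, ?_⟩
  · rintro (i | f) hi
    · cases i <;> simp only [Env.mem, cnt] <;> first | omega | skip
      · exact absurd h.big.symm hi
      · exact h.k_le
      · exact h.c_le
      · exact h.pw_le
    · exact h.dp_le f
  · rw [h.big]
    have h4 := h.total
    have h5 := hd.space_le
    simp only [Env.mem, cnt, List.length_append, Dat.space] at *
    omega

/-- The counter holding a position, and those holding the limits for it. -/
def reg (o : Bool) : Name ⊕ F := .inl (if o then .J else .I)
def low (o : Bool) : Name ⊕ F := .inl (if o then .L else .Z)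
def high (o : Bool) : Name ⊕ F := .inl (if o then .N else .L)

end Env

namespace Cmd

variable {κ F : Type} [Fintype F] [DecidableEq F] {L : Limits (Name ⊕ F)}

def success (v : Vars κ) : Vars κ := { v with ok := true, val := none }
def failure (v : Vars κ) : Vars κ := { v with ok := false, val := none }

/-- The request `isEmpty` would see the counters or the array. Emptiness of a simulated stack is
tested by popping a bit and, if there was one, pushing it back. -/
noncomputable def emptyCode (t : Fin 2) (b : Bool) : Prog κ F :=
  .seq (stackPop t) (cond (fun v => v.val.isNone) (modify fun v => { v with ok := b })
    (.seq (stackPush t) (modify fun v => { v with ok := !b })))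

/-- Execute an instruction if its guard holds, and tell whether this was so. -/
noncomputable def instr : Instr → Prog κ F
  | .adv o b => .seq (test (Env.reg o) (Env.high o)) (cond Vars.ok
      (.seq (fetch (Env.reg o)) (cond (fun v => v.val == some b)
        (.seq (inc (Env.reg o)) (modify success)) (modify failure))) skip)
  -- The bit to be checked is left of the position, so the position is decreased first, and
  -- increased again if the bit is wrong.
  | .ret o b => .seq (test (Env.low o) (Env.reg o)) (cond Vars.ok
      (.seq (dec (Env.reg o)) (.seq (fetch (Env.reg o)) (cond (fun v => v.val == some b)
        (modify success) (.seq (inc (Env.reg o)) (modify failure))))) skip)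
  | .eof => .seq (test (.inl .I) (.inl .L)) (modify fun v => { v with ok := !v.ok })
  -- The free space is decreased before the bit is pushed, and for `pop` it is increased after the
  -- bit is removed, so that the limits hold at every moment.
  | .push t b => .seq (test (.inl .Z) (.inl .G)) (cond Vars.ok
      (.seq (dec (.inl .G)) (.seq (modify fun v => { v with val := some b })
        (.seq (stackPush t) (modify success)))) skip)
  | .pop t b => .seq (stackPop t) (cond (fun v => v.val == some b)
      (.seq (inc (.inl .G)) (modify success))
      (.seq (cond (fun v => v.val.isSome) (stackPush t) skip) (modify failure)))
  | .empty t b => emptyCode t b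
  | .start => .seq (emptyCode 0 true) (cond Vars.ok (.seq (emptyCode 1 true) (cond Vars.ok
      (.seq (test (.inl .Z) (.inl .I)) (cond Vars.ok (modify failure)
        (.seq (test (.inl .L) (.inl .J)) (modify fun v => { v with ok := !v.ok })))) skip)) skip)
  | .nop => modify success
  | .fail => modify failure

variable {Γ : Env F}

/-- The counter `G` has not been adjusted yet, so the resulting memory is an intermediate one, from
which the `pop` can be either completed or undone. -/
theorem Run.mem_stackPop (hΓ : Γ.Fits L) (t : Fin 2) {v : Vars κ} {d : Dat}
    (hd : d.Valid Γ.W Γ.s) (hv : v.buf = false) :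
    Run L (Cmd.stackPop t) (Γ.mem v d)
      { Γ.mem { v with ok := false, val := (d.st t).head? }
          { d with st := Function.update d.st t (d.st t).tail } with cnt := Γ.cnt d } :=
  Run.stackPop (by rw [hΓ.big]; simp) (by rw [hΓ.big]; simp) t (hΓ.mem hd v) rfl rfl
    (by simp [Env.cnt]) hv

/-- Undo `stackPop`. -/
theorem Run.mem_stackPush (hΓ : Γ.Fits L) (t : Fin 2) {v : Vars κ} {d : Dat} {b : Bool}
    (hd : d.Valid Γ.W Γ.s) (hv : v.buf = false) (hb : (d.st t).head? = some b)
    (hval : v.val = some b) :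
    Run L (Cmd.stackPush t)
      { Γ.mem v { d with st := Function.update d.st t (d.st t).tail } with cnt := Γ.cnt d }
      (Γ.mem { v with ok := false, val := none } d) := by
  obtain ⟨l, hl⟩ : ∃ l, d.st t = b :: l := by
    cases hs : d.st t with
    | nil => simp [hs] at hb
    | cons c l => simp [hs] at hb; exact ⟨l, by rw [hb]⟩
  have h1 := d.space_update t l
  have h2 := (hΓ.mem hd v).total
  simp only [hl, List.length_cons, Dat.space] at h1
  simp only [Env.mem, List.length_append] at h2
  have h3 := List.length_append (as := Γ.W false) (bs := Γ.W true)
  refine (Run.stackPush (st := Function.update d.st t (d.st t).tail) (c := Γ.cnt d)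
    (by rw [hΓ.big]; simp) (by rw [hΓ.big]; simp) t ⟨(hΓ.mem hd v).small, ?_⟩ ?_ rfl rfl
    (by simp [Env.cnt]) hv hval).of_eq ?_
  · simp only [hl, List.tail_cons, List.length_append] at *; omega
  · simp only [hl, List.tail_cons, List.length_append] at *; omega
  · simp only [Function.update_self, Function.update_idem, hl, List.tail_cons]
    rw [← hl, Function.update_eq_self]; rfl

theorem Run.emptyCode (hΓ : Γ.Fits L) (t : Fin 2) (b : Bool) {v : Vars κ} {d : Dat}
    (hd : d.Valid Γ.W Γ.s) (hv : v.buf = false) :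
    Run L (Cmd.emptyCode t b) (Γ.mem v d)
      (Γ.mem { v with ok := decide ((d.st t).isEmpty = b), val := none } d) := by
  refine Run.seq (Run.mem_stackPop hΓ t hd hv) ?_
  cases hs : d.st t with
  | nil =>
    have h1 : Function.update d.st t (d.st t).tail = d.st := by
      rw [hs, List.tail_nil, ← hs, Function.update_eq_self]
    rw [hs] at h1
    refine Run.cond_true rfl ((Run.modify ?_).of_eq ?_)
    · simp only [h1]; exact hΓ.mem hd _
    · simp only [h1]
      cases b <;> simp [Env.mem]
  | cons c l =>
    refine Run.cond_false rfl ?_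
    have := Run.mem_stackPush hΓ t (v := { v with ok := false, val := some c }) (b := c) hd hv
      (by simp [hs]) rfl
    rw [hs] at this
    refine Run.seq this ((Run.modify (hΓ.mem hd _)).of_eq ?_)
    cases b <;> simp [Env.mem]

theorem Env_getElem? (W : Bool → List Bool) (l : List Bool) (o : Bool) (k : ℕ)
    (hk : k < (W o).length) :
    ((W false ++ W true) ++ l)[(if o then (W false).length else 0) + k]? = (W o)[k]? := by
  cases o
  · simp at hk ⊢
    rw [List.getElem?_append_left (by omega)]
  · simp only [if_true]
    rw [List.append_assoc, List.getElem?_append_right (by omega),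
      List.getElem?_append_left (by omega)]
    simp

theorem cnt_reg (Γ : Env F) (d : Dat) (o : Bool) :
    Γ.cnt d (Env.reg o) = (if o then (Γ.W false).length else 0) + d.pos o := by
  cases o <;> simp [Env.reg, Env.cnt]

theorem cnt_low (Γ : Env F) (d : Dat) (o : Bool) :
    Γ.cnt d (Env.low o) = if o then (Γ.W false).length else 0 := by
  cases o <;> simp [Env.low, Env.cnt]

theorem cnt_high (Γ : Env F) (d : Dat) (o : Bool) :
    Γ.cnt d (Env.high o) = (if o then (Γ.W false).length else 0) + (Γ.W o).length := by
  cases o <;> simp [Env.high, Env.cnt]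

theorem update_cnt_reg (Γ : Env F) (d : Dat) (o : Bool) (n : ℕ) :
    Function.update (Γ.cnt d) (Env.reg o) ((if o then (Γ.W false).length else 0) + n) =
      Γ.cnt { d with pos := Function.update d.pos o n } := by
  funext i
  cases o <;> rcases i with i | i <;> (try cases i) <;> simp [Env.reg, Env.cnt, Dat.space]

theorem update_cnt_G (Γ : Env F) (d : Dat) (st : Fin 2 → List Bool) (n : ℕ)
    (h : n = Γ.s - (Dat.mk d.pos st).space) :
    Function.update (Γ.cnt d) (.inl .G) n = Γ.cnt { d with st := st } := by
  funext i
  rcases i with i | i <;> (try cases i) <;> simp [Env.cnt, h]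

theorem Run.mem_fetch (hΓ : Γ.Fits L) (o : Bool) {v : Vars κ} {d : Dat}
    (hd : d.Valid Γ.W Γ.s) (hv : v.buf = false) (ho : d.pos o < (Γ.W o).length) :
    Run L (Cmd.fetch (Env.reg o)) (Γ.mem v d)
      (Γ.mem { v with ok := false, val := (Γ.W o)[d.pos o]? } d) := by
  refine (Run.fetch (by rw [hΓ.big]; simp) (by rw [hΓ.big]; cases o <;> simp [Env.reg])
    (hΓ.mem hd v) rfl rfl ?_ hv).of_eq ?_
  · rw [cnt_reg]
    cases o <;> simp at ho ⊢ <;> omega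
  · rw [cnt_reg, Env_getElem? _ _ _ _ ho]
    rfl

theorem Run.mem_test (hΓ : Γ.Fits L) (i j : Name ⊕ F) {v : Vars κ} {d : Dat}
    (hd : d.Valid Γ.W Γ.s) : Run L (Cmd.test i j) (Γ.mem v d)
      (Γ.mem { v with ok := decide (Γ.cnt d i < Γ.cnt d j) } d) :=
  Run.test (hΓ.mem hd v)

theorem Run.mem_modify (hΓ : Γ.Fits L) {f : Vars κ → Vars κ} {v : Vars κ} {d : Dat}
    (hd : d.Valid Γ.W Γ.s) : Run L (Cmd.modify f) (Γ.mem v d) (Γ.mem (f v) d) :=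
  Run.modify (hΓ.mem hd v)

theorem Run.mem_setPos (hΓ : Γ.Fits L) (o : Bool) {v : Vars κ} {d : Dat}
    (hd : d.Valid Γ.W Γ.s) :
    Run L (Cmd.inc (Env.reg o)) (Γ.mem v d)
      (Γ.mem v { d with pos := Function.update d.pos o (d.pos o + 1) }) := by
  refine (Run.inc (hΓ.mem hd v) rfl).of_eq ?_
  have h1 : (Γ.mem v d).cnt (Env.reg o) + 1 =
      (if o then (Γ.W false).length else 0) + (d.pos o + 1) := by
    simp only [Env.mem, cnt_reg]; omega
  rw [h1]
  simp only [Env.mem, update_cnt_reg]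

/-- If the guard fails, everything done for testing it is undone, so the data are unchanged; this is
what `getD d` expresses. -/
theorem Run.instr (hΓ : Γ.Fits L) (i : Instr) {v : Vars κ} {d : Dat}
    (hd : d.Valid Γ.W Γ.s) (hv : v.buf = false) (hval : v.val = none) :
    Run L (Cmd.instr i) (Γ.mem v d)
      (Γ.mem { v with ok := (i.sem Γ.W Γ.s d).isSome } ((i.sem Γ.W Γ.s d).getD d)) := by
  have hvv : ∀ b, ({ v with ok := b, val := none } : Vars κ) = { v with ok := b } := by
    intro b; rw [← hval]
  cases i with
  | adv o b =>
    refine Run.seq (Run.mem_test hΓ _ _ hd) ?_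
    rw [cnt_reg, cnt_high]
    by_cases h : d.pos o < (Γ.W o).length
    · refine Run.cond_true (by simpa [Env.mem] using h) (Run.seq (Run.mem_fetch hΓ o hd hv h) ?_)
      by_cases hb : (Γ.W o)[d.pos o]? = some b
      · refine Run.cond_true (by simp [Env.mem, hb]) (Run.seq (Run.mem_setPos hΓ o hd)
          ((Run.mem_modify hΓ ?_).of_eq ?_))
        · exact Instr.sem_valid (i := .adv o b) hd (by simp [Instr.sem, hb])
        · simp [Instr.sem, hb, success, hvv]
      · refine Run.cond_false (by simp [Env.mem, hb]) ((Run.mem_modify hΓ hd).of_eq ?_)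
        simp [Instr.sem, hb, failure, hvv]
    · refine Run.cond_false (by simpa [Env.mem] using h) ((Run.skip (hΓ.mem hd _)).of_eq ?_)
      simp [Instr.sem, h]
  | ret o b =>
    refine Run.seq (Run.mem_test hΓ _ _ hd) ?_
    rw [cnt_reg, cnt_low]
    have hle := hd.pos_le o
    by_cases h : 0 < d.pos o
    · have hd' : Dat.Valid Γ.W Γ.s { d with pos := Function.update d.pos o (d.pos o - 1) } := by
        refine ⟨fun o' => ?_, hd.space_le⟩
        simp only [Function.update_apply]
        have := hd.pos_le o'
        split_ifs with ho
        · subst ho; omega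
        · exact this
      have hdec : Run L (Cmd.dec (Env.reg o)) (Γ.mem { v with ok := true } d)
          (Γ.mem { v with ok := true }
            { d with pos := Function.update d.pos o (d.pos o - 1) }) := by
        refine (Run.dec (hΓ.mem hd _) ?_).of_eq ?_
        · simp only [Env.mem, cnt_reg]; omega
        · have h1 : (Γ.mem { v with ok := true } d).cnt (Env.reg o) - 1 =
              (if o then (Γ.W false).length else 0) + (d.pos o - 1) := by
            simp only [Env.mem, cnt_reg]; omega
          rw [h1]
          simp only [Env.mem, update_cnt_reg]
      have h0 : decide ((if o then (Γ.W false).length else 0) <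
          (if o then (Γ.W false).length else 0) + d.pos o) = true := by simpa using h
      rw [h0]
      refine Run.cond_true rfl (Run.seq hdec (Run.seq (Run.mem_fetch hΓ o hd' hv ?_) ?_))
      · simp; omega
      · simp only [Function.update_self]
        by_cases hb : (Γ.W o)[d.pos o - 1]? = some b
        · refine Run.cond_true (by simp [Env.mem, hb]) ((Run.mem_modify hΓ hd').of_eq ?_)
          simp [Instr.sem, hb, success, hvv, h]
        · refine Run.cond_false (by simp [Env.mem, hb]) (Run.seq (Run.mem_setPos hΓ o hd') ?_)
          have h2 : d.pos o - 1 + 1 = d.pos o := by omega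
          simp only [Function.update_self, Function.update_idem, h2, Function.update_eq_self]
          refine (Run.mem_modify hΓ hd).of_eq ?_
          simp [Instr.sem, hb, failure, hvv]
    · refine Run.cond_false (by simpa [Env.mem] using h) ((Run.skip (hΓ.mem hd _)).of_eq ?_)
      simp [Instr.sem, h]
  | eof =>
    refine Run.seq (Run.mem_test hΓ _ _ hd) ((Run.mem_modify hΓ hd).of_eq ?_)
    have hle := hd.pos_le false
    by_cases h : d.pos false = (Γ.W false).length
    · simp [Instr.sem, h, Env.cnt]
    · have h' : d.pos false < (Γ.W false).length := by omega
      simp [Instr.sem, h, Env.cnt, h']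
  | push t b =>
    refine Run.seq (Run.mem_test hΓ _ _ hd) ?_
    have hle := hd.space_le
    by_cases h : d.space < Γ.s
    · have h0 : decide (Γ.cnt d (.inl .Z) < Γ.cnt d (.inl .G)) = true := by
        simp [Env.cnt]; omega
      rw [h0]
      have hv' := Instr.sem_valid (i := .push t b) hd (by simp [Instr.sem, h]; rfl)
      have htot := (hΓ.mem hd v).total
      have hsp := d.space_update t (b :: d.st t)
      simp only [Env.mem, hΓ.big, List.length_append, Env.cnt] at htot
      have hfit : ∀ w : Vars κ, Mem.Fits L { Γ.mem w d with
          cnt := Function.update (Γ.cnt d) (.inl .G) (Γ.s - d.space - 1) } := by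
        intro w
        refine ⟨fun j hj => ?_, ?_⟩
        · rw [hΓ.big] at hj
          simp only [Function.update_of_ne hj]
          exact (hΓ.mem hd v).small j (by rw [hΓ.big]; exact hj)
        · simp only [hΓ.big, Function.update_self, Env.mem, List.length_append]
          omega
      refine Run.cond_true rfl (Run.seq (Run.dec (hΓ.mem hd _) ?_) (Run.seq
        (Run.modify (hfit _)) (Run.seq (Run.stackPush (c := Function.update (Γ.cnt d) (.inl .G)
          (Γ.s - d.space - 1)) (st := d.st) (by rw [hΓ.big]; simp)
          (by rw [hΓ.big]; simp) t (b := b) (hfit _) ?_ rfl rfl ?_ hv rfl) ?_)))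
      · simp [Env.mem, Env.cnt]; omega
      · simp only [hΓ.big, Function.update_self, List.length_append]
        omega
      · simp [Env.cnt]
      · have h2 := update_cnt_G Γ d (Function.update d.st t (b :: d.st t)) (Γ.s - d.space - 1)
          (by simp only [List.length_cons] at hsp; omega)
        simp only [Env.mem, h2]
        refine (Run.mem_modify hΓ hv' (v := { v with ok := false, val := none })).of_eq ?_
        simp [Instr.sem, h, success, hvv, Env.mem]
    · refine Run.cond_false ?_ ((Run.skip (hΓ.mem hd _)).of_eq ?_)
      · simp [Env.mem, Env.cnt]; omega
      · simp [Instr.sem, h, Env.cnt]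
  | pop t b =>
    refine Run.seq (Run.mem_stackPop hΓ t hd hv) ?_
    by_cases h : (d.st t).head? = some b
    · have hv' := Instr.sem_valid (i := .pop t b) hd (by simp [Instr.sem, h]; rfl)
      have hsp := d.space_update t (d.st t).tail
      have hle := hd.space_le
      have hne : 0 < (d.st t).length := by
        cases hs : d.st t with
        | nil => simp [hs] at h
        | cons c l => simp
      simp only [List.length_tail] at hsp
      have h2 := update_cnt_G Γ d (Function.update d.st t (d.st t).tail) (Γ.s - d.space + 1)
        (by omega)
      have htot := (hΓ.mem hd v).total
      simp only [Env.mem, hΓ.big, List.length_append, Env.cnt] at htot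
      have hfit : ∀ w : Vars κ, Mem.Fits L
          { Γ.mem w { d with st := Function.update d.st t (d.st t).tail } with
            cnt := Γ.cnt d } := by
        intro w
        refine ⟨(hΓ.mem hd v).small, ?_⟩
        simp only [Dat.space] at hsp
        simp only [hΓ.big, Env.mem, List.length_append, Env.cnt]
        omega
      refine Run.cond_true (by simp [Env.mem, h]) (Run.seq (Run.inc (hfit _) rfl) ?_)
      have h3 : Γ.cnt d (.inl .G) + 1 = Γ.s - d.space + 1 := rfl
      simp only [h3, h2, Env.mem]
      refine (Run.mem_modify hΓ hv' (v := { v with ok := false, val := (d.st t).head? })).of_eq ?_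
      simp [Instr.sem, h, success, hvv, Env.mem]
    · refine Run.cond_false (by simp [Env.mem, h]) (Run.seq
        (b := Γ.mem { v with ok := false, val := none } d) (Run.cond ?_)
        ((Run.mem_modify hΓ hd).of_eq ?_))
      · cases hs : (d.st t).head? with
        | none =>
          have hs' : d.st t = [] := by simpa using hs
          have h1 : Function.update d.st t (d.st t).tail = d.st := by
            rw [hs', List.tail_nil, ← hs', Function.update_eq_self]
          simp only [h1]
          rw [if_neg (by simp [Env.mem])]
          exact Run.skip (hΓ.mem hd _)
        | some c =>
          rw [if_pos (by simp [Env.mem])]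
          exact Run.mem_stackPush hΓ t (v := { v with ok := false, val := some c }) hd hv hs rfl
      · simp [Instr.sem, h, failure, hvv]
  | empty t b =>
    refine (Run.emptyCode hΓ t b hd hv).of_eq ?_
    by_cases h : (d.st t).isEmpty = b <;> simp [Instr.sem, h, hvv]
  | start =>
    refine Run.seq (Run.emptyCode hΓ 0 true hd hv) ?_
    by_cases h0 : d.st 0 = []
    · refine Run.cond_true (by simp [Env.mem, h0]) (Run.seq (Run.emptyCode hΓ 1 true hd hv) ?_)
      by_cases h1 : d.st 1 = []
      · refine Run.cond_true (by simp [Env.mem, h1]) (Run.seq (Run.mem_test hΓ _ _ hd) ?_)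
        by_cases h2 : d.pos false = 0
        · refine Run.cond_false (by simp [Env.mem, Env.cnt, h2]) (Run.seq
            (Run.mem_test hΓ _ _ hd) ((Run.mem_modify hΓ hd).of_eq ?_))
          by_cases h3 : d.pos true = 0
          · simp [Instr.sem, h0, h1, h2, h3, Env.cnt, hvv]
          · have : 0 < d.pos true := by omega
            simp [Instr.sem, h0, h1, h2, h3, Env.cnt, hvv, this]
        · refine Run.cond_true (by simp [Env.mem, Env.cnt, Nat.pos_of_ne_zero h2])
            ((Run.mem_modify hΓ hd).of_eq ?_)
          simp [Instr.sem, h2, failure, hvv]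
      · refine Run.cond_false (by simp [Env.mem, h1]) ((Run.skip (hΓ.mem hd _)).of_eq ?_)
        simp [Instr.sem, h1, hvv]
    · refine Run.cond_false (by simp [Env.mem, h0]) ((Run.skip (hΓ.mem hd _)).of_eq ?_)
      simp [Instr.sem, h0, hvv]
  | nop => exact (Run.mem_modify hΓ hd).of_eq (by simp [Instr.sem, success, hvv])
  | fail => exact (Run.mem_modify hΓ hd).of_eq (by simp [Instr.sem, failure, hvv])

end Cmd

/-! ### Backward depth-first search -/

/-- A finite graph in which every vertex has at most one outgoing edge; the edges carry numbers
less than `size`, and can be followed in both directions. -/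
structure FuncGraph (V : Type) : Type where
  size : ℕ
  fwd : ℕ → V → Option V
  bwd : ℕ → V → Option V
  ok : V → Prop
  isRoot : V → Bool
  isStart : V → Bool
  finite_ok : Finite {v // ok v}
  bwd_iff : ∀ {e v u}, e < size → ok v → (bwd e v = some u ↔ ok u ∧ fwd e u = some v)
  fwd_unique : ∀ {e e' u v v'}, e < size → e' < size → fwd e u = some v → fwd e' u = some v' →
    e = e'
  fwd_root : ∀ {e v}, e < size → isRoot v = true → fwd e v = none

namespace FuncGraph

variable {V : Type} (H : FuncGraph V)

def Step (u v : V) : Prop := H.ok u ∧ ∃ e < H.size, H.fwd e u = some v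

def Reach : V → V → Prop := Relation.ReflTransGen H.Step

/-- A position in the search: the current vertex, whether it is being left, the number of the
next edge, and whether the start has been seen. -/
structure Pos (V : Type) : Type where
  v : V
  up : Bool
  e : ℕ
  found : Bool

/-- No path is stored. The search enters predecessors along `bwd`; after the last incoming edge of a
vertex it turns to `up`, finds the unique outgoing edge by trying all numbers, and resumes at its
target with the next number. The number of the edge by which the vertex was entered is thus
recovered rather than remembered. -/
def next (S : Pos V) : Pos V :=
  if S.e < H.size then
    if S.up then
      match H.fwd S.e S.v with
      | some w => ⟨w, false, S.e + 1, S.found⟩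
      | none => ⟨S.v, true, S.e + 1, S.found⟩
    else
      match H.bwd S.e S.v with
      | some u => ⟨u, false, 0, S.found || H.isStart u⟩
      | none => ⟨S.v, false, S.e + 1, S.found⟩
  else ⟨S.v, true, 0, S.found⟩

def Done (S : Pos V) : Prop := H.isRoot S.v = true ∧ S.up = false ∧ H.size ≤ S.e

/-- The positions that occur. -/
def Good (S : Pos V) : Prop := H.ok S.v ∧ S.e ≤ H.size ∧ ¬ H.Done S ∧
  (S.up = true → S.e < H.size)

def Moves (S S' : Pos V) : Prop := H.Good S ∧ S' = H.next S

variable {H}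

theorem Step.unique {u v v' : V} (h : H.Step u v) (h' : H.Step u v') : v = v' := by
  obtain ⟨-, e, he, h⟩ := h
  obtain ⟨-, e', he', h'⟩ := h'
  obtain rfl := H.fwd_unique he he' h h'
  exact Option.some.inj (h.symm.trans h')

theorem Step.not_isRoot {u v : V} (h : H.Step u v) : H.isRoot u = false := by
  obtain ⟨-, e, he, h⟩ := h
  by_contra hr
  rw [H.fwd_root he (by simpa using hr)] at h
  cases h

/-- A vertex on a cycle has its only outgoing edge on the cycle, so the cycle cannot be left; but
the root, having no outgoing edge, lies on none. -/
theorem not_transGen_self {v r : V} (hr : H.isRoot r = true) (h : H.Reach v r) :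
    ¬ Relation.TransGen H.Step v v := by
  induction h using Relation.ReflTransGen.head_induction_on with
  | refl =>
    intro h
    obtain ⟨w, hw, -⟩ := Relation.TransGen.head'_iff.1 h
    rw [hw.not_isRoot] at hr
    cases hr
  | @head v w hvw _ ih =>
    intro h
    obtain ⟨b, hb, hbv⟩ := Relation.TransGen.head'_iff.1 h
    obtain rfl := hb.unique hvw
    exact ih (Relation.TransGen.tail' hbv hb)

/-- Leaving `u` upwards, all numbers below `e` fail because only one edge leaves `u`; the search
therefore continues in `v` just after the edge through which it came. -/
theorem Moves.scan {u v : V} {e : ℕ} (he : e < H.size) (hu : H.ok u) (h : H.fwd e u = some v)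
    (f : Bool) : Relation.ReflTransGen H.Moves ⟨u, true, 0, f⟩ ⟨v, false, e + 1, f⟩ := by
  have key : ∀ k ≤ e, Relation.ReflTransGen H.Moves ⟨u, true, 0, f⟩ ⟨u, true, k, f⟩ := by
    intro k
    induction k with
    | zero => exact fun _ => .refl
    | succ k ih =>
      intro hk
      refine (ih (by omega)).tail ⟨⟨hu, by simp; omega, by simp [Done], by simp; omega⟩, ?_⟩
      have hn : H.fwd k u = none := by
        by_contra hne
        obtain ⟨w, hw⟩ := Option.ne_none_iff_exists'.1 hne
        have := H.fwd_unique he (by omega) h hw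
        omega
      have hlt : k < H.size := by omega
      simp [next, hlt, hn]
  refine (key e le_rfl).tail ⟨⟨hu, by simp; omega, by simp [Done], by simpa using he⟩, ?_⟩
  simp [next, he, h]

/-- Induction over the tree of predecessors. A start vertex is recorded when it is entered, which
explains the hypothesis on `f₀`: the vertex `v` itself has been entered already. -/
theorem search_subtree {r : V} (hr : H.isRoot r = true) (v : V) (hv : H.ok v)
    (hvr : H.Reach v r) (f₀ : Bool) (hf₀ : H.isStart v = true → f₀ = true) :
    ∃ f, Relation.ReflTransGen H.Moves ⟨v, false, 0, f₀⟩ ⟨v, false, H.size, f⟩ ∧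
      (f = true ↔ f₀ = true ∨ ∃ w, H.ok w ∧ H.isStart w = true ∧ H.Reach w v) := by
  have := H.finite_ok
  -- Reaching the root is made part of the relation because irreflexivity can fail elsewhere in the
  -- graph; transitive and irreflexive relations on a finite type are well-founded.
  have wf : WellFounded fun u v : {v // H.ok v} =>
      Relation.TransGen H.Step u.1 v.1 ∧ H.Reach v.1 r := by
    have : IsTrans {v // H.ok v} fun u v => Relation.TransGen H.Step u.1 v.1 ∧ H.Reach v.1 r :=
      ⟨fun _ _ _ h h' => ⟨h.1.trans h'.1, h'.2⟩⟩
    have : Std.Irrefl fun u v : {v // H.ok v} =>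
        Relation.TransGen H.Step u.1 v.1 ∧ H.Reach v.1 r :=
      ⟨fun _ h => not_transGen_self hr h.2 h.1⟩
    exact Finite.wellFounded_of_trans_of_irrefl _
  obtain ⟨v', rfl⟩ : ∃ v' : {v // H.ok v}, v'.1 = v := ⟨⟨v, hv⟩, rfl⟩
  induction v' using wf.induction generalizing f₀ with
  | h v ih =>
  -- Inner induction on the number `n` of incoming edges that are still to be tried.
  have key : ∀ n e, e + n = H.size → ∀ f₀ : Bool, (H.isStart v.1 = true → f₀ = true) →
      ∃ f, Relation.ReflTransGen H.Moves ⟨v.1, false, e, f₀⟩ ⟨v.1, false, H.size, f⟩ ∧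
      (f = true ↔ f₀ = true ∨ ∃ e' u w, e ≤ e' ∧ e' < H.size ∧ H.ok u ∧
        H.fwd e' u = some v.1 ∧ H.ok w ∧ H.isStart w = true ∧ H.Reach w u) := by
    intro n
    induction n with
    | zero =>
      rintro e rfl f₀ _
      refine ⟨f₀, .refl, ?_⟩
      constructor
      · exact Or.inl
      · rintro (h | ⟨e', u, w, h1, h2, -⟩)
        · exact h
        · omega
    | succ n ihn =>
      intro e hen f₀ hf₀
      have he : e < H.size := by omega
      have hgood : H.Good ⟨v.1, false, e, f₀⟩ :=
        ⟨hv, he.le, by simp [Done]; intro; omega, by simp⟩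
      cases hb : H.bwd e v.1 with
      | none =>
        obtain ⟨f, h1, h2⟩ := ihn (e + 1) (by omega) f₀ hf₀
        refine ⟨f, Relation.ReflTransGen.head ⟨hgood, by simp [next, he, hb]⟩ h1, h2.trans ?_⟩
        refine or_congr_right ⟨?_, ?_⟩
        · rintro ⟨e', u, w, h3, h4⟩
          exact ⟨e', u, w, by omega, h4⟩
        · rintro ⟨e', u, w, h3, h4, h5, h6, h7⟩
          refine ⟨e', u, w, ?_, h4, h5, h6, h7⟩
          rcases h3.eq_or_lt with rfl | h3
          · rw [(H.bwd_iff he hv).2 ⟨h5, h6⟩] at hb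
            cases hb
          · exact h3
      | some u =>
        obtain ⟨hu, hfu⟩ := (H.bwd_iff he hv).1 hb
        have hstep : H.Step u v.1 := ⟨hu, e, he, hfu⟩
        obtain ⟨f₁, h1, h2⟩ := ih ⟨u, hu⟩ ⟨.single hstep, hvr⟩
          (f₀ || H.isStart u) hu (Relation.ReflTransGen.head hstep hvr) (by simp +contextual)
        obtain ⟨f, h3, h4⟩ := ihn (e + 1) (by omega) f₁ (fun h => h2.2 (Or.inl (by simp [hf₀ h])))
        refine ⟨f, ?_, ?_⟩
        · refine Relation.ReflTransGen.head ⟨hgood, ?_⟩ (h1.trans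
            (Relation.ReflTransGen.head ⟨⟨hu, le_rfl, ?_, by simp⟩, ?_⟩
              ((Moves.scan he hu hfu f₁).trans h3)))
          · simp [next, he, hb]
          · simp [Done, hstep.not_isRoot]
          · simp [next]
        · rw [h4, h2]
          constructor
          · rintro ((h | ⟨w, h⟩) | ⟨e', u', w, h5, h6⟩)
            · rw [Bool.or_eq_true] at h
              rcases h with h | h
              · exact Or.inl h
              · exact Or.inr ⟨e, u, u, le_rfl, he, hu, hfu, hu, h, .refl⟩
            · exact Or.inr ⟨e, u, w, le_rfl, he, hu, hfu, h⟩
            · exact Or.inr ⟨e', u', w, by omega, h6⟩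
          · rintro (h | ⟨e', u', w, h5, h6, h7, h8, h9⟩)
            · exact Or.inl (Or.inl (by simp [h]))
            · rcases h5.eq_or_lt with rfl | h5
              · rw [(H.bwd_iff he hv).2 ⟨h7, h8⟩] at hb
                obtain rfl := Option.some.inj hb
                exact Or.inl (Or.inr ⟨w, h9⟩)
              · exact Or.inr ⟨e', u', w, h5, h6, h7, h8, h9⟩
  obtain ⟨f, h1, h2⟩ := key H.size 0 (by omega) f₀ hf₀
  refine ⟨f, h1, h2.trans ⟨?_, ?_⟩⟩
  · rintro (h | ⟨e', u, w, -, h4, h5, h6, h7, h8, h9⟩)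
    · exact Or.inl h
    · exact Or.inr ⟨w, h7, h8, h9.tail ⟨h5, e', h4, h6⟩⟩
  · rintro (h | ⟨w, h7, h8, h9⟩)
    · exact Or.inl h
    · rcases Relation.ReflTransGen.cases_tail h9 with h | ⟨u, h10, h11, e', h12, h13⟩
      · exact Or.inl (hf₀ (h ▸ h8))
      · exact Or.inr ⟨e', u, w, Nat.zero_le _, h12, h11, h13, h7, h8, h10⟩

end FuncGraph

/-! ### The graph of the computations of a machine -/

/-- Control states for recognizing the computations of a machine with control states `Q` that
start in the initial configuration and halt: after halting, the stacks are emptied and the rest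
of the program is read. -/
inductive Ctl (Q : Type) : Type where
  | start
  | run (q : Q)
  | clean (t : Fin 2)
  | skipProgram
  | done

instance {Q : Type} [Finite Q] : Finite (Ctl Q) :=
  Finite.of_injective (β := Option (Option (Option (Q ⊕ Fin 2))))
    (fun
      | .start => none
      | .done => some none
      | .skipProgram => some (some none)
      | .run q => some (some (some (.inl q)))
      | .clean t => some (some (some (.inr t))))
    fun a b h => by cases a <;> cases b <;> simp_all

namespace Machine

variable (U : Machine 2)

/-- The instruction and the new control state for every control state and every answer. -/
def edge : Ctl U.State → Option Bool → Instr × Ctl U.State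
  | .start, none => (.start, .run U.init)
  -- Every control state is paired with every possible answer; pairs that cannot occur receive an
  -- instruction that never succeeds.
  | .start, some _ => (.fail, .done)
  | .run q, a =>
    match U.request q, a with
    | .halt, none => (.nop, .clean 0)
    | .halt, some _ => (.fail, .done)
    -- The auxiliary string is empty, so the second tape answers with its end marker only.
    | .read i next, some b => (if i = 0 then .adv false b else .fail, .run (next (some b)))
    | .read i next, none => (if i = 0 then .eof else .nop, .run (next none))
    | .write b next, none => (.adv true b, .run next)
    | .write _ _, some _ => (.fail, .done)
    | .push t b next, none => (.push t b, .run next)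
    | .push _ _ _, some _ => (.fail, .done)
    | .pop t next, some b => (.pop t b, .run (next (some b)))
    | .pop t next, none => (.empty t true, .run (next none))
    | .isEmpty t next, some b => (.empty t b, .run (next b))
    | .isEmpty _ _, none => (.fail, .done)
  | .clean t, some b => (.pop t b, .clean t)
  | .clean t, none => (.empty t true, if t = 0 then .clean 1 else .skipProgram)
  | .skipProgram, some b => (.adv false b, .skipProgram)
  | .skipProgram, none => (.eof, .done)
  | .done, _ => (.fail, .done)

/-- Determinism: for a given control state, the guards belonging to different answers exclude each
other. -/
theorem edge_unique {W : Bool → List Bool} {s : ℕ} {c : Ctl U.State} {a a' : Option Bool}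
    {d e e' : Dat} (h : (U.edge c a).1.sem W s d = some e)
    (h' : (U.edge c a').1.sem W s d = some e') : a = a' := by
  have hlen : ∀ {l : List Bool} {b : Bool}, l[l.length]? = some b → False := by
    intro l b h; simp at h
  have hadv : ∀ {o b b'}, (Instr.adv o b).sem W s d = some e →
      (Instr.adv o b').sem W s d = some e' → some b = some b' := by
    intro o b b' h h'
    simp only [Instr.sem, Option.ite_none_right_eq_some] at h h'
    rw [← h.1, ← h'.1]
  have hadv' : ∀ {b} {e e' : Dat}, (Instr.adv false b).sem W s d = some e →
      Instr.eof.sem W s d = some e' → False := by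
    intro b e e' h h'
    simp only [Instr.sem, Option.ite_none_right_eq_some] at h h'
    rw [h'.1] at h
    exact hlen h.1
  have hpop : ∀ {t b b'}, (Instr.pop t b).sem W s d = some e →
      (Instr.pop t b').sem W s d = some e' → some b = some b' := by
    intro o b b' h h'
    simp only [Instr.sem, Option.ite_none_right_eq_some] at h h'
    rw [← h.1, ← h'.1]
  have hpop' : ∀ {t b} {e e' : Dat}, (Instr.pop t b).sem W s d = some e →
      (Instr.empty t true).sem W s d = some e' → False := by
    intro t b e e' h h'
    simp only [Instr.sem, Option.ite_none_right_eq_some, List.isEmpty_iff] at h h'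
    rw [h'.1] at h
    simp at h
  have hempty : ∀ {t b b'}, (Instr.empty t b).sem W s d = some e →
      (Instr.empty t b').sem W s d = some e' → some b = some b' := by
    intro t b b' h h'
    simp only [Instr.sem, Option.ite_none_right_eq_some] at h h'
    rw [← h.1, ← h'.1]
  have hfail : ∀ {e}, Instr.fail.sem W s d = some e → False := by
    intro e h; cases h
  cases c with
  | start => cases a <;> cases a' <;> first | rfl | exact (hfail h).elim | exact (hfail h').elim
  | run q =>
    cases hq : U.request q with
    | halt =>
      simp only [edge, hq] at h h'
      cases a <;> cases a' <;> first | rfl | exact (hfail h).elim | exact (hfail h').elim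
    | read i next =>
      simp only [edge, hq] at h h'
      by_cases hi : i = 0
      · cases a <;> cases a' <;> simp only [hi, if_true] at h h' <;>
          first | rfl | exact (hadv' h' h).elim | exact (hadv' h h').elim | exact hadv h h'
      · cases a <;> cases a' <;> simp only [hi, if_false] at h h' <;>
          first | rfl | exact (hfail h).elim | exact (hfail h').elim
    | write b next =>
      simp only [edge, hq] at h h'
      cases a <;> cases a' <;> first | rfl | exact (hfail h).elim | exact (hfail h').elim
    | push t b next =>
      simp only [edge, hq] at h h'
      cases a <;> cases a' <;> first | rfl | exact (hfail h).elim | exact (hfail h').elim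
    | pop t next =>
      simp only [edge, hq] at h h'
      cases a <;> cases a'
      · rfl
      · exact (hpop' h' h).elim
      · exact (hpop' h h').elim
      · exact hpop h h'
    | isEmpty t next =>
      simp only [edge, hq] at h h'
      cases a <;> cases a' <;>
        first | rfl | exact (hfail h).elim | exact (hfail h').elim | exact hempty h h'
  | clean t =>
    cases a <;> cases a'
    · rfl
    · exact (hpop' h' h).elim
    · exact (hpop' h h').elim
    · exact hpop h h'
  | skipProgram =>
    cases a <;> cases a'
    · rfl
    · exact (hadv' h' h).elim
    · exact (hadv' h h').elim
    · exact hadv h h'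
  | done => exact (hfail h).elim

end Machine

theorem Dat.finite_valid (W : Bool → List Bool) (s : ℕ) : Finite {d : Dat // d.Valid W s} := by
  have h1 : Finite {l : List Bool // l.length ≤ s} := (List.finite_length_le Bool s).to_subtype
  refine Finite.of_injective (β := (∀ o, Fin ((W o).length + 1)) ×
    (Fin 2 → {l : List Bool // l.length ≤ s})) (fun d =>
      (fun o => ⟨d.1.pos o, Nat.lt_succ_of_le (d.2.pos_le o)⟩,
        fun t => ⟨d.1.st t, by
          have := d.2.space_le
          unfold Dat.space at this
          obtain rfl | rfl : t = 0 ∨ t = 1 := by fin_cases t <;> simp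
          · omega
          · omega⟩)) ?_
  rintro ⟨d, hd⟩ ⟨e, he⟩ h
  simp only [Prod.mk.injEq, funext_iff, Fin.mk.injEq, Subtype.mk.injEq] at h
  exact Subtype.ext (Dat.ext (funext h.1) (funext h.2))

namespace Machine

variable (U : Machine 2)

instance : Finite U.State := U.finite_state

/-- The number of pairs of a control state and an answer. -/
noncomputable def edgeCount : ℕ := Nat.card (Ctl U.State × Option Bool)

noncomputable def edgeEquiv : Ctl U.State × Option Bool ≃ Fin U.edgeCount := Finite.equivFin _

/-- An enumeration of the pairs of a control state and an answer. -/
noncomputable def edgeAt (e : ℕ) : Option (Ctl U.State × Option Bool) :=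
  if h : e < U.edgeCount then some (U.edgeEquiv.symm ⟨e, h⟩) else none

theorem edgeAt_eq_none (e : ℕ) (h : ¬ e < U.edgeCount) : U.edgeAt e = none := dif_neg h

theorem exists_edgeAt_eq (x : Ctl U.State × Option Bool) :
    ∃ e < U.edgeCount, U.edgeAt e = some x := by
  refine ⟨(U.edgeEquiv x).1, (U.edgeEquiv x).2, ?_⟩
  rw [edgeAt, dif_pos (U.edgeEquiv x).2]
  simp

theorem edgeAt_injective {e e' : ℕ} (he : e < U.edgeCount) (he' : e' < U.edgeCount)
    (h : U.edgeAt e = U.edgeAt e') : e = e' := by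
  rw [edgeAt, edgeAt, dif_pos he, dif_pos he'] at h
  simpa [Fin.ext_iff] using h

-- An edge number encodes a pair of a control state and an answer, not an answer alone: seen
-- backwards, an edge may come from any control state, and all candidates must be enumerable. There
-- are constantly many of them, so the number fits into the finite control.
open Classical in
noncomputable def stepFwd (W : Bool → List Bool) (s e : ℕ) (v : Ctl U.State × Dat) :
    Option (Ctl U.State × Dat) :=
  (U.edgeAt e).bind fun x => if x.1 = v.1 then
    ((U.edge x.1 x.2).1.sem W s v.2).map fun d => ((U.edge x.1 x.2).2, d) else none

open Classical in
noncomputable def stepBwd (W : Bool → List Bool) (s e : ℕ) (v : Ctl U.State × Dat) :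
    Option (Ctl U.State × Dat) :=
  (U.edgeAt e).bind fun x => if (U.edge x.1 x.2).2 = v.1 then
    ((U.edge x.1 x.2).1.inv.sem W s v.2).map fun d => (x.1, d) else none

theorem stepFwd_eq_some {W : Bool → List Bool} {s e : ℕ} {v w : Ctl U.State × Dat} :
    U.stepFwd W s e v = some w ↔ ∃ a, U.edgeAt e = some (v.1, a) ∧
      (U.edge v.1 a).2 = w.1 ∧ (U.edge v.1 a).1.sem W s v.2 = some w.2 := by
  rw [stepFwd]
  constructor
  · intro h
    obtain ⟨⟨c, a⟩, h1, h2⟩ := Option.bind_eq_some_iff.1 h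
    simp only [Option.ite_none_right_eq_some, Option.map_eq_some_iff] at h2
    obtain ⟨rfl, d, hd, rfl⟩ := h2
    exact ⟨a, h1, rfl, hd⟩
  · rintro ⟨a, h1, h2, h3⟩
    simp [h1, h3, h2]

theorem stepBwd_eq_some {W : Bool → List Bool} {s e : ℕ} {v w : Ctl U.State × Dat} :
    U.stepBwd W s e v = some w ↔ ∃ a, U.edgeAt e = some (w.1, a) ∧
      (U.edge w.1 a).2 = v.1 ∧ (U.edge w.1 a).1.inv.sem W s v.2 = some w.2 := by
  rw [stepBwd]
  constructor
  · intro h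
    obtain ⟨⟨c, a⟩, h1, h2⟩ := Option.bind_eq_some_iff.1 h
    simp only [Option.ite_none_right_eq_some, Option.map_eq_some_iff] at h2
    obtain ⟨h2, d, hd, rfl⟩ := h2
    exact ⟨a, h1, h2, hd⟩
  · rintro ⟨a, h1, h2, h3⟩
    simp [h1, h3, h2]

open Classical in
/-- The graph of the computations on a program `W false` with output `W true` in space `s`. -/
noncomputable def graph (W : Bool → List Bool) (s : ℕ) : FuncGraph (Ctl U.State × Dat) where
  size := U.edgeCount
  fwd := U.stepFwd W s
  bwd := U.stepBwd W s
  ok v := v.2.Valid W s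
  isRoot v := decide (v.1 = .done)
  -- The data need not be inspected: the instruction `start` lets only the initial data pass, so no
  -- other vertex of this kind has an outgoing edge.
  isStart v := decide (v.1 = .start)
  finite_ok := by
    have := Dat.finite_valid W s
    exact Finite.of_injective
      (β := Ctl U.State × {d : Dat // d.Valid W s}) (fun v => (v.1.1, ⟨v.1.2, v.2⟩))
      fun v w h => by
        simp only [Prod.mk.injEq, Subtype.mk.injEq] at h
        exact Subtype.ext (Prod.ext h.1 h.2)
  bwd_iff := by
    intro e v u _ hv
    rw [stepBwd_eq_some, stepFwd_eq_some]
    constructor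
    · rintro ⟨a, h1, h2, h3⟩
      have hu := Instr.sem_valid hv h3
      exact ⟨hu, a, h1, h2, (Instr.sem_inv_iff hu hv).2 h3⟩
    · rintro ⟨hu, a, h1, h2, h3⟩
      exact ⟨a, h1, h2, (Instr.sem_inv_iff hu hv).1 h3⟩
  fwd_unique := by
    intro e e' u v v' he he' h h'
    obtain ⟨a, h1, -, h3⟩ := (stepFwd_eq_some U).1 h
    obtain ⟨a', h1', -, h3'⟩ := (stepFwd_eq_some U).1 h'
    obtain rfl := U.edge_unique h3 h3'
    exact U.edgeAt_injective he he' (h1.trans h1'.symm)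
  fwd_root := by
    intro e v _ hv
    by_contra hne
    obtain ⟨w, hw⟩ := Option.ne_none_iff_exists'.1 hne
    obtain ⟨a, -, -, h3⟩ := (stepFwd_eq_some U).1 hw
    simp only [decide_eq_true_eq] at hv
    rw [hv] at h3
    cases h3

theorem graph_step_iff {W : Bool → List Bool} {s : ℕ} {v w : Ctl U.State × Dat} :
    (U.graph W s).Step v w ↔ v.2.Valid W s ∧ ∃ a, (U.edge v.1 a).2 = w.1 ∧
      (U.edge v.1 a).1.sem W s v.2 = some w.2 := by
  constructor
  · rintro ⟨hv, e, he, h⟩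
    obtain ⟨a, -, h2, h3⟩ := (stepFwd_eq_some U).1 h
    exact ⟨hv, a, h2, h3⟩
  · rintro ⟨hv, a, h2, h3⟩
    obtain ⟨e, he, h1⟩ := U.exists_edgeAt_eq (v.1, a)
    exact ⟨hv, e, he, (stepFwd_eq_some U).2 ⟨a, h1, h2, h3⟩⟩

/-- The configuration with given control state and data. -/
def confOf (W : Bool → List Bool) (q : U.State) (d : Dat) : Config 2 U.State :=
  ⟨q, ![(W false).drop (d.pos false), []], d.st, (W true).take (d.pos true)⟩

variable {U}

/-- Soundness of the simulation: an instruction whose guard holds performs exactly the step of `U`,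
the guard having predicted the answer. -/
theorem step_confOf_of_edge {W : Bool → List Bool} {s : ℕ} {q : U.State} {d d' : Dat}
    {a : Option Bool} (hq : U.request q ≠ .halt)
    (h : (U.edge (.run q) a).1.sem W s d = some d') :
    ∃ q', (U.edge (.run q) a).2 = .run q' ∧ U.step (U.confOf W q d) = U.confOf W q' d' := by
  have hst : (U.confOf W q d).state = q := rfl
  cases hr : U.request q with
  | halt => exact absurd hr hq
  | read i next =>
    simp only [edge, hr] at h ⊢
    rcases a with _ | b
    · refine ⟨_, rfl, ?_⟩
      by_cases hi : i = 0
      · subst hi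
        simp only [if_true, Instr.sem, Option.ite_none_right_eq_some, Option.some.injEq] at h
        obtain ⟨h1, rfl⟩ := h
        simp [step, confOf, hr, h1]
      · obtain rfl : i = 1 := by omega
        simp only [one_ne_zero, if_false, Instr.sem, Option.some.injEq] at h
        subst h
        simp [step, confOf, hr]
    · refine ⟨_, rfl, ?_⟩
      by_cases hi : i = 0
      · subst hi
        simp only [if_true, Instr.sem, Option.ite_none_right_eq_some, Option.some.injEq] at h
        obtain ⟨h1, rfl⟩ := h
        simp only [step, confOf, hr]
        simp only [Matrix.cons_val_zero, List.head?_drop, List.tail_drop, h1]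
        congr 1
        funext k; fin_cases k <;> simp
      · simp [hi, Instr.sem] at h
  | write b next =>
    simp only [edge, hr] at h ⊢
    rcases a with _ | b
    · simp only [Instr.sem, Option.ite_none_right_eq_some, Option.some.injEq] at h
      obtain ⟨h1, rfl⟩ := h
      refine ⟨_, rfl, ?_⟩
      simp [step, confOf, hr, List.take_add_one, h1]
    · cases h
  | push t b next =>
    simp only [edge, hr] at h ⊢
    rcases a with _ | b
    · simp only [Instr.sem, Option.ite_none_right_eq_some, Option.some.injEq] at h
      obtain ⟨h1, rfl⟩ := h
      refine ⟨_, rfl, ?_⟩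
      simp [step, confOf, hr]
    · cases h
  | pop t next =>
    simp only [edge, hr] at h ⊢
    rcases a with _ | b
    · simp only [Instr.sem, Option.ite_none_right_eq_some, Option.some.injEq,
        List.isEmpty_iff] at h
      obtain ⟨h1, rfl⟩ := h
      refine ⟨_, rfl, ?_⟩
      have h2 : Function.update d.st t [] = d.st := by rw [← h1, Function.update_eq_self]
      simp [step, confOf, hr, h1, h2]
    · simp only [Instr.sem, Option.ite_none_right_eq_some, Option.some.injEq] at h
      obtain ⟨h1, rfl⟩ := h
      refine ⟨_, rfl, ?_⟩
      simp [step, confOf, hr, h1]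
  | isEmpty t next =>
    simp only [edge, hr] at h ⊢
    rcases a with _ | b
    · cases h
    · simp only [Instr.sem, Option.ite_none_right_eq_some, Option.some.injEq] at h
      obtain ⟨h1, rfl⟩ := h
      refine ⟨_, rfl, ?_⟩
      simp [step, confOf, hr, h1]

/-- Completeness of the simulation. The space bound after the step is what `push` needs, and the
prefix condition is what `write` needs; the other requests always have an applicable edge. -/
theorem exists_edge_of_step {W : Bool → List Bool} {s : ℕ} {q : U.State} {d : Dat}
    (hq : U.request q ≠ .halt) (hd : d.Valid W s) (hs : (U.step (U.confOf W q d)).space ≤ s)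
    (ho : (U.step (U.confOf W q d)).output <+: W true) :
    ∃ a q' d', U.edge (.run q) a = ((U.edge (.run q) a).1, .run q') ∧
      (U.edge (.run q) a).1.sem W s d = some d' ∧
      U.step (U.confOf W q d) = U.confOf W q' d' := by
  suffices h : ∃ a d', (U.edge (.run q) a).1.sem W s d = some d' by
    obtain ⟨a, d', h⟩ := h
    obtain ⟨q', h1, h2⟩ := step_confOf_of_edge hq h
    exact ⟨a, q', d', Prod.ext rfl h1, h, h2⟩
  cases hr : U.request q with
  | halt => exact absurd hr hq
  | read i next =>
    by_cases hi : i = 0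
    · cases hp : (W false)[d.pos false]? with
      | none =>
        have h1 := hd.pos_le false
        rw [List.getElem?_eq_none_iff] at hp
        refine ⟨none, d, ?_⟩
        simp only [edge, hr, hi, if_true, Instr.sem]
        rw [if_pos (by omega)]
      | some b =>
        refine ⟨some b, { d with pos := Function.update d.pos false (d.pos false + 1) }, ?_⟩
        simp only [edge, hr, hi, if_true, Instr.sem, hp]
    · refine ⟨none, d, ?_⟩
      simp [edge, hr, hi, Instr.sem]
  | write b next =>
    refine ⟨none, { d with pos := Function.update d.pos true (d.pos true + 1) }, ?_⟩
    simp only [edge, hr, Instr.sem]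
    rw [if_pos]
    simp only [step, confOf, hr] at ho
    obtain ⟨l, hl⟩ := ho
    have h1 := hd.pos_le true
    rw [← hl, List.append_assoc, List.getElem?_append_right (by simp)]
    simp [h1]
  | push t b next =>
    refine ⟨none, { d with st := Function.update d.st t (b :: d.st t) }, ?_⟩
    simp only [edge, hr, Instr.sem]
    rw [if_pos]
    simp only [step, confOf, hr] at hs
    have h1 := d.space_update t (b :: d.st t)
    simp only [Config.space, Dat.space, List.length_cons] at *
    omega
  | pop t next =>
    cases hp : d.st t with
    | nil =>
      refine ⟨none, d, ?_⟩
      simp [edge, hr, Instr.sem, hp]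
    | cons b l =>
      refine ⟨some b, { d with st := Function.update d.st t l }, ?_⟩
      simp [edge, hr, Instr.sem, hp]
  | isEmpty t next =>
    refine ⟨some (d.st t).isEmpty, d, ?_⟩
    simp [edge, hr, Instr.sem]

end Machine

namespace Machine

theorem output_prefix_step {m : ℕ} (V : Machine m) (c : Config m V.State) :
    c.output <+: (V.step c).output := by
  unfold step
  split <;> simp

/-- Output is never erased, so in an accepted computation it is at all times a prefix of the
expected string; a wrong bit may be rejected at once. -/
theorem output_prefix_configAt {m : ℕ} (V : Machine m) (input : Fin m → List Bool) {t t' : ℕ}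
    (h : t ≤ t') : (V.configAt input t).output <+: (V.configAt input t').output := by
  induction h with
  | refl => exact List.prefix_refl _
  | step _ ih =>
    refine ih.trans ?_
    simp only [configAt, Function.iterate_succ_apply']
    exact output_prefix_step V _

theorem step_of_halt {m : ℕ} (V : Machine m) {c : Config m V.State}
    (h : V.request c.state = .halt) : V.step c = c := by
  unfold step
  rw [h]

theorem usesSpace_of_halt {m : ℕ} (V : Machine m) {input : Fin m → List Bool} {t s : ℕ}
    (h : V.request (V.configAt input t).state = .halt)
    (hs : ∀ t' ≤ t, (V.configAt input t').space ≤ s) : V.UsesSpace input s := by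
  intro t'
  rcases le_total t' t with h1 | h1
  · exact hs t' h1
  · obtain ⟨r, rfl⟩ := Nat.exists_eq_add_of_le h1
    have : V.configAt input (t + r) = V.configAt input t := by
      simp only [configAt]
      rw [Nat.add_comm, Function.iterate_add_apply]
      exact Function.iterate_fixed (V.step_of_halt h) r
    rw [this]
    exact hs t le_rfl

variable {U : Machine 2}

/-- The data at the end of an accepted computation. -/
def finalDat (W : Bool → List Bool) : Dat := ⟨fun o => (W o).length, fun _ => []⟩

def initialDat : Dat := ⟨fun _ => 0, fun _ => []⟩

theorem valid_finalDat (W : Bool → List Bool) (s : ℕ) : (finalDat W).Valid W s :=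
  ⟨fun _ => le_rfl, by simp [finalDat, Dat.space]⟩

theorem valid_initialDat (W : Bool → List Bool) (s : ℕ) : initialDat.Valid W s :=
  ⟨fun _ => Nat.zero_le _, by simp [initialDat, Dat.space]⟩

theorem initial_eq_confOf (W : Bool → List Bool) :
    U.initial ![W false, []] = U.confOf W U.init initialDat := by
  simp [initial, confOf, initialDat]

theorem reach_clean {W : Bool → List Bool} {s : ℕ} (t : Fin 2) (l : List Bool) (d : Dat)
    (hd : d.Valid W s) (hl : d.st t = l) :
    (U.graph W s).Reach (.clean t, d) (if t = 0 then .clean 1 else .skipProgram,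
      { d with st := Function.update d.st t [] }) := by
  induction l generalizing d with
  | nil =>
    refine Relation.ReflTransGen.single (U.graph_step_iff.2 ⟨hd, none, rfl, ?_⟩)
    have h1 : Function.update d.st t [] = d.st := by rw [← hl, Function.update_eq_self]
    simp [edge, Instr.sem, hl, h1]
  | cons b l ih =>
    have h1 : (U.edge (.clean t) (some b)).1.sem W s d =
        some { d with st := Function.update d.st t l } := by
      simp [edge, Instr.sem, hl]
    have h2 := ih _ (Instr.sem_valid hd h1) (by simp)
    simp only [Function.update_idem] at h2
    exact Relation.ReflTransGen.head (U.graph_step_iff.2 ⟨hd, some b, rfl, h1⟩) h2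

theorem reach_skipProgram {W : Bool → List Bool} {s : ℕ} (n : ℕ) (d : Dat)
    (hd : d.Valid W s) (hn : d.pos false + n = (W false).length) :
    (U.graph W s).Reach (.skipProgram, d) (.done,
      { d with pos := Function.update d.pos false (W false).length }) := by
  induction n generalizing d with
  | zero =>
    refine Relation.ReflTransGen.single (U.graph_step_iff.2 ⟨hd, none, rfl, ?_⟩)
    have h0 : d.pos false = (W false).length := by omega
    have h1 : Function.update d.pos false (W false).length = d.pos := by
      rw [← h0, Function.update_eq_self]
    simp [edge, Instr.sem, h0, h1]
  | succ n ih =>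
    have h0 : d.pos false < (W false).length := by omega
    have h1 : (U.edge .skipProgram (some (W false)[d.pos false])).1.sem W s d =
        some { d with pos := Function.update d.pos false (d.pos false + 1) } := by
      simp [edge, Instr.sem, h0]
    have h2 := ih _ (Instr.sem_valid hd h1) (by simp; omega)
    simp only [Function.update_idem] at h2
    exact Relation.ReflTransGen.head (U.graph_step_iff.2 ⟨hd, _, rfl, h1⟩) h2

/-- The steps of `U` are followed up to the first halting time; then emptying the stacks and reading
the rest of the program leads to the unique accepting vertex. -/
theorem reach_of_accepts {W : Bool → List Bool} {s : ℕ} (h : U.Outputs ![W false, []] (W true))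
    (hs : U.UsesSpace ![W false, []] s) :
    (U.graph W s).Reach (.start, initialDat) (.done, finalDat W) := by
  classical
  have hex : ∃ t, U.request (U.configAt ![W false, []] t).state = .halt := by
    obtain ⟨t, h1, -⟩ := h; exact ⟨t, h1⟩
  set t₀ := Nat.find hex with ht₀
  have hhalt := Nat.find_spec hex
  rw [← ht₀] at hhalt
  have hout : (U.configAt ![W false, []] t₀).output = W true := by
    obtain ⟨t, h1, h2⟩ := h
    have hle : t₀ ≤ t := Nat.find_min' hex h1
    obtain ⟨r, rfl⟩ := Nat.exists_eq_add_of_le hle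
    rw [← h2]
    have h3 : U.configAt ![W false, []] (t₀ + r) = U.configAt ![W false, []] t₀ := by
      rw [configAt, Nat.add_comm, Function.iterate_add_apply]
      exact Function.iterate_fixed (U.step_of_halt hhalt) r
    rw [h3]
  have key : ∀ t ≤ t₀, ∃ q d, d.Valid W s ∧ U.configAt ![W false, []] t = U.confOf W q d ∧
      (U.graph W s).Reach (.start, initialDat) (.run q, d) := by
    intro t
    induction t with
    | zero =>
      intro _
      refine ⟨U.init, initialDat, valid_initialDat W s, initial_eq_confOf W,
        Relation.ReflTransGen.single (U.graph_step_iff.2 ⟨valid_initialDat W s, none, rfl, ?_⟩)⟩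
      simp [edge, Instr.sem, initialDat]
    | succ t ih =>
      intro ht
      obtain ⟨q, d, hd, h1, h2⟩ := ih (by omega)
      have hq : U.request q ≠ .halt := by
        have := Nat.find_min hex (m := t) (by omega)
        rwa [h1] at this
      have h3 : U.configAt ![W false, []] (t + 1) = U.step (U.confOf W q d) := by
        rw [← h1]; simp only [configAt, Function.iterate_succ_apply']
      obtain ⟨a, q', d', h4, h5, h6⟩ := exists_edge_of_step (s := s) hq hd (h3 ▸ hs (t + 1))
        (by rw [← h3, ← hout]; exact U.output_prefix_configAt _ ht)
      exact ⟨q', d', Instr.sem_valid hd h5, h3.trans h6,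
        h2.tail (U.graph_step_iff.2 ⟨hd, a, by rw [h4], h5⟩)⟩
  obtain ⟨q, d, hd, h1, h2⟩ := key t₀ le_rfl
  rw [h1] at hhalt hout
  have hq : U.request q = .halt := hhalt
  have hpos : d.pos true = (W true).length := by
    have h3 : (W true).take (d.pos true) = W true := hout
    have h4 := congrArg List.length h3
    have h5 := hd.pos_le true
    simp only [List.length_take] at h4
    omega
  have hstep : (U.graph W s).Step (.run q, d) (.clean 0, d) :=
    U.graph_step_iff.2 ⟨hd, none, by simp [edge, hq], by simp [edge, hq, Instr.sem]⟩
  refine h2.trans (Relation.ReflTransGen.head hstep ?_)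
  · have hv : ∀ (st : Fin 2 → List Bool) (_ : (Dat.mk d.pos st).space ≤ d.space),
        (Dat.mk d.pos st).Valid W s := fun st h => ⟨hd.pos_le, h.trans hd.space_le⟩
    have h3 := reach_clean (U := U) (s := s) 0 _ d hd rfl
    have hd1 := hv (Function.update d.st 0 []) (by simp [Dat.space])
    have h4 := reach_clean (U := U) (s := s) 1 _ _ hd1 rfl
    have hd2 := hv (Function.update (Function.update d.st 0 []) 1 []) (by simp [Dat.space])
    have h5 := reach_skipProgram (U := U) (s := s) ((W false).length - d.pos false) _ hd2
      (by have := hd.pos_le false; simp only; omega)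
    simp only [if_true, one_ne_zero, if_false] at h3 h4
    have h6 := (h3.trans h4).trans h5
    have h7 : (Dat.mk (Function.update d.pos false (W false).length)
        (Function.update (Function.update d.st 0 []) 1 [])) = finalDat W := by
      refine Dat.ext (funext fun o => ?_) (funext fun t => ?_)
      · cases o <;> simp [finalDat, hpos]
      · fin_cases t <;> simp [finalDat]
    simp only [h7] at h6
    exact h6

/-- Every vertex with an outgoing edge is valid, which yields the space bound. -/
theorem accepts_of_reach {W : Bool → List Bool} {s : ℕ} {d : Dat}
    (h : (U.graph W s).Reach (.start, d) (.done, finalDat W)) :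
    U.Outputs ![W false, []] (W true) ∧ U.UsesSpace ![W false, []] s := by
  -- Induction backwards from the accepting vertex. Nothing is written after halting, so in the
  -- closing phase the output must already be complete; this gives the output at the moment of
  -- halting.
  have key : ∀ v, (U.graph W s).Reach v (.done, finalDat W) →
      (∀ q, v.1 = .run q → ∃ t, U.request (U.step^[t] (U.confOf W q v.2)).state = .halt ∧
        (U.step^[t] (U.confOf W q v.2)).output = W true ∧
        ∀ t' ≤ t, (U.step^[t'] (U.confOf W q v.2)).space ≤ s) ∧
      (v.1 = .start → ∃ t, U.request (U.step^[t] (U.confOf W U.init initialDat)).state = .halt ∧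
        (U.step^[t] (U.confOf W U.init initialDat)).output = W true ∧
        ∀ t' ≤ t, (U.step^[t'] (U.confOf W U.init initialDat)).space ≤ s) ∧
      (((∃ t, v.1 = .clean t) ∨ v.1 = .skipProgram ∨ v.1 = .done) →
        v.2.pos true = (W true).length) := by
    intro v hv
    induction hv using Relation.ReflTransGen.head_induction_on with
    | refl => exact ⟨by simp, by simp, by simp [finalDat]⟩
    | @head v w hvw _ ih =>
      obtain ⟨c, d⟩ := v
      obtain ⟨c', d'⟩ := w
      obtain ⟨hd, a, h1, h2⟩ := U.graph_step_iff.1 hvw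
      simp only at hd h1 h2 ih ⊢
      obtain ⟨ih1, ih2, ih3⟩ := ih
      cases c with
      | start =>
        refine ⟨by simp, fun _ => ?_, by simp⟩
        rcases a with _ | b
        · simp only [edge, Instr.sem, Option.ite_none_right_eq_some, Option.some.injEq] at h1 h2
          obtain ⟨⟨h3, h4, h5, h6⟩, rfl⟩ := h2
          have h7 : d = initialDat := by
            refine Dat.ext (funext fun o => ?_) (funext fun t => ?_)
            · cases o <;> simp [initialDat, h5, h6]
            · fin_cases t <;> simp [initialDat, h3, h4]
          subst h7
          exact ih1 _ h1.symm
        · cases h2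
      | run q =>
        refine ⟨?_, by simp, by simp⟩
        rintro q' ⟨⟩
        by_cases hq : U.request q = .halt
        · refine ⟨0, hq, ?_, fun t' ht' => ?_⟩
          · simp only [edge, hq] at h1 h2
            rcases a with _ | b
            · simp only [Instr.sem, Option.some.injEq] at h2
              subst h2
              have := ih3 (Or.inl ⟨0, h1.symm⟩)
              simp [confOf, this]
            · cases h2
          · obtain rfl := Nat.le_zero.1 ht'
            exact hd.space_le
        · obtain ⟨q', h3, h4⟩ := step_confOf_of_edge hq h2
          obtain ⟨t, h5, h6, h7⟩ := ih1 q' (h1.symm.trans h3)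
          refine ⟨t + 1, ?_, ?_, fun t' ht' => ?_⟩
          · rw [Function.iterate_succ_apply, h4, h5]
          · rw [Function.iterate_succ_apply, h4, h6]
          · cases t' with
            | zero => exact hd.space_le
            | succ t' =>
              rw [Function.iterate_succ_apply, h4]
              exact h7 t' (by omega)
      | clean t =>
        refine ⟨by simp, by simp, fun _ => ?_⟩
        rcases a with _ | b
        · simp only [edge, Instr.sem, Option.ite_none_right_eq_some, Option.some.injEq] at h1 h2
          obtain ⟨-, rfl⟩ := h2
          refine ih3 ?_
          split_ifs at h1
          · exact Or.inl ⟨_, h1.symm⟩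
          · exact Or.inr (Or.inl h1.symm)
        · simp only [edge, Instr.sem, Option.ite_none_right_eq_some, Option.some.injEq] at h1 h2
          obtain ⟨-, rfl⟩ := h2
          exact ih3 (Or.inl ⟨_, h1.symm⟩)
      | skipProgram =>
        refine ⟨by simp, by simp, fun _ => ?_⟩
        rcases a with _ | b
        · simp only [edge, Instr.sem, Option.ite_none_right_eq_some, Option.some.injEq] at h1 h2
          obtain ⟨-, rfl⟩ := h2
          exact ih3 (Or.inr (Or.inr h1.symm))
        · simp only [edge, Instr.sem, Option.ite_none_right_eq_some, Option.some.injEq] at h1 h2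
          obtain ⟨-, rfl⟩ := h2
          simpa using ih3 (Or.inr (Or.inl h1.symm))
      | done => cases h2
  obtain ⟨t, h1, h2, h3⟩ := (key _ h).2.1 rfl
  rw [← initial_eq_confOf] at h1 h2 h3
  exact ⟨⟨t, h1, h2⟩, U.usesSpace_of_halt h1 h3⟩

end Machine

/-! ### The search as a program -/

namespace Machine

/-- The machine outputs `x` on the program `p` in space `s`. -/
def Accepts (U : Machine 2) (s : ℕ) (x p : List Bool) : Prop :=
  U.Outputs ![p, []] x ∧ U.UsesSpace ![p, []] s

variable (U : Machine 2)

/-- The finite part of a position in the search through the graph of computations. -/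
structure Spot : Type where
  c : Ctl U.State
  up : Bool
  e : Fin (U.edgeCount + 1)

instance : Finite U.Spot :=
  Finite.of_injective (fun k : U.Spot => (k.c, k.up, k.e)) fun k l h => by
    cases k; cases l; simp_all

def rootSpot (e : Fin (U.edgeCount + 1)) : U.Spot := ⟨.done, false, e⟩

variable {U}

/-- The default value is harmless: for a number without an edge the instruction is `fail`, so the
search never moves to this state. -/
noncomputable def edgeSource (e : ℕ) : Ctl U.State := ((U.edgeAt e).map Prod.fst).getD .done

noncomputable def edgeTarget (e : ℕ) : Ctl U.State :=
  ((U.edgeAt e).map fun x => (U.edge x.1 x.2).2).getD .done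

open Classical in
/-- The instruction executed at a position of the search. -/
noncomputable def Spot.instr (k : U.Spot) : Instr :=
  ((U.edgeAt k.e).map fun x =>
    if k.up then if x.1 = k.c then (U.edge x.1 x.2).1 else .fail
    else if (U.edge x.1 x.2).2 = k.c then (U.edge x.1 x.2).1.inv else .fail).getD .fail

open Classical in
/-- Continue after trying to follow an edge. -/
noncomputable def Spot.update (v : Vars U.Spot) : Vars U.Spot :=
  if v.ctl.e.1 < U.edgeCount then
    if v.ok then
      if v.ctl.up then
        -- There is no wrap-around, because the edge number is less than `edgeCount` here and the
        -- type has `edgeCount + 1` elements.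
        { v with ok := false, ctl := ⟨edgeTarget v.ctl.e, false, Fin.ofNat _ (v.ctl.e + 1)⟩ }
      else
        { v with
          ok := false
          res := v.res || decide (edgeSource (U := U) v.ctl.e = .start)
          ctl := ⟨edgeSource v.ctl.e, false, 0⟩ }
    else { v with ok := false, ctl := ⟨v.ctl.c, v.ctl.up, Fin.ofNat _ (v.ctl.e + 1)⟩ }
  else { v with ok := false, ctl := ⟨v.ctl.c, true, 0⟩ }

open Classical in
noncomputable def Spot.going (v : Vars U.Spot) : Bool :=
  !decide (v.ctl.c = .done ∧ v.ctl.up = false ∧ U.edgeCount ≤ v.ctl.e)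

noncomputable def spotOf (S : FuncGraph.Pos (Ctl U.State × Dat)) : U.Spot := ⟨S.v.1, S.up, Fin.ofNat _ S.e⟩

theorem stepFwd_eq {W : Bool → List Bool} {s e : ℕ} {v : Ctl U.State × Dat}
    (k : U.Spot) (hc : k.c = v.1) (hu : k.up = true) (he : k.e = e) :
    U.stepFwd W s e v = (k.instr.sem W s v.2).map fun d => (edgeTarget e, d) := by
  obtain ⟨c, u, e'⟩ := k
  simp only at hc hu he
  subst he hu hc
  unfold stepFwd Spot.instr edgeTarget
  cases h : U.edgeAt e' with
  | none => simp [Instr.sem]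
  | some x =>
    simp only [Option.bind_some, Option.map_some, Option.getD_some, if_true]
    split_ifs <;> simp only [Instr.sem, Option.map_none]

theorem stepBwd_eq {W : Bool → List Bool} {s e : ℕ} {v : Ctl U.State × Dat}
    (k : U.Spot) (hc : k.c = v.1) (hu : k.up = false) (he : k.e = e) :
    U.stepBwd W s e v = (k.instr.sem W s v.2).map fun d => (edgeSource e, d) := by
  obtain ⟨c, u, e'⟩ := k
  simp only at hc hu he
  subst he hu hc
  unfold stepBwd Spot.instr edgeSource
  cases h : U.edgeAt e' with
  | none => simp [Instr.sem]
  | some x =>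
    simp only [Option.bind_some, Option.map_some, Option.getD_some, Bool.false_eq_true,
      if_false]
    split_ifs <;> simp only [Instr.sem, Option.map_none]

end Machine

namespace Cmd

variable {F : Type} [Fintype F] [DecidableEq F] {L : Limits (Name ⊕ F)} {U : Machine 2}
  {Γ : Env F}

open Machine

/-- One move of the search. -/
noncomputable def searchStep : Prog U.Spot F :=
  .seq (cases (fun v => v.ctl) fun k => instr k.instr) (modify Spot.update)

/-- Decide whether the program and the output on stack `1` belong together. -/
noncomputable def search : Prog U.Spot F := whileDo Spot.going searchStep

-- One pass through the loop is one move of the abstract search: the data of the vertex are in the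
-- stacks and counters, everything else is in the finite control.
open Classical in
theorem Run.searchStep (hΓ : Γ.Fits L) (S : FuncGraph.Pos (Ctl U.State × Dat))
    (hS : (U.graph Γ.W Γ.s).Good S) {v : Vars U.Spot}
    (hok : v.ok = false) (hv : v.buf = false) (hval : v.val = none) :
    Run L Cmd.searchStep (Γ.mem { v with res := S.found, ctl := spotOf S } S.v.2)
      (Γ.mem { v with
        res := ((U.graph Γ.W Γ.s).next S).found
        ctl := spotOf ((U.graph Γ.W Γ.s).next S) } ((U.graph Γ.W Γ.s).next S).v.2) := by
  obtain ⟨hd, he, -, -⟩ := hS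
  have he' : ((spotOf S).e : ℕ) = S.e := by
    simp only [spotOf, Fin.val_ofNat]
    exact Nat.mod_eq_of_lt (Nat.lt_succ_of_le he)
  have hmod : S.e % (U.edgeCount + 1) = S.e := Nat.mod_eq_of_lt (Nat.lt_succ_of_le he)
  have hsize : (U.graph Γ.W Γ.s).size = U.edgeCount := rfl
  refine Run.seq (Run.cases (Run.instr hΓ (spotOf S).instr hd hv hval)) ?_
  have hd2 : (((spotOf S).instr.sem Γ.W Γ.s S.v.2).getD S.v.2).Valid Γ.W Γ.s := by
    cases h : (spotOf S).instr.sem Γ.W Γ.s S.v.2 with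
    | none => exact hd
    | some d => exact Instr.sem_valid hd h
  refine (Run.mem_modify hΓ hd2).of_eq ?_
  unfold FuncGraph.next
  rw [hsize]
  by_cases hlt : S.e < U.edgeCount
  · rw [if_pos hlt]
    cases hup : S.up with
    | true =>
      have h1 := stepFwd_eq (W := Γ.W) (s := Γ.s) (e := S.e) (v := S.v) (spotOf S) rfl hup he'
      have h2 : (U.graph Γ.W Γ.s).fwd S.e S.v = U.stepFwd Γ.W Γ.s S.e S.v := rfl
      rw [if_pos rfl, h2, h1]
      cases h : (spotOf S).instr.sem Γ.W Γ.s S.v.2 with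
      | none =>
        simp [Spot.update, hlt, hok, hmod, spotOf, hup]
      | some d =>
        simp [Spot.update, hlt, hok, hmod, spotOf, hup]
    | false =>
      have h1 := stepBwd_eq (W := Γ.W) (s := Γ.s) (e := S.e) (v := S.v) (spotOf S) rfl hup he'
      have h2 : (U.graph Γ.W Γ.s).bwd S.e S.v = U.stepBwd Γ.W Γ.s S.e S.v := rfl
      rw [if_neg (by simp), h2, h1]
      cases h : (spotOf S).instr.sem Γ.W Γ.s S.v.2 with
      | none =>
        simp [Spot.update, hlt, hok, hmod, spotOf, hup]
      | some d =>
        have h3 : (U.graph Γ.W Γ.s).isStart (edgeSource S.e, d) =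
          decide (edgeSource (U := U) S.e = .start) := rfl
        simp [Spot.update, hlt, hok, hmod, spotOf, hup, h3]
  · rw [if_neg hlt]
    have h : (spotOf S).instr = .fail := by
      simp [Spot.instr, he', U.edgeAt_eq_none _ hlt]
    rw [h]
    simp [Spot.update, hlt, hok, hmod, Instr.sem, spotOf]

-- The search leaves the memory as it found it, at the accepting vertex, so the next program can be
-- treated without any reinitialization of the data.
open Classical in
theorem Run.search (hΓ : Γ.Fits L) {v : Vars U.Spot}
    (hok : v.ok = false) (hv : v.buf = false) (hval : v.val = none)
    (hctl : v.ctl = U.rootSpot 0) :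
    Run L Cmd.search (Γ.mem v (finalDat Γ.W)) (Γ.mem { v with
      res := v.res || decide (U.Accepts Γ.s (Γ.W true) (Γ.W false))
      ctl := U.rootSpot (Fin.last _) } (finalDat Γ.W)) := by
  have hroot : (U.graph Γ.W Γ.s).isRoot (.done, finalDat Γ.W) = true := by simp [graph]
  obtain ⟨f, h1, h2⟩ := FuncGraph.search_subtree hroot (.done, finalDat Γ.W)
    (valid_finalDat Γ.W Γ.s) .refl v.res (by simp [graph])
  have key : ∀ S, Relation.ReflTransGen (U.graph Γ.W Γ.s).Moves S
      ⟨(.done, finalDat Γ.W), false, U.edgeCount, f⟩ →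
      Run L Cmd.search (Γ.mem { v with res := S.found, ctl := spotOf S } S.v.2)
        (Γ.mem { v with res := f, ctl := U.rootSpot (Fin.last _) } (finalDat Γ.W)) := by
    intro S hS
    induction hS using Relation.ReflTransGen.head_induction_on with
    | refl =>
      have h3 : spotOf (U := U) ⟨(.done, finalDat Γ.W), false, U.edgeCount, f⟩ =
          U.rootSpot (Fin.last _) := by
        simp only [spotOf, rootSpot, Spot.mk.injEq, true_and]
        exact Fin.ext (by simp)
      rw [h3]
      refine Run.whileDo_done (hΓ.mem (valid_finalDat Γ.W Γ.s) _) ?_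
      simp [Spot.going, Env.mem, rootSpot]
    | @head S S' hS _ ih =>
      obtain ⟨hgood, rfl⟩ := hS
      refine Run.whileDo_next ?_ (Run.searchStep hΓ S hgood hok hv hval) ih
      have hnd := hgood.2.2.1
      have he' : ((spotOf S).e : ℕ) = S.e := by
        simp only [spotOf, Fin.val_ofNat]
        exact Nat.mod_eq_of_lt (Nat.lt_succ_of_le hgood.2.1)
      simp only [Spot.going, Bool.not_eq_true', decide_eq_false_iff_not]
      intro hh
      refine hnd ⟨?_, hh.2.1, ?_⟩
      · have h3 : S.v.1 = .done := hh.1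
        simpa [graph] using h3
      · have := hh.2.2
        rw [show ((Γ.mem { v with res := S.found, ctl := spotOf S } S.v.2).ctl.ctl.e : ℕ) = S.e
          from he'] at this
        exact this
  have h4 := key _ h1
  have h5 : spotOf (U := U) ⟨(.done, finalDat Γ.W), false, 0, v.res⟩ = v.ctl := by
    rw [hctl]; simp [spotOf, rootSpot]
  simp only [h5] at h4
  have h6 : f = (v.res || decide (U.Accepts Γ.s (Γ.W true) (Γ.W false))) := by
    rw [Bool.eq_iff_iff, h2, Bool.or_eq_true, decide_eq_true_iff]
    refine or_congr_right ⟨?_, ?_⟩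
    · rintro ⟨⟨c, d⟩, -, h7, h8⟩
      obtain rfl : c = .start := by simpa [graph] using h7
      exact accepts_of_reach h8
    · rintro ⟨h7, h8⟩
      exact ⟨(.start, initialDat), valid_initialDat _ _, by simp [graph],
        reach_of_accepts h7 h8⟩
  rw [← h6]
  exact h4

end Cmd

/-! ### Enumeration of the programs of given length -/

/-- The number with given binary digits, least significant digit first. -/
def bitsVal : List Bool → ℕ
  | [] => 0
  | b :: l => b.toNat + 2 * bitsVal l

/-- Binary addition of one, modulo a power of two. -/
def succBits : List Bool → List Bool
  | [] => []
  | false :: l => true :: l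
  | true :: l => false :: succBits l

theorem length_succBits (l : List Bool) : (succBits l).length = l.length := by
  induction l with
  | nil => rfl
  | cons b l ih => cases b <;> simp [succBits, ih]

theorem bitsVal_lt (l : List Bool) : bitsVal l < 2 ^ l.length := by
  induction l with
  | nil => simp [bitsVal]
  | cons b l ih =>
    have : b.toNat ≤ 1 := b.toNat_le
    simp only [bitsVal, List.length_cons, pow_succ]; omega

theorem bitsVal_injective {l l' : List Bool} (h : l.length = l'.length)
    (hv : bitsVal l = bitsVal l') : l = l' := by
  induction l generalizing l' with
  | nil => cases l' <;> simp_all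
  | cons b l ih =>
    cases l' with
    | nil => simp at h
    | cons b' l' =>
      simp only [bitsVal] at hv
      have h1 : b = b' := by cases b <;> cases b' <;> simp at hv ⊢ <;> omega
      subst h1
      rw [ih (by simpa using h) (by omega)]

theorem bitsVal_succBits {l : List Bool} (h : l.any (!·) = true) :
    bitsVal (succBits l) = bitsVal l + 1 := by
  induction l with
  | nil => simp at h
  | cons b l ih =>
    cases b
    · simp [succBits, bitsVal]; omega
    · have := ih (by simpa using h)
      simp [succBits, bitsVal, this]; omega

/-- The last word of a given length is followed by the word of zeros, which is the right one to be
lengthened. -/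
theorem succBits_of_not_any {l : List Bool} (h : l.any (!·) = false) :
    succBits l = List.replicate l.length false ∧ bitsVal l + 1 = 2 ^ l.length := by
  induction l with
  | nil => simp [succBits, bitsVal]
  | cons b l ih =>
    cases b
    · simp at h
    · have := ih (by simpa using h)
      simp only [succBits, bitsVal, List.length_cons, pow_succ, List.replicate_succ, this.1,
        true_and]
      simp; omega

theorem bitsVal_replicate_false (n : ℕ) : bitsVal (List.replicate n false) = 0 := by
  induction n with
  | zero => rfl
  | succ n ih => simp [List.replicate_succ, bitsVal, ih]

namespace Cmd

variable {κ F : Type} [Fintype F] [DecidableEq F] {L : Limits (Name ⊕ F)}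

theorem Run.whileDo_done_eq {p : Vars κ → Bool} {c : Prog κ F}
    {a b : Mem 3 (Vars κ) (Name ⊕ F)} (h : a.Fits L) (hp : p a.ctl = false) (hab : a = b) :
    Run L (Cmd.whileDo p c) a b := (Run.whileDo_done h hp).of_eq hab

theorem fits_mono {a b : Mem 3 (Vars κ) (Name ⊕ F)} (h : a.Fits L) (hc : ∀ i, b.cnt i ≤ a.cnt i)
    (ht : b.fst.length + b.snd.length ≤ a.fst.length + a.snd.length) : b.Fits L :=
  ⟨fun i hi => (hc i).trans (h.small i hi), by have := h.total; have := hc L.big; omega⟩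

theorem Run.of_eq' {c : Prog κ F} {a a' b b' : Mem 3 (Vars κ) (Name ⊕ F)} (h : Run L c a b)
    (ha : a = a') (hb : b = b') : Run L c a' b' := ha ▸ hb ▸ h

/-- Put as many zeros on stack `1` as counter `T` says. -/
noncomputable def pushZeros : Prog κ F :=
  .seq (test (.inl .Z) (.inl .T)) (whileDo Vars.ok
    (.seq (pushSnd (fun _ => false) id) (.seq (dec (.inl .T)) (test (.inl .Z) (.inl .T)))))

theorem Run.pushZeros (hL : L.big ≠ .inl .T) {v : Vars κ} {c : Name ⊕ F → ℕ} {t : ℕ}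
    {inp : Fin 3 → List Bool} {fst snd out : List Bool}
    (hf : Mem.Fits L ⟨v, c, inp, fst, List.replicate t false ++ snd, out⟩)
    (hZ : c (.inl .Z) = 0) (hT : c (.inl .T) = t) :
    Run L Cmd.pushZeros ⟨v, c, inp, fst, snd, out⟩
      ⟨{ v with ok := false }, Function.update c (.inl .T) 0, inp, fst,
        List.replicate t false ++ snd, out⟩ := by
  refine Run.seq (Run.test (fits_congr hf rfl (by simp))) ?_
  simp only
  induction t generalizing snd c v with
  | zero =>
    simp only [hZ, hT, lt_self_iff_false, decide_false, List.replicate_zero, List.nil_append]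
    rw [show (0 : ℕ) = c (.inl .T) by rw [hT], Function.update_eq_self]
    exact Run.whileDo_done (fits_congr hf rfl (by simp)) rfl
  | succ t ih =>
    have h1 : decide (c (.inl .Z) < c (.inl .T)) = true := by simp [hZ, hT]
    rw [h1]
    have h2 : List.replicate (t + 1) false ++ snd = List.replicate t false ++ false :: snd := by
      rw [List.replicate_succ', List.append_assoc]; rfl
    have hf0 := hf.total
    simp only [List.length_append, List.length_replicate] at hf0
    have hf2 : Mem.Fits L ⟨{ v with ok := true },
        Function.update c (.inl .T) (c (.inl .T) - 1), inp, fst,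
          List.replicate t false ++ false :: snd, out⟩ := by
      refine fits_update hf hL.symm (n := c (.inl .T) - 1) ?_ rfl (by simp; omega)
      exact (Nat.sub_le _ _).trans (hf.small (.inl .T) hL.symm)
    refine Run.whileDo_next rfl (Run.seq (Run.pushSnd ?_ ?_) (Run.seq (Run.dec ?_ ?_)
      (Run.test ?_))) ?_
    · exact fits_congr hf rfl (by simp)
    · simp; omega
    · exact fits_congr hf rfl (by simp)
    · simp [hT]
    · exact fits_congr hf2 rfl (by simp)
    · have := ih (v := { v with ok := true }) (snd := false :: snd) hf2 (by simp [hZ])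
        (by simp [hT])
      simp only [Function.update_idem] at this
      rw [h2]
      exact this

/-- Remove the ones on top of the array and change the zero below them into a one. -/
noncomputable def carryLoop : Prog κ F := whileDo Vars.ok
    (.seq (popSnd fun v b => { v with val := b })
      (cond (fun v => v.val == some true)
        (.seq (modify fun v => { v with val := none })
          (.seq (inc (.inl .T)) (test (.inl .T) (.inl .L))))
        (pushSnd (fun _ => true) fun v => { v with ok := false, val := none, more := true })))

/-- Add one to the program on stack `1`, and tell whether there is no overflow. -/
noncomputable def increment : Prog κ F :=
  .seq (modify fun v => { v with more := false }) (.seq (test (.inl .T) (.inl .L))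
    (.seq carryLoop pushZeros))

/-- `T` counts the ones that have been removed; as many zeros are put back afterwards. Overflow is
noticed when `T` reaches the length `L` of the program. -/
theorem Run.carryLoop (hL : L.big ≠ .inl .T) (hL' : L.big ≠ .inl .L) {v : Vars κ}
    {c : Name ⊕ F → ℕ} {inp : Fin 3 → List Bool} {p fst snd out : List Bool}
    (hf : Mem.Fits L ⟨v, c, inp, fst, p ++ snd, out⟩)
    (hZ : c (.inl .Z) = 0) (hT : c (.inl .T) + p.length = c (.inl .L))
    (hval : v.val = none) (hmore : v.more = false) :
    ∃ l t, Run L Cmd.carryLoop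
      ⟨{ v with ok := decide (c (.inl .T) < c (.inl .L)) }, c, inp, fst, p ++ snd, out⟩
      ⟨{ v with ok := false, more := p.any (!·) },
        Function.update c (.inl .T) (c (.inl .T) + t), inp, fst, l ++ snd, out⟩ ∧
      succBits p = List.replicate t false ++ l := by
  induction p generalizing c v with
  | nil =>
    refine ⟨[], 0, ?_, by simp [succBits]⟩
    have h1 : decide (c (.inl .T) < c (.inl .L)) = false := by
      simp at hT ⊢; omega
    simp only [h1, Nat.add_zero, Function.update_eq_self]
    refine Run.whileDo_done_eq (fits_congr hf rfl (by simp)) rfl ?_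
    simp [hmore]
  | cons b p ih =>
    have h1 : decide (c (.inl .T) < c (.inl .L)) = true := by
      simp at hT ⊢; omega
    have hsmall := hf.small (.inl .L) hL'.symm
    have htot := hf.total
    simp only [List.length_cons, List.cons_append, List.length_append] at hT htot hsmall
    rw [h1]
    cases b
    · refine ⟨true :: p, 0, ?_, by simp [succBits]⟩
      simp only [Nat.add_zero, Function.update_eq_self]
      refine Run.whileDo_next rfl (Run.seq (Run.popSnd (fits_congr hf rfl (by simp)))
        (Run.cond_false rfl (Run.pushSnd (fits_congr hf rfl (by simp)) ?_)))
        (Run.whileDo_done_eq (fits_congr hf rfl (by simp)) rfl ?_)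
      · simp; omega
      · simp [hval]
    · have hf2 : Mem.Fits L ⟨{ v with ok := true, val := none },
          Function.update c (.inl .T) (c (.inl .T) + 1), inp, fst, p ++ snd, out⟩ :=
        fits_update hf hL.symm (n := c (.inl .T) + 1) (by omega) rfl (by simp)
      obtain ⟨l, t, h2, h3⟩ := ih hf2 (by simp [hZ]) (by simp; omega) rfl hmore
      refine ⟨l, t + 1, ?_, by simp [succBits, h3, List.replicate_succ]⟩
      refine Run.whileDo_next rfl (Run.seq (Run.popSnd (fits_congr hf rfl (by simp)))
        (Run.cond_true rfl (Run.seq (Run.modify (fits_congr hf rfl (by simp)))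
          (Run.seq (Run.inc (fits_congr hf rfl (by simp)) hZ)
            (Run.test (fits_congr hf2 rfl (by simp))))))) ?_
      have h4 : c (.inl .T) + 1 + t = c (.inl .T) + (t + 1) := by omega
      simpa [h4, hval, Cmd.carryLoop] using h2

theorem Run.increment (hL : L.big ≠ .inl .T) (hL' : L.big ≠ .inl .L) {v : Vars κ}
    {c : Name ⊕ F → ℕ} {inp : Fin 3 → List Bool} {p fst snd out : List Bool}
    (hf : Mem.Fits L ⟨v, c, inp, fst, p ++ snd, out⟩)
    (hZ : c (.inl .Z) = 0) (hT : c (.inl .T) = 0) (hp : c (.inl .L) = p.length)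
    (hval : v.val = none) :
    Run L Cmd.increment ⟨v, c, inp, fst, p ++ snd, out⟩
      ⟨{ v with ok := false, more := p.any (!·) }, c, inp, fst, succBits p ++ snd, out⟩ := by
  obtain ⟨l, t, h1, h2⟩ := Run.carryLoop hL hL' (v := { v with more := false }) (c := c)
    (inp := inp) (p := p) (fst := fst) (snd := snd) (out := out)
    (fits_congr hf rfl (by simp)) hZ (by omega) hval rfl
  have hlen := length_succBits p
  rw [h2, List.length_append, List.length_replicate] at hlen
  have hsmall := hf.small (.inl .L) hL'.symm
  simp only [hp] at hsmall
  refine Run.seq (Run.modify hf) (Run.seq (Run.test (fits_congr hf rfl (by simp)))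
    (Run.seq h1 ((Run.pushZeros hL (t := t) ?_ ?_ ?_).of_eq ?_)))
  · refine fits_update hf hL.symm (n := c (.inl .T) + t) (by omega) rfl ?_
    simp; omega
  · simp [hZ]
  · simp [hT]
  · simp only [Function.update_idem, h2, List.append_assoc]
    rw [← hT, Function.update_eq_self]

end Cmd

namespace Env

variable {κ F : Type}

/-- The environment with another program. -/
def withProg (Γ : Env F) (p : List Bool) : Env F :=
  { Γ with W := fun
    | true => Γ.W true
    | false => p }

/-- The memory before and after the search for a computation with program `p`. -/
def ready (Γ : Env F) (v : Vars κ) (p : List Bool) : Mem 3 (Vars κ) (Name ⊕ F) :=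
  (Γ.withProg p).mem v (Machine.finalDat (Γ.withProg p).W)

/-- At the accepting vertex the counters depend on the program only through its length, so passing
to another program of the same length changes no counter. -/
def readyCnt (Γ : Env F) (l : ℕ) : Name ⊕ F → ℕ
  | .inl .I => l
  | .inl .J => l + (Γ.W true).length
  | .inl .L => l
  | .inl .N => l + (Γ.W true).length
  | .inl .G => Γ.s
  | .inl .T => 0
  | .inl .K => Γ.k
  | .inl .C => Γ.c
  | .inl .P => Γ.pw
  | .inl .Z => 0
  | .inr f => Γ.dp f

theorem ready_eq (Γ : Env F) (v : Vars κ) (p : List Bool) :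
    Γ.ready v p = ⟨v, Γ.readyCnt p.length, Γ.inp, [], p ++ Γ.W true, Γ.out⟩ := by
  unfold ready mem
  refine Mem.ext rfl ?_ rfl rfl ?_ rfl
  · funext i
    rcases i with i | i <;> (try cases i) <;>
      simp [cnt, readyCnt, withProg, Machine.finalDat, Dat.space]
  · simp [withProg, Machine.finalDat]

end Env

namespace Cmd

variable {κ F : Type} [Fintype F] [DecidableEq F] {L : Limits (Name ⊕ F)}

open Machine

variable {U : Machine 2}

/-- Search for a computation with the program on stack `1`, then go to the next program. -/
noncomputable def searchNext : Prog U.Spot F :=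
  .seq (modify fun v => { v with ctl := U.rootSpot 0 }) (.seq search increment)

/-- Search for a program that has the length of the one on stack `1` and is not smaller. -/
noncomputable def searchLength : Prog U.Spot F :=
  .seq (modify fun v => { v with more := true }) (whileDo Vars.more searchNext)

open Classical in
theorem Run.searchNext {Γ : Env F} {p : List Bool} (hΓ : (Γ.withProg p).Fits L)
    {v : Vars U.Spot} (hok : v.ok = false) (hv : v.buf = false) (hval : v.val = none) :
    Run L Cmd.searchNext (Γ.ready v p)
      (Γ.ready { v with
          res := v.res || decide (U.Accepts Γ.s (Γ.W true) p)
          more := p.any (!·)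
          ctl := U.rootSpot (Fin.last _) } (succBits p)) := by
  have hfin := valid_finalDat (Γ.withProg p).W Γ.s
  refine Run.seq (Run.mem_modify hΓ hfin) (Run.seq (Run.search hΓ hok hv hval rfl) ?_)
  refine (Run.increment (p := p) (snd := Γ.W true) (fst := []) (out := Γ.out) (inp := Γ.inp)
      (c := Γ.readyCnt p.length)
    (v := { v with
        res := v.res || decide (U.Accepts Γ.s (Γ.W true) p), ctl := U.rootSpot (Fin.last _) })
    (by rw [hΓ.big]; simp) (by rw [hΓ.big]; simp)
       ?_ rfl rfl rfl hval).of_eq' ?_ ?_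
  · rw [← Γ.ready_eq]
    exact hΓ.mem hfin _
  · exact (Γ.ready_eq { v with
        res := v.res || decide (U.Accepts Γ.s (Γ.W true) p), ctl := U.rootSpot (Fin.last _) }
      p).symm
  · rw [Γ.ready_eq, length_succBits, hok]

open Classical in
theorem Run.searchLength {Γ : Env F} (n : ℕ)
    (hΓ : ∀ p : List Bool, p.length = n → (Γ.withProg p).Fits L) {v : Vars U.Spot}
    (hok : v.ok = false) (hv : v.buf = false) (hval : v.val = none) :
    ∃ ctl, Run L Cmd.searchLength (Γ.ready v (List.replicate n false))
      (Γ.ready { v with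
          res := v.res || decide (∃ q, q.length = n ∧ U.Accepts Γ.s (Γ.W true) q)
          more := false
          ctl := ctl } (List.replicate n false)) := by
  -- Induction on the number `r` of programs of length `n` that come after `p`.
  have key : ∀ r (p : List Bool) (v : Vars U.Spot), p.length = n → bitsVal p + r + 1 = 2 ^ n →
      v.ok = false → v.buf = false → v.val = none → v.more = true → 
      ∃ ctl, Run L (whileDo Vars.more Cmd.searchNext) (Γ.ready v p)
      (Γ.ready { v with
          res := v.res || decide (∃ q, q.length = n ∧ bitsVal p ≤ bitsVal q ∧
            U.Accepts Γ.s (Γ.W true) q)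
          more := false
          ctl := ctl } (List.replicate n false)) := by
    intro r
    induction r with
    | zero =>
      intro p v hp hr hok hv hval hmore
      have h1 : p.any (!·) = false := by
        by_contra h1
        have h2 := bitsVal_succBits (by simpa using h1)
        have h3 := bitsVal_lt (succBits p)
        rw [length_succBits, hp] at h3
        omega
      have h2 := Run.searchNext (hΓ p hp) hok hv hval
      rw [(succBits_of_not_any h1).1, h1, hp] at h2
      refine ⟨U.rootSpot (Fin.last _), Run.whileDo_next hmore h2 (Run.whileDo_done_eq ?_ rfl ?_)⟩
      · exact (hΓ _ (by simp)).mem (valid_finalDat _ _) _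
      · congr 3
        refine decide_eq_decide.2 ⟨fun h => ⟨p, hp, le_rfl, h⟩, ?_⟩
        rintro ⟨q, h3, h4, h5⟩
        have h6 := bitsVal_lt q
        rw [h3] at h6
        rwa [bitsVal_injective (hp.trans h3.symm) (by omega)]
    | succ r ih =>
      intro p v hp hr hok hv hval hmore
      have h1 : p.any (!·) = true := by
        by_contra h1
        have := (succBits_of_not_any (by simpa using h1)).2
        rw [hp] at this
        omega
      have h2 := Run.searchNext (hΓ p hp) hok hv hval
      have h3 := bitsVal_succBits h1
      rw [h1] at h2
      obtain ⟨ctl, h4⟩ := ih (succBits p) (v := { v with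
          res := v.res || decide (U.Accepts Γ.s (Γ.W true) p)
          more := true
          ctl := U.rootSpot (Fin.last _) }) ((length_succBits p).trans hp) (by omega)
        hok hv hval rfl
      refine ⟨ctl, Run.whileDo_next hmore h2 (h4.of_eq ?_)⟩
      congr 2
      simp only [Bool.or_assoc]
      congr 1
      rw [Bool.eq_iff_iff, Bool.or_eq_true, decide_eq_true_iff, decide_eq_true_iff,
        decide_eq_true_iff, h3]
      constructor
      · rintro (h | ⟨q, h5, h6, h7⟩)
        · exact ⟨p, hp, le_rfl, h⟩
        · exact ⟨q, h5, by omega, h7⟩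
      · rintro ⟨q, h5, h6, h7⟩
        rcases h6.eq_or_lt with h6 | h6
        · exact Or.inl (by rwa [bitsVal_injective (hp.trans h5.symm) h6])
        · exact Or.inr ⟨q, h5, h6, h7⟩
  obtain ⟨ctl, h⟩ := key (2 ^ n - 1) (List.replicate n false) { v with more := true } (by simp)
    (by have := Nat.one_le_two_pow (n := n); rw [bitsVal_replicate_false]; omega) hok hv hval rfl
  refine ⟨ctl, Run.seq (Run.mem_modify (hΓ _ (by simp)) (valid_finalDat _ _)) (h.of_eq ?_)⟩
  simp [bitsVal_replicate_false]

/-- Replace the program on stack `1` by a longer one. -/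
noncomputable def lengthen : Prog κ F :=
  .seq (pushSnd (fun _ => false) id) (.seq (inc (.inl .L)) (.seq (inc (.inl .N))
    (.seq (inc (.inl .I)) (inc (.inl .J)))))

/-- At the accepting vertex both positions stand at the ends of their words, so they grow together
with the two lengths. All intermediate memories are componentwise below the final one, whence they
fit. -/
theorem Run.lengthen {Γ : Env F} {p : List Bool} (hΓ : (Γ.withProg (false :: p)).Fits L)
    {v : Vars κ} : Run L Cmd.lengthen (Γ.ready v p) (Γ.ready v (false :: p)) := by
  have hfit : (Γ.ready v (false :: p)).Fits L := hΓ.mem (valid_finalDat _ _) _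
  have hbig := hΓ.big
  have htot := hfit.total
  rw [Γ.ready_eq] at hfit
  rw [Γ.ready_eq] at htot
  simp only [List.length_nil, List.length_append, List.length_cons, hbig, Env.readyCnt] at htot
  rw [Γ.ready_eq, Γ.ready_eq]
  refine Run.seq (Run.pushSnd (fits_mono hfit ?_ ?_) ?_) (Run.seq (Run.inc (fits_mono hfit ?_ ?_) ?_)
    (Run.seq (Run.inc (fits_mono hfit ?_ ?_) ?_) (Run.seq (Run.inc (fits_mono hfit ?_ ?_) ?_)
    ((Run.inc (fits_mono hfit ?_ ?_) ?_).of_eq ?_))))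
  any_goals first
    | exact Function.update_of_ne (by simp) _ _ 
    | rfl
    | (intro i; rcases i with i | i <;> (try cases i) <;> simp [Env.readyCnt])
    | (simp; done)
    | (simp; omega)
  · simp [hbig, Env.readyCnt]; omega
  · refine Mem.ext rfl ?_ rfl rfl (by simp) rfl
    funext i
    rcases i with i | i <;> (try cases i) <;> simp [Env.readyCnt] <;> omega

/-- Search for a program of length less than `K`. -/
noncomputable def searchAll : Prog U.Spot F :=
  .seq (test (.inl .L) (.inl .K)) (whileDo Vars.ok
    (.seq (modify fun v => { v with ok := false }) (.seq searchLength
      (.seq lengthen (test (.inl .L) (.inl .K))))))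

open Classical in
theorem Run.searchAll {Γ : Env F}
    (hΓ : ∀ p : List Bool, p.length ≤ Γ.k → (Γ.withProg p).Fits L) {v : Vars U.Spot}
    (hok : v.ok = false) (hv : v.buf = false) (hval : v.val = none) :
    ∃ ctl : Bool × U.Spot, Run L Cmd.searchAll (Γ.ready v [])
      (Γ.ready { v with
          res := v.res || decide (∃ q : List Bool, q.length < Γ.k ∧ U.Accepts Γ.s (Γ.W true) q)
          more := ctl.1
          ctl := ctl.2 } (List.replicate Γ.k false)) := by
  have key : ∀ r l (v : Vars U.Spot), l + r = Γ.k →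
      v.ok = decide (l < Γ.k) → v.buf = false → v.val = none →
      ∃ ctl : Bool × U.Spot, Run L (whileDo Vars.ok
    (.seq (Cmd.modify fun v => { v with ok := false }) (.seq Cmd.searchLength
      (.seq Cmd.lengthen (Cmd.test (.inl .L) (.inl .K))))))
          (Γ.ready v (List.replicate l false))
      (Γ.ready { v with
          ok := false
          res := v.res || decide (∃ q : List Bool, l ≤ q.length ∧ q.length < Γ.k ∧
            U.Accepts Γ.s (Γ.W true) q)
          more := ctl.1
          ctl := ctl.2 } (List.replicate Γ.k false)) := by
    intro r
    induction r with
    | zero =>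
      rintro l v h hok hv hval
      obtain rfl : l = Γ.k := h
      refine ⟨(v.more, v.ctl), Run.whileDo_done_eq ?_ (by simp [Env.ready, Env.mem, hok]) ?_⟩
      · exact (hΓ _ (by simp)).mem (valid_finalDat _ _) _
      · have h1 : ¬ ∃ q : List Bool, Γ.k ≤ q.length ∧ q.length < Γ.k ∧
            U.Accepts Γ.s (Γ.W true) q := by
          rintro ⟨q, h1, h2, -⟩; omega
        simp only [h1, decide_false, Bool.or_false]
        congr 1
        cases v
        simp at hok
        simp [hok]
    | succ r ih =>
      rintro l v h hok hv hval
      have hlt : l < Γ.k := by omega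
      obtain ⟨ctl, h1⟩ := Run.searchLength (L := L) (Γ := Γ) l (fun p hp => hΓ p (by omega))
        (v := { v with ok := false }) rfl hv hval
      have hrep : false :: List.replicate l false = List.replicate (l + 1) false := rfl
      have hfit : (Γ.withProg (false :: List.replicate l false)).Fits L := hΓ _ (by simp; omega)
      obtain ⟨ctl', h2⟩ := ih (l + 1) (v := { v with
          ok := decide (l + 1 < Γ.k)
          res := v.res || decide (∃ q, q.length = l ∧ U.Accepts Γ.s (Γ.W true) q)
          more := false
          ctl := ctl }) (by omega) rfl hv hval
      refine ⟨ctl', Run.whileDo_next (by simpa [Env.ready, Env.mem, hok] using hlt)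
        (Run.seq (Run.mem_modify (hΓ _ (by simp; omega)) (valid_finalDat _ _))
        (Run.seq h1 (Run.seq (Run.lengthen hfit)
          (Run.mem_test hfit _ _ (valid_finalDat _ _))))) (h2.of_eq' ?_ ?_)⟩
      · rw [← hrep]
        congr 3
        simp [Env.cnt, Env.withProg]
      · congr 2
        simp only [Bool.or_assoc]
        congr 1
        rw [Bool.eq_iff_iff, Bool.or_eq_true, decide_eq_true_iff, decide_eq_true_iff,
          decide_eq_true_iff]
        constructor
        · rintro (⟨q, h3, h4⟩ | ⟨q, h3, h4⟩)
          · exact ⟨q, h3.ge, by omega, h4⟩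
          · exact ⟨q, by omega, h4⟩
        · rintro ⟨q, h3, h4, h5⟩
          rcases h3.eq_or_lt with h3 | h3
          · exact Or.inl ⟨q, h3.symm, h5⟩
          · exact Or.inr ⟨q, h3, h4, h5⟩
  obtain ⟨ctl, h⟩ := key Γ.k 0 { v with ok := decide (0 < Γ.k) } (by omega) rfl hv hval
  refine ⟨ctl, Run.seq (Run.mem_test (hΓ _ (by simp)) _ _ (valid_finalDat _ _)) (h.of_eq ?_)⟩
  simp [hok]

end Cmd

/-! ### Cheapest runs of finite transducers -/

/-- A nondeterministic transducer; every silent transition has cost zero or one. -/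
structure Transducer (Q : Type) : Type where
  init : Q
  silent : List (Q × Q × Bool)
  output : List (Q × Q × Bool)
  final : List Q

namespace Transducer

variable {Q : Type} (D : Transducer Q)

/-- There is a run to the given state with the given output and the given cost. -/
inductive Cost : Q → List Bool → ℕ → Prop where
  | init : Cost D.init [] 0
  | silent {f g : Q} {w : List Bool} {m : ℕ} {a : Bool} (h : Cost f w m)
      (he : (f, g, a) ∈ D.silent) : Cost g w (m + a.toNat)
  | output {f g : Q} {w : List Bool} {m : ℕ} {b : Bool} (h : Cost f w m)
      (he : (f, g, b) ∈ D.output) : Cost g (w ++ [b]) m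

/-- There is a run with given output and cost that ends with the last output. -/
def Entry (f : Q) (w : List Bool) (m : ℕ) : Prop :=
  (f = D.init ∧ w = [] ∧ m = 0) ∨
    ∃ g u b, w = u ++ [b] ∧ (g, f, b) ∈ D.output ∧ D.Cost g u m

variable {D}

/-- The termination criterion of relaxation: values that no silent transition can improve, and that
are small enough where the word `w` has just been completed, are lower bounds for all costs. -/
theorem Cost.le_of_closed {A : Q → ℕ} {w : List Bool}
    (hA : ∀ f g a, (f, g, a) ∈ D.silent → A g ≤ A f + a.toNat)
    (hE : ∀ f m, D.Entry f w m → A f ≤ m) {f : Q} {m : ℕ} (h : D.Cost f w m) : A f ≤ m := by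
  obtain ⟨u, hu⟩ : ∃ u, u = w := ⟨w, rfl⟩
  rw [← hu] at h
  induction h with
  | init => exact hE _ _ (Or.inl ⟨rfl, hu.symm, rfl⟩)
  | silent h he ih => exact (hA _ _ _ he).trans (Nat.add_le_add_right (ih hu) _)
  | output h he ih => exact hE _ _ (Or.inr ⟨_, _, _, hu.symm, he, h⟩)

def MinCost (D : Transducer Q) (f : Q) (w : List Bool) (m : ℕ) : Prop :=
  D.Cost f w m ∧ ∀ m', D.Cost f w m' → m ≤ m'

/-- Initial parts of a cheapest run are cheapest for their own state and output, and the cost grows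
by at most one per transition; hence no value up to `m` is skipped. -/
theorem MinCost.exists_of_le {f : Q} {w : List Bool} {m : ℕ} (h : D.MinCost f w m) :
    ∀ i ≤ m, ∃ g u, u <+: w ∧ D.MinCost g u i := by
  obtain ⟨h, hm⟩ := h
  induction h with
  | init =>
    intro i hi
    obtain rfl : i = 0 := by omega
    exact ⟨_, _, List.prefix_refl _, .init, hm⟩
  | @silent f g w m a h he ih =>
    intro i hi
    rcases hi.eq_or_lt with rfl | hi
    · exact ⟨_, _, List.prefix_refl _, h.silent he, hm⟩
    · refine ih (fun m' h' => ?_) i (by have := a.toNat_le; omega)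
      have := hm _ (h'.silent he)
      omega
  | @output f g w m b h he ih =>
    intro i hi
    obtain ⟨g', u, h1, h2⟩ := ih (fun m' h' => hm _ (h'.output he)) i hi
    exact ⟨g', u, h1.trans (List.prefix_append _ _), h2⟩

/-- Pigeonhole: the values from zero to the minimal cost all are minimal costs for some state and
some prefix of `w`, and such a pair determines its minimal cost. -/
theorem Cost.exists_lt [Fintype Q] {f : Q} {w : List Bool} {m : ℕ} (h : D.Cost f w m) :
    ∃ m', m' ≤ m ∧ D.Cost f w m' ∧ m' < Fintype.card Q * (w.length + 1) := by
  classical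
  have hex : ∃ m, D.Cost f w m := ⟨m, h⟩
  refine ⟨Nat.find hex, Nat.find_min' hex h, Nat.find_spec hex, ?_⟩
  have hmin : D.MinCost f w (Nat.find hex) :=
    ⟨Nat.find_spec hex, fun m' h' => Nat.find_min' hex h'⟩
  choose g u hu hg using hmin.exists_of_le
  let φ : Fin (Nat.find hex + 1) → Q × Fin (w.length + 1) := fun i =>
    (g i (Nat.lt_succ_iff.1 i.2), ⟨(u i (Nat.lt_succ_iff.1 i.2)).length,
      Nat.lt_succ_of_le (hu i _).length_le⟩)
  have hφ : Function.Injective φ := by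
    intro i j hij
    simp only [φ, Prod.mk.injEq, Fin.mk.injEq] at hij
    have h1 := hg i (Nat.lt_succ_iff.1 i.2)
    have h2 := hg j (Nat.lt_succ_iff.1 j.2)
    have h3 : u i (Nat.lt_succ_iff.1 i.2) = u j (Nat.lt_succ_iff.1 j.2) := by
      rw [List.prefix_iff_eq_take.1 (hu i (Nat.lt_succ_iff.1 i.2)), hij.2,
        ← List.prefix_iff_eq_take.1 (hu j (Nat.lt_succ_iff.1 j.2))]
    rw [hij.1, h3] at h1
    exact Fin.ext (le_antisymm (h1.2 _ h2.1) (h2.2 _ h1.1))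
  have := Fintype.card_le_of_injective φ hφ
  simp only [Fintype.card_fin, Fintype.card_prod] at this
  omega

end Transducer

/-! ### Program triples and relaxation of counters -/

namespace Cmd

variable {κ F : Type} [Fintype F] [DecidableEq F] {L : Limits (Name ⊕ F)}

/-- The program turns memories that satisfy `P` into memories that satisfy `R`. -/
def Triple (L : Limits (Name ⊕ F)) (P : Mem 3 (Vars κ) (Name ⊕ F) → Prop) (c : Prog κ F)
    (R : Mem 3 (Vars κ) (Name ⊕ F) → Prop) : Prop :=
  ∀ a, P a → ∃ b, Run L c a b ∧ R b

theorem Triple.seq {P R S : Mem 3 (Vars κ) (Name ⊕ F) → Prop} {c d : Prog κ F}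
    (h : Triple L P c R) (h' : Triple L R d S) : Triple L P (.seq c d) S := by
  intro a ha
  obtain ⟨b, h1, hb⟩ := h a ha
  obtain ⟨e, h2, he⟩ := h' b hb
  exact ⟨e, h1.seq h2, he⟩

theorem Triple.whileDo {P R : Mem 3 (Vars κ) (Name ⊕ F) → Prop} {c : Prog κ F}
    {p : Vars κ → Bool} (μ : Mem 3 (Vars κ) (Name ⊕ F) → ℕ)
    (hfits : ∀ a, P a → p a.ctl = false → a.Fits L)
    (hR : ∀ a, P a → p a.ctl = false → R a)
    (h : ∀ a, P a → p a.ctl = true → ∃ b, Run L c a b ∧ P b ∧ μ b < μ a) :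
    Triple L P (Cmd.whileDo p c) R := by
  intro a ha
  obtain ⟨n, hn⟩ : ∃ n, n = μ a := ⟨_, rfl⟩
  induction n using Nat.strong_induction_on generalizing a with
  | _ n ih =>
  cases hp : p a.ctl with
  | false => exact ⟨a, Run.whileDo_done (hfits a ha hp) hp, hR a ha hp⟩
  | true =>
    obtain ⟨b, h1, hb, hlt⟩ := h a ha hp
    obtain ⟨e, h2, he⟩ := ih (μ b) (hn ▸ hlt) b hb rfl
    exact ⟨e, Run.whileDo_next hp h1 h2, he⟩

/-- Execute a program for all members of a list. -/
def forEach {α : Type} (l : List α) (body : α → Prog κ F) : Prog κ F :=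
  l.foldr (fun a c => .seq (body a) c) skip

-- The invariant is indexed by the part of the list that has already been handled.
theorem Triple.forEach {α : Type} {l : List α} {body : α → Prog κ F}
    (I : List α → Mem 3 (Vars κ) (Name ⊕ F) → Prop) (hI : ∀ k a, I k a → a.Fits L)
    (h : ∀ k x, x ∈ l → Triple L (I k) (body x) (I (k ++ [x]))) :
    Triple L (I []) (Cmd.forEach l body) (I l) := by
  have key : ∀ r k, (∀ x ∈ r, x ∈ l) → Triple L (I k) (Cmd.forEach r body) (I (k ++ r)) := by
    intro r
    induction r with
    | nil => intro k _ a ha; exact ⟨a, Run.skip (hI k a ha), by simpa using ha⟩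
    | cons x r ih =>
      intro k hr
      have := (h k x (hr x (by simp))).seq (ih (k ++ [x]) fun y hy => hr y (by simp [hy]))
      rw [List.append_assoc] at this
      exact this
  simpa using key l [] fun _ h => h

/-- Lower a counter to the value of another one, increased by one if `a` is true. -/
noncomputable def relax (i j : Name ⊕ F) (a : Bool) : Prog κ F :=
  .seq (add (.inl .T) i (.inl .Z) a) (.seq (test (.inl .T) j)
    (.seq (cond Vars.ok (.seq (copy j (.inl .T)) (modify fun v => { v with more := true })) skip)
      (copy (.inl .T) (.inl .Z))))

theorem Run.relax {i j : Name ⊕ F} {a : Bool} {m : Mem 3 (Vars κ) (Name ⊕ F)} (h : m.Fits L)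
    (hL : L.big ≠ .inl .T) (hj : j ≠ L.big) (hjT : j ≠ .inl .T) (hjZ : j ≠ .inl .Z)
    (hZ : m.cnt (.inl .Z) = 0) (hT : m.cnt (.inl .T) = 0) (hi : m.cnt i + 1 ≤ L.small) :
    ∃ ok, Run L (Cmd.relax i j a) m { m with
      ctl := { m.ctl with
        ok := ok, more := m.ctl.more || decide (m.cnt i + a.toNat < m.cnt j) }
      cnt := Function.update m.cnt j (min (m.cnt j) (m.cnt i + a.toNat)) } := by
  have ha := a.toNat_le
  have hf : ∀ v : Vars κ, Mem.Fits L { m with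
      ctl := v, cnt := Function.update m.cnt (.inl .T) (m.cnt i + a.toNat) } := fun v =>
    fits_update h hL.symm (n := m.cnt i + a.toNat) (by omega) rfl le_rfl
  refine ⟨decide (m.cnt i + a.toNat < m.cnt j), Run.seq ((Run.add h).of_eq (b' := { m with
    cnt := Function.update m.cnt (.inl .T) (m.cnt i + a.toNat) }) (by simp [hZ]))
    (Run.seq (Run.test (hf m.ctl)) (Run.seq (b := { m with
      ctl := { m.ctl with
        ok := decide (m.cnt i + a.toNat < m.cnt j)
        more := m.ctl.more || decide (m.cnt i + a.toNat < m.cnt j) }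
      cnt := Function.update (Function.update m.cnt (.inl .T) (m.cnt i + a.toNat)) j
        (min (m.cnt j) (m.cnt i + a.toNat)) }) ?_ ?_))⟩
  · simp only [Function.update_self, Function.update_of_ne hjT]
    by_cases hlt : m.cnt i + a.toNat < m.cnt j
    · refine Run.cond_true (by simp [hlt]) (Run.seq (Run.copy (hf _) (by simp [hZ]))
        (Run.of_eq (Run.modify ?_) ?_))
      · exact fits_update (hf m.ctl) hj (n := m.cnt i + a.toNat) (by omega) (by simp) le_rfl
      · simp [hlt, min_eq_right hlt.le]
    · refine Run.cond_false (by simp [hlt]) ((Run.skip (hf _)).of_eq ?_)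
      have h1 : min (m.cnt j) (m.cnt i + a.toNat) =
          Function.update m.cnt (.inl .T) (m.cnt i + a.toNat) j := by
        rw [Function.update_of_ne hjT]; omega
      rw [h1, Function.update_eq_self]
      simp [hlt]
  · have hf2 : Mem.Fits L ({ m with
      ctl := { m.ctl with
        ok := decide (m.cnt i + a.toNat < m.cnt j)
        more := m.ctl.more || decide (m.cnt i + a.toNat < m.cnt j) }
      cnt := Function.update (Function.update m.cnt (.inl .T) (m.cnt i + a.toNat)) j
        (min (m.cnt j) (m.cnt i + a.toNat)) }) :=
      fits_update (hf m.ctl) hj (n := min (m.cnt j) (m.cnt i + a.toNat)) (by omega) rfl le_rfl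
    refine (Run.copy hf2 (by simp [hZ, hjZ.symm])).of_eq ?_
    have h1 : Function.update (Function.update m.cnt (.inl .T) (m.cnt i + a.toNat)) j
        (min (m.cnt j) (m.cnt i + a.toNat)) (.inl .Z) = m.cnt (.inl .T) := by
      simp [hjZ.symm, hZ, hT]
    simp only [h1]
    have h2 : Function.update m.cnt j (min (m.cnt j) (m.cnt i + a.toNat)) (.inl .T) =
        m.cnt (.inl .T) := Function.update_of_ne hjT.symm _ _
    rw [Function.update_comm hjT, Function.update_idem, Function.update_comm hjT.symm, ← h2,
      Function.update_eq_self]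

end Cmd

/-! ### Computing the costs -/

namespace Cmd

variable {κ Q : Type} [Fintype Q] [DecidableEq Q] {L : Limits (Name ⊕ (Bool × Q))}

/-- There are two banks of counters for the costs. -/
def bank (b : Bool) (f : Q) : Name ⊕ (Bool × Q) := .inr (b, f)

theorem bank_inj {b b' : Bool} {f g : Q} : bank b f = bank b' g ↔ b = b' ∧ f = g := by
  simp [bank]

/-- What stays true during the computation of the costs: the bound is `k`, the input that is left
is `x`. -/
structure Frame (L : Limits (Name ⊕ (Bool × Q))) (k : ℕ) (x : List Bool)
    (a : Mem 3 (Vars κ) (Name ⊕ (Bool × Q))) : Prop where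
  fits : a.Fits L
  zero : a.cnt (.inl .Z) = 0
  temp : a.cnt (.inl .T) = 0
  bound : a.cnt (.inl .K) = k
  le : ∀ b f, a.cnt (bank b f) ≤ k
  snd : a.snd = x
  out : a.out = []
  res : a.ctl.res = false

theorem Frame.setBank {k : ℕ} {x : List Bool} {a b : Mem 3 (Vars κ) (Name ⊕ (Bool × Q))}
    (h : Frame L k x a) (hL : L.big = .inl .G) (hk : k ≤ L.small) {c : Bool} {f : Q} {n : ℕ}
    (hn : n ≤ k) (hc : b.cnt = Function.update a.cnt (bank c f) n) (hf : b.fst = a.fst)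
    (hs : b.snd = a.snd) (ho : b.out = a.out) (hr : b.ctl.res = a.ctl.res) : Frame L k x b where
  fits := fits_update h.fits (i := bank c f) (by rw [hL]; simp [bank]) (hn.trans hk) hc
    (by rw [hf, hs])
  zero := by rw [hc]; simpa [bank] using h.zero
  temp := by rw [hc]; simpa [bank] using h.temp
  bound := by rw [hc]; simpa [bank] using h.bound
  le := by
    intro b g
    rw [hc, Function.update_apply]
    split_ifs
    · exact hn
    · exact h.le b g
  snd := hs.trans h.snd
  out := ho.trans h.out
  res := hr.trans h.res

noncomputable def fill (b : Bool) (src : Q → Name ⊕ (Bool × Q)) : Prog κ (Bool × Q) :=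
  forEach Finset.univ.toList fun f => copy (bank b f) (src f)

theorem Run.fill {k : ℕ} {x : List Bool} (hL : L.big = .inl .G) (hk : k ≤ L.small) (b : Bool)
    (src : Q → Name ⊕ (Bool × Q)) (hsrc : ∀ f g, src f ≠ bank b g)
    {a : Mem 3 (Vars κ) (Name ⊕ (Bool × Q))} (ha : Frame L k x a)
    (hle : ∀ f, a.cnt (src f) ≤ k) :
    ∃ e, Run L (Cmd.fill b src) a e ∧ Frame L k x e ∧ (∀ f, e.cnt (bank b f) = a.cnt (src f)) ∧
      ∀ f, e.cnt (bank (!b) f) = a.cnt (bank (!b) f) := by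
  have := Triple.forEach (L := L) (l := Finset.univ.toList)
    (body := fun f => Cmd.copy (κ := κ) (bank b f) (src f))
    (fun pre m => Frame L k x m ∧ (∀ f ∈ pre, m.cnt (bank b f) = a.cnt (src f)) ∧
      (∀ f, m.cnt (bank (!b) f) = a.cnt (bank (!b) f)) ∧ ∀ f, m.cnt (src f) = a.cnt (src f))
    (fun _ _ h => h.1.fits) ?_ a ⟨ha, by simp, fun _ => rfl, fun _ => rfl⟩
  · obtain ⟨e, h1, h2, h3, h4, -⟩ := this
    exact ⟨e, h1, h2, fun f => h3 f (by simp), h4⟩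
  · rintro pre f - m ⟨h1, h2, h3, h4⟩
    have h0 := Run.copy (i := bank b f) (j := src f) h1.fits h1.zero
    refine ⟨_, h0, h1.setBank hL hk (c := b) (f := f)
      (n := m.cnt (src f)) (h4 f ▸ hle f) rfl rfl rfl rfl rfl, ?_, ?_, ?_⟩
    · intro g hg
      simp only [Function.update_apply]
      split_ifs with h5
      · rw [(bank_inj.1 h5).2, h4]
      · simp only [List.mem_append, List.mem_singleton] at hg
        rcases hg with hg | rfl
        · exact h2 g hg
        · exact absurd rfl h5
    · intro g
      rw [← h3 g]
      exact Function.update_of_ne (by simp [bank]) _ _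
    · intro g
      rw [← h4 g]
      exact Function.update_of_ne (hsrc g f) _ _

theorem Frame.relax {k : ℕ} {x : List Bool} (hL : L.big = .inl .G) (hk : k + 1 ≤ L.small)
    {a : Mem 3 (Vars κ) (Name ⊕ (Bool × Q))} (ha : Frame L k x a) (b c : Bool) (f g : Q)
    (w : Bool) : ∃ e, Run L (Cmd.relax (bank b f) (bank c g) w) a e ∧ Frame L k x e ∧
      e.cnt = Function.update a.cnt (bank c g)
        (min (a.cnt (bank c g)) (a.cnt (bank b f) + w.toNat)) ∧
      e.ctl.more = (a.ctl.more ||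
        decide (a.cnt (bank b f) + w.toNat < a.cnt (bank c g))) := by
  obtain ⟨ok, h⟩ := Run.relax (i := bank b f) (j := bank c g) (a := w) ha.fits (by rw [hL]; simp)
    (by rw [hL]; simp [bank]) (by simp [bank]) (by simp [bank]) ha.zero ha.temp
    (by have := ha.le b f; omega)
  exact ⟨_, h, ha.setBank hL (by omega) (c := c) (f := g)
    ((min_le_left _ _).trans (ha.le c g)) rfl rfl rfl rfl rfl, rfl, rfl⟩

/-- The first bank contains costs of runs with output `w`, or the bound. -/
def Sound (D : Transducer Q) (k : ℕ) (w : List Bool) (b : Bool)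
    (a : Mem 3 (Vars κ) (Name ⊕ (Bool × Q))) : Prop :=
  ∀ f, a.cnt (bank b f) < k → D.Cost f w (a.cnt (bank b f))

/-- Apply all silent transitions. -/
noncomputable def closureRound (D : Transducer Q) : Prog κ (Bool × Q) :=
  forEach D.silent fun e => relax (bank false e.1) (bank false e.2.1) e.2.2

/-- Values are only ever lowered to costs of actual runs, so soundness persists. If `more` stays
false, no counter has changed during the round, and all comparisons hold simultaneously. -/
theorem Run.closureRound (D : Transducer Q) {k : ℕ} {x w : List Bool} (hL : L.big = .inl .G)
    (hk : k + 1 ≤ L.small) {a : Mem 3 (Vars κ) (Name ⊕ (Bool × Q))} (ha : Frame L k x a)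
    (hs : Sound D k w false a) (hmore : a.ctl.more = false) :
    ∃ e, Run L (Cmd.closureRound D) a e ∧ Frame L k x e ∧ Sound D k w false e ∧
      (∀ f, e.cnt (bank false f) ≤ a.cnt (bank false f)) ∧
      (e.ctl.more = false → ∀ f g b, (f, g, b) ∈ D.silent →
        e.cnt (bank false g) ≤ e.cnt (bank false f) + b.toNat) ∧
      (e.ctl.more = true → ∃ f, e.cnt (bank false f) < a.cnt (bank false f)) := by
  have := Triple.forEach (L := L) (l := D.silent)
    (body := fun e => Cmd.relax (κ := κ) (bank false e.1) (bank false e.2.1) e.2.2)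
    (fun pre m => Frame L k x m ∧ Sound D k w false m ∧
      (∀ f, m.cnt (bank false f) ≤ a.cnt (bank false f)) ∧
      -- As long as nothing has changed, the tests already made speak about the initial counters.
      (m.ctl.more = false → (∀ f, m.cnt (bank false f) = a.cnt (bank false f)) ∧
        ∀ f g b, (f, g, b) ∈ pre →
        a.cnt (bank false g) ≤ a.cnt (bank false f) + b.toNat) ∧
      (m.ctl.more = true → ∃ f, m.cnt (bank false f) < a.cnt (bank false f)))
    (fun _ _ h => h.1.fits) ?_ a
    ⟨ha, hs, fun _ => le_rfl, fun _ => ⟨fun _ => rfl, by simp⟩, by simp [hmore]⟩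
  · obtain ⟨e, h1, h2, h3, h4, h5, h6⟩ := this
    refine ⟨e, h1, h2, h3, h4, fun h => ?_, h6⟩
    obtain ⟨h7, h8⟩ := h5 h
    simpa only [h7] using h8
  · rintro pre ⟨f, g, b⟩ hmem m ⟨h1, h2, h3, h4, h5⟩
    obtain ⟨e, h6, h7, h8, h9⟩ := h1.relax hL hk false false f g b
    have h10 : ∀ u, e.cnt (bank false u) ≤ m.cnt (bank false u) := by
      intro u
      rw [h8, Function.update_apply]
      split_ifs with h
      · rw [h]; exact min_le_left _ _
      · exact le_rfl
    refine ⟨e, h6, h7, ?_, fun u => (h10 u).trans (h3 u), ?_, ?_⟩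
    · intro u hu
      rw [h8, Function.update_apply] at hu ⊢
      split_ifs at hu ⊢ with h
      · rcases min_choice (m.cnt (bank false g)) (m.cnt (bank false f) + b.toNat) with h' | h'
        · rw [h'] at hu ⊢
          rw [(bank_inj.1 h).2]
          exact h2 g hu
        · rw [h'] at hu ⊢
          rw [(bank_inj.1 h).2]
          exact .silent (h2 f (by omega)) hmem
      · exact h2 u hu
    · intro h
      rw [h9, Bool.or_eq_false_iff, decide_eq_false_iff_not, not_lt] at h
      obtain ⟨h11, h12⟩ := h4 h.1
      rw [h8, min_eq_left h.2, Function.update_eq_self]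
      refine ⟨h11, fun f' g' b' hm => ?_⟩
      simp only [List.mem_append, List.mem_singleton, Prod.mk.injEq] at hm
      rcases hm with hm | ⟨rfl, rfl, rfl⟩
      · exact h12 f' g' b' hm
      · rw [← h11, ← h11]; exact h.2
    · intro h
      rw [h9, Bool.or_eq_true, decide_eq_true_iff] at h
      rcases h with h | h
      · obtain ⟨u, hu⟩ := h5 h
        exact ⟨u, (h10 u).trans_lt hu⟩
      · refine ⟨g, lt_of_lt_of_le ?_ (h3 g)⟩
        rw [h8, Function.update_self]
        exact (min_le_right _ _).trans_lt h

/-- Close the costs under silent transitions. -/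
noncomputable def closure (D : Transducer Q) : Prog κ (Bool × Q) :=
  .seq (modify fun v => { v with more := true }) (whileDo Vars.more
    (.seq (modify fun v => { v with more := false }) (closureRound D)))

theorem Run.closure (D : Transducer Q) {k : ℕ} {x w : List Bool} (hL : L.big = .inl .G)
    (hk : k + 1 ≤ L.small) {a : Mem 3 (Vars κ) (Name ⊕ (Bool × Q))} (ha : Frame L k x a)
    (hs : Sound D k w false a) (hE : ∀ f m, D.Entry f w m → a.cnt (bank false f) ≤ m) :
    ∃ e, Run L (Cmd.closure D) a e ∧ Frame L k x e ∧ Sound D k w false e ∧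
      ∀ f m, D.Cost f w m → e.cnt (bank false f) ≤ m := by
  have := Triple.whileDo (L := L) (p := Vars.more)
    (c := .seq (Cmd.modify fun v : Vars κ => { v with more := false }) (Cmd.closureRound D))
    (P := fun m => Frame L k x m ∧ Sound D k w false m ∧
      (∀ f n, D.Entry f w n → m.cnt (bank false f) ≤ n) ∧
      (m.ctl.more = false → ∀ f g b, (f, g, b) ∈ D.silent →
        m.cnt (bank false g) ≤ m.cnt (bank false f) + b.toNat))
    (R := fun m => Frame L k x m ∧ Sound D k w false m ∧
      ∀ f n, D.Cost f w n → m.cnt (bank false f) ≤ n)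
    -- Each round lowers some counter, except the last one, in which `more` drops from true to
    -- false.
    (fun m => ∑ f, m.cnt (bank false f) + m.ctl.more.toNat)
    (fun m h _ => h.1.fits) ?_ ?_ { a with ctl := { a.ctl with more := true } }
    ⟨⟨fits_congr ha.fits rfl le_rfl, ha.zero, ha.temp, ha.bound, ha.le, ha.snd, ha.out, ha.res⟩,
      hs, hE, by simp⟩
  · obtain ⟨e, h1, h2⟩ := this
    exact ⟨e, Run.seq (Run.modify ha.fits) h1, h2⟩
  · rintro m ⟨h1, h2, h3, h4⟩ hm
    exact ⟨h1, h2, fun f n h => h.le_of_closed (A := fun f => m.cnt (bank false f)) (h4 hm) h3⟩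
  · rintro m ⟨h1, h2, h3, h4⟩ hm
    obtain ⟨e, h5, h6, h7, h8, h9, h10⟩ := Run.closureRound D hL hk
      (a := { m with ctl := { m.ctl with more := false } }) (w := w)
      ⟨fits_congr h1.fits rfl le_rfl, h1.zero, h1.temp, h1.bound, h1.le, h1.snd, h1.out, h1.res⟩
      h2 rfl
    refine ⟨e, Run.seq (Run.modify h1.fits) h5, ⟨h6, h7, fun f n h => (h8 f).trans (h3 f n h), h9⟩,
      ?_⟩
    rw [hm]
    cases he : e.ctl.more with
    | false =>
      have := Finset.sum_le_sum fun f (_ : f ∈ Finset.univ) => h8 f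
      simp only [Bool.toNat_false, Bool.toNat_true] at this ⊢
      omega
    | true =>
      obtain ⟨f, hf⟩ := h10 he
      have := Finset.sum_lt_sum (fun f (_ : f ∈ Finset.univ) => h8 f) ⟨f, Finset.mem_univ _, hf⟩
      simp only [Bool.toNat_true] at this ⊢
      omega

/-- Apply the transitions with output `b`. -/
noncomputable def transfer (D : Transducer Q) (b : Bool) : Prog κ (Bool × Q) :=
  .seq (fill true fun _ => .inl .K) (.seq
    (forEach D.output fun e =>
      if e.2.2 = b then relax (bank false e.1) (bank true e.2.1) false else skip)
    (fill false (bank true)))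

/-- Two banks are needed because the costs for `w` must remain available while those for `w ++ [b]`
are collected. The new values are correct only for runs that end with the output of `b`; the silent
transitions afterwards are left to `closure`. -/
theorem Run.transfer (D : Transducer Q) {k : ℕ} {x w : List Bool} (b : Bool)
    (hL : L.big = .inl .G) (hk : k + 1 ≤ L.small) {a : Mem 3 (Vars κ) (Name ⊕ (Bool × Q))}
    (ha : Frame L k x a) (hs : Sound D k w false a)
    (hC : ∀ f m, D.Cost f w m → a.cnt (bank false f) ≤ m) :
    ∃ e, Run L (Cmd.transfer D b) a e ∧ Frame L k x e ∧ Sound D k (w ++ [b]) false e ∧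
      ∀ f m, D.Entry f (w ++ [b]) m → e.cnt (bank false f) ≤ m := by
  obtain ⟨a₁, h1, h2, h3, h4⟩ := Run.fill hL (by omega) true (fun _ => .inl .K)
    (by simp [bank]) ha (fun _ => ha.bound.le)
  simp only [Bool.not_true, ha.bound] at h3 h4
  have := Triple.forEach (L := L) (l := D.output)
    (body := fun e => if e.2.2 = b then
      Cmd.relax (κ := κ) (bank false e.1) (bank true e.2.1) false else Cmd.skip)
    (fun pre m => Frame L k x m ∧ Sound D k (w ++ [b]) true m ∧
      (∀ f, m.cnt (bank false f) = a.cnt (bank false f)) ∧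
      ∀ f g, (f, g, b) ∈ pre → m.cnt (bank true g) ≤ a.cnt (bank false f))
    (fun _ _ h => h.1.fits) ?_ a₁ ⟨h2, ?_, h4, by simp⟩
  · obtain ⟨a₂, h5, h6, h7, h8, h9⟩ := this
    obtain ⟨a₃, h10, h11, h12, -⟩ := Run.fill hL (by omega) false (bank true)
      (by simp [bank]) h6 (fun f => h6.le true f)
    refine ⟨a₃, Run.seq h1 (Run.seq h5 h10), h11, ?_, ?_⟩
    · intro f hf
      rw [h12] at hf ⊢
      exact h7 f hf
    · rintro f m (⟨-, h, -⟩ | ⟨g, u, c, h, h13, h14⟩)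
      · simp at h
      · obtain ⟨rfl, h⟩ := List.append_inj' h rfl
        obtain rfl : b = c := by simpa using h
        rw [h12]
        exact (h9 g f h13).trans (hC g m h14)
  · rintro pre ⟨f, g, c⟩ hmem m ⟨h5, h6, h7, h8⟩
    by_cases hc : c = b
    · subst hc
      simp only [if_true]
      obtain ⟨e, h9, h10, h11, -⟩ := h5.relax hL hk false true f g false
      simp only [Bool.toNat_false, Nat.add_zero, h7] at h11
      refine ⟨e, h9, h10, ?_, ?_, ?_⟩
      · intro u hu
        rw [h11, Function.update_apply] at hu ⊢
        split_ifs at hu ⊢ with h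
        · rcases min_choice (m.cnt (bank true g)) (a.cnt (bank false f)) with h' | h'
          · rw [h'] at hu ⊢
            rw [(bank_inj.1 h).2]
            exact h6 g hu
          · rw [h'] at hu ⊢
            rw [(bank_inj.1 h).2]
            exact .output (hs f hu) hmem
        · exact h6 u hu
      · intro u
        rw [h11, Function.update_of_ne (by simp [bank]), h7]
      · intro u v huv
        rw [h11, Function.update_apply]
        simp only [List.mem_append, List.mem_singleton, Prod.mk.injEq] at huv
        split_ifs with h
        · rcases huv with huv | ⟨rfl, rfl, -⟩
          · rw [← (bank_inj.1 h).2]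
            exact (min_le_left _ _).trans (h8 u v huv)
          · exact min_le_right _ _
        · rcases huv with huv | ⟨rfl, rfl, -⟩
          · exact h8 u v huv
          · exact absurd rfl h
    · simp only [if_neg hc]
      refine ⟨m, Run.skip h5.fits, h5, h6, h7, fun u v huv => ?_⟩
      simp only [List.mem_append, List.mem_singleton, Prod.mk.injEq] at huv
      rcases huv with huv | ⟨-, -, h⟩
      · exact h8 u v huv
      · exact absurd h.symm hc
  · intro f hf
    rw [h3] at hf
    exact absurd hf (lt_irrefl _)

/-- Read the output from stack `1` and compute the costs. -/
noncomputable def readOutput (D : Transducer Q) : Prog κ (Bool × Q) :=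
  .seq (popSnd fun v b => { v with val := b }) (whileDo (fun v => v.val.isSome)
    (.seq (cond (fun v => v.val == some true) (transfer D true) (transfer D false))
      (.seq (closure D) (popSnd fun v b => { v with val := b }))))

theorem Frame.popSnd {k : ℕ} {x : List Bool} {a : Mem 3 (Vars κ) (Name ⊕ (Bool × Q))}
    (ha : Frame L k x a) :
    Frame L k x.tail { a with ctl := { a.ctl with val := a.snd.head? }, snd := a.snd.tail } :=
  ⟨fits_congr ha.fits rfl (by simp), ha.zero, ha.temp, ha.bound, ha.le,
    congrArg List.tail ha.snd, ha.out, ha.res⟩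

/-- Dynamic programming along the output: `w` is the part already consumed and `x` the part still on
stack `1`. -/
theorem Run.readOutput (D : Transducer Q) {k : ℕ} {x w : List Bool}
    (hL : L.big = .inl .G) (hk : k + 1 ≤ L.small) {a : Mem 3 (Vars κ) (Name ⊕ (Bool × Q))}
    (ha : Frame L k x a) (hs : Sound D k w false a)
    (hC : ∀ f m, D.Cost f w m → a.cnt (bank false f) ≤ m) :
    ∃ e, Run L (Cmd.readOutput D) a e ∧ Frame L k [] e ∧ Sound D k (w ++ x) false e ∧
      ∀ f m, D.Cost f (w ++ x) m → e.cnt (bank false f) ≤ m := by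
  suffices h : ∃ e, Run L (whileDo (fun v => v.val.isSome)
    (.seq (Cmd.cond (fun v => v.val == some true) (Cmd.transfer D true) (Cmd.transfer D false))
      (.seq (Cmd.closure D) (Cmd.popSnd fun v b => { v with val := b }))))
      { a with ctl := { a.ctl with val := a.snd.head? }, snd := a.snd.tail } e ∧
      Frame L k [] e ∧ Sound D k (w ++ x) false e ∧
      ∀ f m, D.Cost f (w ++ x) m → e.cnt (bank false f) ≤ m by
    obtain ⟨e, h1, h2⟩ := h
    exact ⟨e, Run.seq (Run.popSnd ha.fits) h1, h2⟩
  induction x generalizing a w with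
  | nil =>
    refine ⟨_, Run.whileDo_done ha.popSnd.fits (by simp [ha.snd]), ha.popSnd, ?_⟩
    rw [List.append_nil]
    exact ⟨hs, hC⟩
  | cons b x ih =>
    have h1 : Frame L k x _ := ha.popSnd
    obtain ⟨a₁, h2, h3, h4, h5⟩ := Run.transfer D b hL hk h1 (w := w) hs hC
    obtain ⟨a₂, h6, h7, h8, h9⟩ := Run.closure D hL hk h3 h4 h5
    obtain ⟨e, h10, h11⟩ := ih h7 h8 h9
    rw [List.append_assoc] at h11
    refine ⟨e, Run.whileDo_next (by simp [ha.snd]) (Run.seq (Run.cond ?_) (Run.seq h6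
      (Run.popSnd h7.fits))) h10, h11⟩
    cases b <;> simpa [ha.snd] using h2

/-- Decide whether there is a final state with cost less than the bound. -/
noncomputable def anyFinal (D : Transducer Q) : Prog κ (Bool × Q) :=
  forEach D.final fun f => .seq (test (bank false f) (.inl .K))
    (modify fun v => { v with res := v.res || v.ok })

theorem Run.anyFinal (D : Transducer Q) {k : ℕ} {x : List Bool}
    {a : Mem 3 (Vars κ) (Name ⊕ (Bool × Q))} (ha : Frame L k x a) :
    ∃ e, Run L (Cmd.anyFinal D) a e ∧ e.Fits L ∧ e.out = [] ∧
      (e.ctl.res = true ↔ ∃ f ∈ D.final, a.cnt (bank false f) < k) := by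
  have := Triple.forEach (L := L) (l := D.final)
    (body := fun f => .seq (Cmd.test (bank false f) (.inl .K))
      (Cmd.modify fun v : Vars κ => { v with res := v.res || v.ok }))
    (fun pre m => m.Fits L ∧ m.out = [] ∧ m.cnt = a.cnt ∧
      (m.ctl.res = true ↔ ∃ f ∈ pre, a.cnt (bank false f) < k))
    (fun _ _ h => h.1) ?_ a ⟨ha.fits, ha.out, rfl, by simp [ha.res]⟩
  · obtain ⟨e, h1, h2, h3, -, h4⟩ := this
    exact ⟨e, h1, h2, h3, h4⟩
  · rintro pre f - m ⟨h1, h2, h3, h4⟩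
    have h5 := Run.seq (Run.test (i := bank false f) (j := .inl .K) h1)
      (Run.modify (f := fun v : Vars κ => { v with res := v.res || v.ok })
        (fits_congr h1 rfl le_rfl))
    refine ⟨_, h5, fits_congr h1 rfl le_rfl, h2, h3, ?_⟩
    simp [h4, h3, ha.bound, or_and_right, exists_or]

/-- Decide whether there is a run of cost less than `K` with the output on stack `1`. -/
noncomputable def cheapRun (D : Transducer Q) : Prog κ (Bool × Q) :=
  .seq (fill false fun _ => .inl .K) (.seq (copy (bank false D.init) (.inl .Z))
    (.seq (closure D) (.seq (readOutput D) (anyFinal D))))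

theorem Run.cheapRun (D : Transducer Q) {k : ℕ} {x : List Bool}
    (hL : L.big = .inl .G) (hk : k + 1 ≤ L.small) {a : Mem 3 (Vars κ) (Name ⊕ (Bool × Q))}
    (ha : Frame L k x a) :
    ∃ e, Run L (Cmd.cheapRun D) a e ∧ e.Fits L ∧ e.out = [] ∧
      (e.ctl.res = true ↔ ∃ f ∈ D.final, ∃ m < k, D.Cost f x m) := by
  obtain ⟨a₁, h1, h2, h3, -⟩ := Run.fill hL (by omega) false (fun _ => .inl .K)
    (by simp [bank]) ha (fun _ => ha.bound.le)
  simp only [ha.bound] at h3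
  have h4 := Run.copy (i := bank false D.init) (j := .inl .Z) h2.fits h2.zero
  have h5 := h2.setBank hL (by omega) (b := { a₁ with
    cnt := Function.update a₁.cnt (bank false D.init) (a₁.cnt (.inl .Z)) }) (c := false) (f := D.init)
    (n := a₁.cnt (.inl .Z)) (by rw [h2.zero]; omega) rfl rfl rfl rfl rfl
  have hs : Sound D k [] false { a₁ with
      cnt := Function.update a₁.cnt (bank false D.init) (a₁.cnt (.inl .Z)) } := by
    intro f hf
    simp only [Function.update_apply, h2.zero, h3] at hf ⊢
    split_ifs at hf ⊢ with h
    · rw [(bank_inj.1 h).2]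
      exact .init
    · exact absurd hf (lt_irrefl _)
  have hE : ∀ f m, D.Entry f [] m → Function.update a₁.cnt (bank false D.init)
      (a₁.cnt (.inl .Z)) (bank false f) ≤ m := by
    rintro f m (⟨rfl, -, rfl⟩ | ⟨g, u, b, h, -⟩)
    · simp [h2.zero]
    · simp at h
  obtain ⟨a₂, h6, h7, h8, h9⟩ := Run.closure D hL hk h5 hs hE
  obtain ⟨a₃, h10, h11, h12, h13⟩ := Run.readOutput D hL hk h7 h8 h9
  obtain ⟨e, h14, h15, h16, h17⟩ := Run.anyFinal D h11
  refine ⟨e, Run.seq h1 (Run.seq h4 (Run.seq h6 (Run.seq h10 h14))), h15, h16, h17.trans ?_⟩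
  constructor
  · rintro ⟨f, h18, h19⟩
    exact ⟨f, h18, _, h19, h12 f h19⟩
  · rintro ⟨f, h18, m, h19, h20⟩
    exact ⟨f, h18, (h13 f m h20).trans_lt h19⟩

end Cmd

/-! ### Computations in constant space -/

namespace Instr

/-- The instruction concerns only the stacks. -/
def IsLocal : Instr → Prop
  | push _ _ | pop _ _ | empty _ _ | nop => True
  | _ => False

theorem sem_of_isLocal {i : Instr} (hi : i.IsLocal) (W : Bool → List Bool) (s : ℕ) (d : Dat) :
    i.sem W s d = (i.sem (fun _ => []) s ⟨fun _ => 0, d.st⟩).map fun e => ⟨d.pos, e.st⟩ := by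
  cases i <;> simp only [IsLocal] at hi
  · simp only [sem, Dat.space]; split_ifs with h <;> simp [h]
  · simp only [sem]; split_ifs <;> rfl
  · simp only [sem]; split_ifs <;> rfl
  · rfl

theorem sem_adv {W : Bool → List Bool} {s : ℕ} {d : Dat} {o b : Bool}
    (h : (W o)[d.pos o]? = some b) : (adv o b).sem W s d =
      some { d with pos := Function.update d.pos o (d.pos o + 1) } := if_pos h

/-- The effect of an instruction without output on the stacks and on the flag that tells
whether the program has been read to its end; `a` tells whether a bit of the program is read. -/
def Silent (s : ℕ) (i : Instr) (a : Bool) (x y : (Fin 2 → List Bool) × Bool) : Prop :=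
  -- Once the end marker has been seen, no further bit may be guessed, since the guesses have to
  -- form a single program.
  (∃ b, i = adv false b ∧ a = true ∧ x.2 = false ∧ y = x) ∨
  (i = eof ∧ a = false ∧ y = (x.1, true)) ∨
  (i.IsLocal ∧ a = false ∧ y.2 = x.2 ∧
    i.sem (fun _ => []) s ⟨fun _ => 0, x.1⟩ = some ⟨fun _ => 0, y.1⟩)

end Instr

namespace Machine

variable (U : Machine 2)

/-- Control state, stacks of bounded size, and whether the program has been read to its end. -/
abbrev Node (B : ℕ) : Type :=
  {x : Ctl U.State × (Fin 2 → List Bool) × Bool //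
    (x.2.1 0).length + (x.2.1 1).length ≤ B}

instance (B : ℕ) : Finite (U.Node B) := by
  have h1 : Finite {l : List Bool // l.length ≤ B} := (List.finite_length_le Bool B).to_subtype
  refine Finite.of_injective (β := Ctl U.State × (Fin 2 → {l : List Bool // l.length ≤ B}) × Bool)
    (fun x => (x.1.1, fun t => ⟨x.1.2.1 t, ?_⟩, x.1.2.2)) ?_
  · have := x.2
    obtain rfl | rfl : t = 0 ∨ t = 1 := by fin_cases t <;> simp
    · omega
    · omega
  · rintro ⟨⟨c, st, e⟩, h⟩ ⟨⟨c', st', e'⟩, h'⟩ heq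
    simp only [Prod.mk.injEq, funext_iff, Subtype.mk.injEq] at heq
    obtain ⟨rfl, h2, rfl⟩ := heq
    obtain rfl : st = st' := funext h2
    rfl

noncomputable instance (B : ℕ) : Fintype (U.Node B) := Fintype.ofFinite _

noncomputable instance (B : ℕ) : DecidableEq (U.Node B) := Classical.decEq _

open Classical in
/-- The computations in space `s`, as runs of a transducer that guesses the program. -/
noncomputable def transducer (B s : ℕ) : Transducer (U.Node B) where
  init := ⟨(.run U.init, fun _ => [], false), by simp⟩
  silent := (Finset.univ.filter fun e : U.Node B × U.Node B × Bool =>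
    ∃ a, (U.edge e.1.1.1 a).2 = e.2.1.1.1 ∧
      (U.edge e.1.1.1 a).1.Silent s e.2.2 e.1.1.2 e.2.1.1.2).toList
  output := (Finset.univ.filter fun e : U.Node B × U.Node B × Bool =>
    ∃ a, U.edge e.1.1.1 a = (.adv true e.2.2, e.2.1.1.1) ∧ e.2.1.1.2 = e.1.1.2).toList
  final := (Finset.univ.filter fun f : U.Node B =>
    f.1.1 = .done ∧ f.1.2.1 = fun _ => []).toList

variable {U}

/-- Program and output as a function. -/
def words (p x : List Bool) : Bool → List Bool
  | false => p
  | true => x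

theorem Reach.valid {W : Bool → List Bool} {s : ℕ} {v w : Ctl U.State × Dat}
    (h : (U.graph W s).Reach v w) (hv : v.2.Valid W s) : w.2.Valid W s := by
  induction h with
  | refl => exact hv
  | tail _ h ih =>
    obtain ⟨-, a, -, h2⟩ := U.graph_step_iff.1 h
    exact Instr.sem_valid ih h2

def posOf (m n : ℕ) : Bool → ℕ
  | false => m
  | true => n

/-- The guessed bits form the beginning `p` of a program. As long as the end marker has not been
seen, any continuation `r` is possible, and this freedom is what the induction needs when the next
bit is guessed. -/
theorem reach_of_cost {B s : ℕ} {f : U.Node B} {w : List Bool} {m : ℕ}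
    (h : (U.transducer B s).Cost f w m) : ∃ p : List Bool, p.length = m ∧
      ∀ r x, (f.1.2.2 = true → r = []) → w <+: x →
        (U.graph (words (p ++ r) x) s).Reach (.start, initialDat)
          (f.1.1, ⟨posOf m w.length, f.1.2.1⟩) := by
  induction h with
  | init =>
    refine ⟨[], rfl, fun r x _ _ => Relation.ReflTransGen.single (U.graph_step_iff.2
      ⟨valid_initialDat _ _, none, rfl, ?_⟩)⟩
    simp only [edge, Instr.sem, initialDat, transducer, Option.ite_none_right_eq_some, true_and]
    congr 2
    funext o; cases o <;> rfl
  | @silent f g w m a h he ih =>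
    obtain ⟨p, rfl, ih⟩ := ih
    simp only [transducer, Finset.mem_toList, Finset.mem_filter, Finset.mem_univ, true_and] at he
    obtain ⟨ans, h1, h2⟩ := he
    rcases h2 with ⟨b, h2, rfl, h3, h4⟩ | ⟨h2, rfl, h4⟩ | ⟨h2, rfl, h3, h4⟩
    · refine ⟨p ++ [b], by simp, fun r x _ hx => ?_⟩
      have h5 := ih (b :: r) x (by simp [h3]) hx
      have h6 : p ++ [b] ++ r = p ++ b :: r := by simp
      rw [h6]
      refine h5.tail (U.graph_step_iff.2 ⟨Reach.valid h5 (valid_initialDat _ _), ans, h1, ?_⟩)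
      rw [h2, h4]
      rw [Instr.sem_adv (by simp [words, posOf])]
      congr 2
      funext o; cases o <;> simp [posOf]
    · refine ⟨p, by simp, fun r x hr hx => ?_⟩
      have hr' : r = [] := hr (by rw [h4])
      have h5 := ih r x (fun _ => hr') hx
      refine h5.tail (U.graph_step_iff.2 ⟨Reach.valid h5 (valid_initialDat _ _), ans, h1, ?_⟩)
      rw [h2, h4, hr']
      simp [Instr.sem, words, posOf]
    · refine ⟨p, by simp, fun r x hr hx => ?_⟩
      have h5 := ih r x (fun h => hr (h3 ▸ h)) hx
      refine h5.tail (U.graph_step_iff.2 ⟨Reach.valid h5 (valid_initialDat _ _), ans, h1, ?_⟩)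
      rw [Instr.sem_of_isLocal h2, h4]
      simp
  | @output f g w m b h he ih =>
    obtain ⟨p, rfl, ih⟩ := ih
    simp only [transducer, Finset.mem_toList, Finset.mem_filter, Finset.mem_univ, true_and] at he
    obtain ⟨ans, h1, h2⟩ := he
    refine ⟨p, rfl, fun r x hr hx => ?_⟩
    have h5 := ih r x (fun h => hr (h2 ▸ h)) ((List.prefix_append _ _).trans hx)
    refine h5.tail (U.graph_step_iff.2 ⟨Reach.valid h5 (valid_initialDat _ _), ans, ?_, ?_⟩)
    · rw [h1]
    · obtain ⟨y, rfl⟩ := hx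
      rw [h1, h2]
      rw [Instr.sem_adv (by simp [words, posOf])]
      congr 2
      funext o; cases o <;> simp [posOf]

theorem edge_ne_ret (c : Ctl U.State) (a : Option Bool) (o b : Bool) :
    (U.edge c a).1 ≠ .ret o b := by
  unfold edge
  split <;> (try split) <;> (try split_ifs) <;> simp

theorem edge_eq_start {c : Ctl U.State} {a : Option Bool} (h : (U.edge c a).1 = .start) :
    c = .start := by
  unfold edge at h
  split at h <;> (try rfl) <;> (try split at h) <;> (try split_ifs at h) <;> simp at h

theorem edge_ne_to_start (c : Ctl U.State) (a : Option Bool) : (U.edge c a).2 ≠ .start := by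
  unfold edge
  split <;> (try split) <;> (try split_ifs) <;> simp

/-- The transducer begins after the edge leaving the start vertex, which is therefore treated apart.
The flag `e` is true only if the program has been read to its end, so afterwards no program bit can
be read. -/
theorem cost_of_reach {B s : ℕ} (hB : s ≤ B) {p x : List Bool} {v : Ctl U.State × Dat}
    (h : (U.graph (words p x) s).Reach (.start, initialDat) v) : v = (.start, initialDat) ∨
      v.1 ≠ .start ∧ ∃ (hv : (v.2.st 0).length + (v.2.st 1).length ≤ B) (e : Bool),
        (e = true → v.2.pos false = p.length) ∧
        (U.transducer B s).Cost ⟨(v.1, v.2.st, e), hv⟩ (x.take (v.2.pos true)) (v.2.pos false) := by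
  induction h with
  | refl => exact Or.inl rfl
  | @tail v w _ h ih =>
    right
    obtain ⟨hv, a, h1, h2⟩ := U.graph_step_iff.1 h
    have hw := Instr.sem_valid hv h2
    refine ⟨h1 ▸ edge_ne_to_start _ _, hw.space_le.trans hB, ?_⟩
    rcases ih with rfl | ⟨h3, h4, e, h5, h6⟩
    · cases a with
      | some b => simp [edge, Instr.sem] at h2
      | none =>
        obtain ⟨c, d⟩ := w
        obtain rfl : Ctl.run U.init = c := h1
        simp only [edge, Instr.sem, Option.ite_none_right_eq_some, Option.some.injEq] at h2
        obtain ⟨-, rfl⟩ := h2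
        exact ⟨false, by simp, .init⟩
    · obtain ⟨c, d⟩ := v
      obtain ⟨c', d'⟩ := w
      simp only at h1 h2 h3 h4 h5 h6 hv
      have hsil : ∀ (e' : Bool) (b : Bool) (hd' : (d'.st 0).length + (d'.st 1).length ≤ B),
          (U.edge c a).1.Silent s b (d.st, e) (d'.st, e') →
          (U.transducer B s).Cost ⟨(c', d'.st, e'), hd'⟩ (x.take (d.pos true))
            (d.pos false + b.toNat) := by
        intro e' b hd' h
        refine .silent h6 ?_
        simp only [transducer, Finset.mem_toList, Finset.mem_filter, Finset.mem_univ, true_and]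
        exact ⟨a, h1, h⟩
      have hloc : (U.edge c a).1.IsLocal → ∃ e', (e' = true → d'.pos false = p.length) ∧
          (U.transducer B s).Cost ⟨(c', d'.st, e'), hw.space_le.trans hB⟩
            (x.take (d'.pos true)) (d'.pos false) := by
        intro hi
        rw [Instr.sem_of_isLocal hi] at h2
        obtain ⟨d₁, h7, h8⟩ := Option.map_eq_some_iff.1 h2
        subst h8
        refine ⟨e, h5, hsil e false (hw.space_le.trans hB) (Or.inr (Or.inr ⟨hi, rfl, rfl, ?_⟩))⟩
        have h8 := Instr.sem_of_isLocal hi (fun _ => []) s ⟨fun _ => 0, d.st⟩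
        simp only [h7, Option.map_some] at h8 ⊢
        exact h8
      cases hi : (U.edge c a).1 with
      | ret o b => exact absurd hi (edge_ne_ret _ _ _ _)
      | start => exact absurd (edge_eq_start hi) h3
      | fail => rw [hi] at h2; cases h2
      | push t b => exact hloc (by rw [hi]; trivial)
      | pop t b => exact hloc (by rw [hi]; trivial)
      | empty t b => exact hloc (by rw [hi]; trivial)
      | nop => exact hloc (by rw [hi]; trivial)
      | eof =>
        rw [hi] at h2
        simp only [Instr.sem, Option.ite_none_right_eq_some, Option.some.injEq] at h2
        obtain ⟨h7, rfl⟩ := h2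
        exact ⟨true, fun _ => h7, hsil true false h4 (Or.inr (Or.inl ⟨hi, rfl, rfl⟩))⟩
      | adv o b =>
        rw [hi] at h2
        simp only [Instr.sem, Option.ite_none_right_eq_some, Option.some.injEq] at h2
        obtain ⟨h7, rfl⟩ := h2
        cases o with
        | false =>
          have he : e = false := by
            by_contra he
            have := h5 (by simpa using he)
            simp [words, this] at h7
          subst he
          exact ⟨false, by simp, hsil false true h4 (Or.inl ⟨b, hi, rfl, rfl, rfl⟩)⟩
        | true =>
          refine ⟨e, h5, ?_⟩
          have h8 : x.take (d.pos true + 1) = x.take (d.pos true) ++ [b] := by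
            rw [List.take_add_one]
            simp only [words] at h7
            rw [h7]; rfl
          simp only [Function.update_self, h8]
          refine .output h6 ?_
          simp only [transducer, Finset.mem_toList, Finset.mem_filter, Finset.mem_univ, true_and]
          exact ⟨a, Prod.ext hi h1, trivial⟩

theorem mem_final {B s : ℕ} {f : U.Node B} :
    f ∈ (U.transducer B s).final ↔ f.1.1 = .done ∧ f.1.2.1 = fun _ => [] := by
  simp [transducer]

theorem exists_accepts_iff {B s : ℕ} (hB : s ≤ B) {x : List Bool} {k : ℕ} :
    (∃ p : List Bool, p.length < k ∧ U.Accepts s x p) ↔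
      ∃ f ∈ (U.transducer B s).final, ∃ m < k, (U.transducer B s).Cost f x m := by
  simp only [mem_final]
  constructor
  · rintro ⟨p, hp, h1, h2⟩
    have h3 := reach_of_accepts (W := words p x) h1 h2
    rcases cost_of_reach hB h3 with h4 | ⟨-, h4, e, -, h5⟩
    · simp at h4
    · refine ⟨⟨(.done, fun _ => [], e), by simp⟩, ⟨rfl, rfl⟩, _, hp, ?_⟩
      simpa [finalDat, words] using h5
  · rintro ⟨f, ⟨h1, h2⟩, m, hm, h3⟩
    obtain ⟨p, rfl, h4⟩ := reach_of_cost h3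
    have h5 := h4 [] x (fun _ => rfl) (List.prefix_refl _)
    rw [List.append_nil, h1, h2] at h5
    refine ⟨p, hm, accepts_of_reach (W := words p x) (d := initialDat) ?_⟩
    convert h5 using 2
    refine Dat.ext (funext fun o => ?_) rfl
    cases o <;> rfl

end Machine

/-! ### Reading the input -/

/-- Space needed by Horner's scheme for the number `S`: `t` digits are still on the stack and `g` is
the value of those consumed. For positive `g` the sum is bounded by `g * 2 ^ t`; before the leading
digit is consumed, the second hypothesis helps, which says that there are no superfluous digits. -/
theorem length_add_le_of_pow_le {t g S : ℕ} (h : g * 2 ^ t ≤ S) (h' : t = 0 ∨ 2 ^ t ≤ 2 * S) :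
    t + g ≤ S := by
  rcases Nat.eq_zero_or_pos g with rfl | hg
  · rcases h' with rfl | h'
    · omega
    · cases t with
      | zero => omega
      | succ t =>
        have := Nat.lt_two_pow_self (n := t)
        rw [pow_succ] at h'
        omega
  · have h1 := Nat.lt_two_pow_self (n := t)
    nlinarith

theorem bitsVal_append (l : List Bool) (b : Bool) :
    bitsVal (l ++ [b]) = bitsVal l + b.toNat * 2 ^ l.length := by
  induction l with
  | nil => simp [bitsVal]
  | cons c l ih => simp only [List.cons_append, bitsVal, ih, List.length_cons, pow_succ]; ring

theorem bitsVal_bits (n : ℕ) : bitsVal (Nat.bits n) = n := by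
  induction n using Nat.binaryRec' with
  | zero => simp [bitsVal]
  | bit b n h ih =>
    rw [Nat.bits_append_bit n b h, bitsVal, ih, Nat.bit_val]
    omega

namespace Cmd

variable {κ F : Type} [Fintype F] [DecidableEq F] {L : Limits (Name ⊕ F)}

/-- The counters between the phases of the computation. -/
def regs (n j g k c p : ℕ) : Name ⊕ F → ℕ
  | .inl .N => n
  | .inl .J => j
  | .inl .G => g
  | .inl .K => k
  | .inl .C => c
  | .inl .P => p
  | _ => 0

section

variable (n j g k c p a : ℕ)

theorem update_regs_N : Function.update (regs (F := F) n j g k c p) (.inl .N) a =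
    regs a j g k c p := by
  funext i; rcases i with i | i <;> (try cases i) <;> simp [regs]

theorem update_regs_J : Function.update (regs (F := F) n j g k c p) (.inl .J) a =
    regs n a g k c p := by
  funext i; rcases i with i | i <;> (try cases i) <;> simp [regs]

theorem update_regs_G : Function.update (regs (F := F) n j g k c p) (.inl .G) a =
    regs n j a k c p := by
  funext i; rcases i with i | i <;> (try cases i) <;> simp [regs]

theorem update_regs_K : Function.update (regs (F := F) n j g k c p) (.inl .K) a =
    regs n j g a c p := by
  funext i; rcases i with i | i <;> (try cases i) <;> simp [regs]

theorem update_regs_C : Function.update (regs (F := F) n j g k c p) (.inl .C) a =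
    regs n j g k a p := by
  funext i; rcases i with i | i <;> (try cases i) <;> simp [regs]

theorem update_regs_P : Function.update (regs (F := F) n j g k c p) (.inl .P) a =
    regs n j g k c a := by
  funext i; rcases i with i | i <;> (try cases i) <;> simp [regs]

end

theorem fits_regs {n j g k c p : ℕ} (hL : L.big = .inl .G) (hn : n ≤ L.small) (hj : j ≤ L.small)
    (hk : k ≤ L.small) (hc : c ≤ L.small) (hp : p ≤ L.small) {v : Vars κ}
    {inp : Fin 3 → List Bool} {fst snd out : List Bool}
    (ht : fst.length + snd.length + g ≤ L.total) :
    Mem.Fits L ⟨v, regs n j g k c p, inp, fst, snd, out⟩ := by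
  refine ⟨?_, ?_⟩
  · rintro (i | i) hi
    · rw [hL] at hi
      cases i <;> simp_all [regs]
    · simp [regs]
  · simpa [hL, regs] using ht

/-- Read an input tape to its end and push the bits on stack `0`; perhaps count them. -/
noncomputable def loadTape (i : Fin 3) (count : Bool) : Prog κ F :=
  .seq (readInput i fun v b => { v with val := b }) (whileDo (fun v => v.val.isSome)
    (.seq (pushFst (fun v => v.val == some true) fun v => { v with val := none })
      (.seq (if count then inc (.inl .N) else skip)
        (readInput i fun v b => { v with val := b }))))

theorem Run.loadTape {i : Fin 3} {count : Bool} {n j g k c p : ℕ} {v : Vars κ}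
    {inp : Fin 3 → List Bool} {fst snd out l : List Bool} (hL : L.big = .inl .G)
    (hn : n + count.toNat * l.length ≤ L.small) (hj : j ≤ L.small)
    (hk : k ≤ L.small) (hc : c ≤ L.small) (hp : p ≤ L.small)
    (ht : l.length + fst.length + snd.length + g ≤ L.total) (hi : inp i = l)
    (hval : v.val = none) :
    Run L (Cmd.loadTape i count) ⟨v, regs n j g k c p, inp, fst, snd, out⟩
      ⟨v, regs (n + count.toNat * l.length) j g k c p, Function.update inp i [],
        l.reverse ++ fst, snd, out⟩ := by
  refine Run.seq (Run.readInput (fits_regs hL (by omega) hj hk hc hp (by omega))) ?_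
  simp only [hi]
  induction l generalizing n fst inp with
  | nil =>
    refine Run.whileDo_done_eq (fits_regs hL (by omega) hj hk hc hp (by omega)) rfl ?_
    simp [← hval]
  | cons b l ih =>
    simp only [List.length_cons] at hn ht
    have hn' : n + count.toNat + count.toNat * l.length ≤ L.small := by
      rw [Nat.mul_add] at hn; omega
    have h1 := ih (n := n + count.toNat) (fst := b :: fst) (inp := Function.update inp i l)
      hn' (by simp; omega) (by simp)
    refine Run.whileDo_next rfl (Run.seq (Run.pushFst
      (fits_regs hL (by omega) hj hk hc hp (by omega)) ?_) (Run.seq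
      (b := ⟨{ v with val := none }, regs (n + count.toNat) j g k c p,
        Function.update inp i l, b :: fst, snd, out⟩) ?_
      (Run.readInput (fits_regs hL (by omega) hj hk hc hp (by simp; omega))))) (h1.of_eq' ?_ ?_)
    · simp [hL, regs]; omega
    · cases count
      · refine (Run.skip ?_).of_eq ?_
        · exact fits_regs hL (by omega) hj hk hc hp (by simp; omega)
        · cases b <;> simp
      · refine (Run.inc ?_ ?_).of_eq ?_
        · exact fits_regs hL (by simp at hn'; omega) hj hk hc hp (by simp; omega)
        · rfl
        · simp only [update_regs_N]
          cases b <;> simp [regs]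
    · simp
    · have h2 : n + count.toNat + count.toNat * l.length =
          n + count.toNat * (b :: l).length := by rw [List.length_cons]; ring
      simp [h2]

/-- Convert the number on stack `0` from binary into a counter. -/
noncomputable def horner : Prog κ F :=
  .seq (popFst fun v b => { v with val := b }) (whileDo (fun v => v.val.isSome)
    (.seq (add (.inl .G) (.inl .G) (.inl .G) false)
      (.seq (cond (fun v => v.val == some true) (inc (.inl .G)) skip)
        (popFst fun v b => { v with val := b }))))

/-- The tape has the least significant digit first, so after loading the most significant one is on
top of the stack, as Horner's scheme wants it. -/
theorem Run.horner {n j g k c p : ℕ} {v : Vars κ}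
    {inp : Fin 3 → List Bool} {snd out l : List Bool} (hL : L.big = .inl .G)
    (hn : n ≤ L.small) (hj : j ≤ L.small)
    (hk : k ≤ L.small) (hc : c ≤ L.small) (hp : p ≤ L.small) {S : ℕ}
    (hS : g * 2 ^ l.length + bitsVal l = S) (hl : l.length = 0 ∨ 2 ^ l.length ≤ 2 * S)
    (ht : snd.length + S ≤ L.total) (hval : v.val = none) :
    Run L Cmd.horner ⟨v, regs n j g k c p, inp, l.reverse, snd, out⟩
      ⟨v, regs n j S k c p, inp, [], snd, out⟩ := by
  have h0 := length_add_le_of_pow_le (g := g) (by omega) hl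
  refine Run.seq (Run.popFst (fits_regs hL hn hj hk hc hp (by simp; omega))) ?_
  simp only
  induction l using List.reverseRecOn generalizing g with
  | nil =>
    obtain rfl : g = S := by simpa [bitsVal] using hS
    refine Run.whileDo_done_eq (fits_regs hL hn hj hk hc hp (by simp; omega)) rfl ?_
    simp [← hval]
  | append_singleton l b ih =>
    have hb := b.toNat_le
    have hS' : (2 * g + b.toNat) * 2 ^ l.length + bitsVal l = S := by
      rw [← hS, bitsVal_append, List.length_append]
      simp only [List.length_singleton, pow_succ]; ring
    have hl' : l.length = 0 ∨ 2 ^ l.length ≤ 2 * S := by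
      right
      simp only [List.length_append, List.length_singleton, pow_succ] at hl
      omega
    have h1 := length_add_le_of_pow_le (t := l.length) (g := 2 * g + b.toNat) (S := S) (by omega) hl'
    have h2 := ih hS' hl' h1
    simp only [List.reverse_append, List.reverse_singleton, List.singleton_append, List.head?_cons,
      List.tail_cons]
    refine Run.whileDo_next rfl (Run.seq (Run.add
      (fits_regs hL hn hj hk hc hp (by simp at h0 ⊢; omega))) (Run.seq
      (b := ⟨{ v with val := some b }, regs n j (2 * g + b.toNat) k c p, inp, l.reverse, snd, out⟩)
      ?_ (Run.popFst (fits_regs hL hn hj hk hc hp (by simp; omega))))) h2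
    simp only [update_regs_G]
    have h3 : regs (F := F) n j g k c p (.inl .G) + regs (F := F) n j g k c p (.inl .G) +
      false.toNat = 2 * g := by simp [regs]; ring
    rw [h3]
    have hf : Mem.Fits L ⟨{ v with val := some b }, regs n j (2 * g) k c p, inp, l.reverse, snd,
        out⟩ := fits_regs hL hn hj hk hc hp (by simp; omega)
    cases b
    · exact Run.cond_false rfl (Run.skip hf)
    · refine Run.cond_true rfl ((Run.inc hf rfl).of_eq ?_)
      simp [update_regs_G, regs]

/-- Add a counter to another one, but do not exceed `C`. -/
noncomputable def capAdd (i j : Name ⊕ F) : Prog κ F :=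
  .seq (add i i j false) (.seq (test (.inl .C) i) (.seq (cond Vars.ok (copy i (.inl .C)) skip)
    (modify fun v => { v with ok := false })))

theorem Run.capAdd {i j : Name ⊕ F} {a : Mem 3 (Vars κ) (Name ⊕ F)} (h : a.Fits L)
    (hi : i ≠ L.big) (hiC : i ≠ .inl .C) (hiZ : i ≠ .inl .Z) (hZ : a.cnt (.inl .Z) = 0)
    (hle : a.cnt i + a.cnt j ≤ L.small) (hok : a.ctl.ok = false) :
    Run L (Cmd.capAdd i j) a
      { a with cnt := Function.update a.cnt i (min (a.cnt i + a.cnt j) (a.cnt (.inl .C))) } := by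
  have hf : ∀ v : Vars κ, Mem.Fits L { a with
      ctl := v, cnt := Function.update a.cnt i (a.cnt i + a.cnt j) } := fun v =>
    fits_update h hi hle rfl le_rfl
  have hf' : ∀ v : Vars κ, Mem.Fits L { a with
      ctl := v
      cnt := Function.update a.cnt i (min (a.cnt i + a.cnt j) (a.cnt (.inl .C))) } := fun v =>
    fits_update h hi ((min_le_left _ _).trans hle) rfl le_rfl
  have hC : Function.update a.cnt i (a.cnt i + a.cnt j) (.inl .C) = a.cnt (.inl .C) :=
    Function.update_of_ne hiC.symm _ _
  have hv : ({ a.ctl with ok := false } : Vars κ) = a.ctl := by rw [← hok]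
  refine Run.seq ((Run.add h).of_eq (b' := { a with
    cnt := Function.update a.cnt i (a.cnt i + a.cnt j) }) (by simp)) (Run.seq (Run.test (hf _))
    (Run.seq (b := { a with
      ctl := { a.ctl with ok := decide (a.cnt (.inl .C) < a.cnt i + a.cnt j) }
      cnt := Function.update a.cnt i (min (a.cnt i + a.cnt j) (a.cnt (.inl .C))) }) ?_
    ((Run.modify (hf' _)).of_eq ?_)))
  · simp only [Function.update_self, hC]
    by_cases hlt : a.cnt (.inl .C) < a.cnt i + a.cnt j
    · refine Run.cond_true (by simp [hlt]) ((Run.copy (hf _) (by simp [hiZ.symm, hZ])).of_eq ?_)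
      simp [hC, min_eq_right hlt.le]
    · refine Run.cond_false (by simp [hlt]) ((Run.skip (hf _)).of_eq ?_)
      rw [min_eq_left (not_lt.1 hlt)]
  · simp [hv]

/-- Read a number from tape `1` and store it in `K` unless it exceeds `C`. -/
noncomputable def loadBound : Prog κ F :=
  .seq (inc (.inl .P)) (.seq (readInput 1 fun v b => { v with val := b })
    (whileDo (fun v => v.val.isSome)
      (.seq (cond (fun v => v.val == some true) (capAdd (.inl .K) (.inl .P)) skip)
        (.seq (capAdd (.inl .P) (.inl .P)) (readInput 1 fun v b => { v with val := b })))))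

/-- The number on the tape may be arbitrarily large, so it is never stored in full: `P` is the
current power of two and `K` the partial sum, both truncated at `c`. Truncation is harmless, because
a nonzero digit at a truncated power pushes the sum to the cap anyway. Sums before truncation reach
at most `2 * c`. -/
theorem Run.loadBound {n j g c : ℕ} {v : Vars κ}
    {inp : Fin 3 → List Bool} {fst snd out l : List Bool} (hL : L.big = .inl .G)
    (hn : n ≤ L.small) (hj : j ≤ L.small)
    (hc : 2 * c ≤ L.small) (hc0 : 0 < c) (ht : fst.length + snd.length + g ≤ L.total)
    (hl : inp 1 = l) (hok : v.ok = false) (hval : v.val = none) :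
    ∃ p, p ≤ c ∧ Run L Cmd.loadBound ⟨v, regs n j g 0 c 0, inp, fst, snd, out⟩
      ⟨v, regs n j g (min (bitsVal l) c) c p, Function.update inp 1 [], fst, snd, out⟩ := by
  have key : ∀ (l : List Bool) (inp : Fin 3 → List Bool) k p, inp 1 = l → k ≤ c → p ≤ c →
      ∃ p', p' ≤ c ∧ Run L (whileDo (fun v => v.val.isSome)
      (.seq (Cmd.cond (fun v => v.val == some true) (Cmd.capAdd (.inl .K) (.inl .P)) Cmd.skip)
        (.seq (Cmd.capAdd (.inl .P) (.inl .P)) (Cmd.readInput 1 fun v b => { v with val := b }))))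
      ⟨{ v with val := l.head? }, regs n j g k c p, Function.update inp 1 l.tail, fst, snd, out⟩
      ⟨v, regs n j g (min (k + p * bitsVal l) c) c p', Function.update inp 1 [], fst, snd, out⟩ := by
    intro l
    induction l with
    | nil =>
      intro inp k p hi hk hp
      refine ⟨p, hp, Run.whileDo_done_eq (fits_regs hL hn hj (by omega) (by omega) (by omega) ht)
        rfl ?_⟩
      simp [bitsVal, ← hval, min_eq_left hk]
    | cons b l ih =>
      intro inp k p hi hk hp
      obtain ⟨p', h1, h2⟩ := ih (Function.update inp 1 l) (min (k + b.toNat * p) c)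
        (min (p + p) c) (by simp) (min_le_right _ _) (min_le_right _ _)
      have hfit : ∀ (v : Vars κ) (i : Fin 3 → List Bool) (k p : ℕ), k ≤ c → p ≤ c →
          Mem.Fits L ⟨v, regs n j g k c p, i, fst, snd, out⟩ := fun v i k p hk hp =>
        fits_regs hL hn hj (by omega) (by omega) (by omega) ht
      refine ⟨p', h1, Run.whileDo_next rfl (Run.seq (b := ⟨{ v with val := some b },
        regs n j g (min (k + b.toNat * p) c) c p, Function.update inp 1 l, fst, snd, out⟩) ?_
        (Run.seq (Run.capAdd (i := .inl .P) (j := .inl .P) (hfit _ _ _ _ (min_le_right _ _) hp) (by rw [hL]; simp) (by simp)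
          (by simp) rfl (by simp [regs]; omega) (by exact hok)) (Run.readInput ?_))) (h2.of_eq' ?_ ?_)⟩
      · cases b
        · refine Run.cond_false rfl ((Run.skip (hfit _ _ _ _ hk hp)).of_eq ?_)
          simp [min_eq_left hk]
        · refine Run.cond_true rfl ((Run.capAdd (i := .inl .K) (j := .inl .P)
            (hfit _ _ _ _ hk hp) (by rw [hL]; simp) (by simp)
            (by simp) rfl (by simp [regs]; omega) (by exact hok)).of_eq ?_)
          simp [update_regs_K, regs]
      · simp only [update_regs_P]
        exact hfit _ _ _ _ (min_le_right _ _) (min_le_right _ _)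
      · simp [update_regs_P, regs]
      · have h3 : min (min (k + b.toNat * p) c + min (p + p) c * bitsVal l) c =
            min (k + p * bitsVal (b :: l)) c := by
          have h4 : k + p * bitsVal (b :: l) = k + b.toNat * p + 2 * p * bitsVal l := by
            rw [bitsVal]; ring
          rw [h4]
          rcases Nat.eq_zero_or_pos (bitsVal l) with h5 | h5
          · rw [h5]; simp
          · rcases le_total (p + p) c with h6 | h6
            · rw [min_eq_left h6, ← two_mul]
              rcases le_total (k + b.toNat * p) c with h7 | h7
              · rw [min_eq_left h7]
              · rw [min_eq_right h7, min_eq_right (by omega), min_eq_right (by omega)]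
            · have h7 := Nat.le_mul_of_pos_right c h5
              have h8 := Nat.le_mul_of_pos_right (2 * p) h5
              rw [min_eq_right h6, min_eq_right (by omega), min_eq_right (by omega)]
        simp [h3]
  obtain ⟨p', h1, h2⟩ := key l inp 0 1 hl (by omega) (by omega)
  refine ⟨p', h1, Run.seq (Run.inc (fits_regs hL hn hj (by omega) (by omega) (by omega) ht) rfl)
    (Run.seq (Run.readInput ?_) (h2.of_eq' ?_ ?_))⟩
  · simp only [update_regs_P]
    exact fits_regs hL hn hj (by omega) (by omega) (by simp [regs]; omega) ht
  · simp [update_regs_P, hl, regs]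
  · simp

/-- Increase a counter by a constant. -/
noncomputable def incBy (i : Name ⊕ F) : ℕ → Prog κ F
  | 0 => skip
  | r + 1 => .seq (inc i) (incBy i r)

theorem Run.incBy {i : Name ⊕ F} {r : ℕ} {a : Mem 3 (Vars κ) (Name ⊕ F)}
    (h : Mem.Fits L { a with cnt := Function.update a.cnt i (a.cnt i + r) })
    (hi : i ≠ .inl .Z) (hZ : a.cnt (.inl .Z) = 0) :
    Run L (Cmd.incBy i r) a { a with cnt := Function.update a.cnt i (a.cnt i + r) } := by
  induction r generalizing a with
  | zero =>
    rw [Nat.add_zero, Function.update_eq_self] at h ⊢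
    exact Run.skip h
  | succ r ih =>
    have h1 : a.cnt i + 1 + r = a.cnt i + (r + 1) := by ring
    have h2 := ih (a := { a with cnt := Function.update a.cnt i (a.cnt i + 1) })
      (by simpa [h1] using h) (by simp [hi.symm, hZ])
    refine Run.seq (Run.inc (fits_mono h (fun t => ?_) le_rfl) hZ) (h2.of_eq (by simp [h1]))
    simp only [Function.update_apply]
    split_ifs with ht
    · subst ht; omega
    · exact le_rfl

/-- Double counter `C` a constant number of times. -/
noncomputable def doubleC : ℕ → Prog κ F
  | 0 => skip
  | r + 1 => .seq (add (.inl .C) (.inl .C) (.inl .C) false) (doubleC r)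

theorem Run.doubleC {r : ℕ} {a : Mem 3 (Vars κ) (Name ⊕ F)}
    (h : Mem.Fits L
      { a with cnt := Function.update a.cnt (.inl .C) (a.cnt (.inl .C) * 2 ^ r) }) :
    Run L (Cmd.doubleC r) a
      { a with cnt := Function.update a.cnt (.inl .C) (a.cnt (.inl .C) * 2 ^ r) } := by
  induction r generalizing a with
  | zero =>
    rw [pow_zero, Nat.mul_one, Function.update_eq_self] at h ⊢
    exact Run.skip h
  | succ r ih =>
    have h1 : (a.cnt (.inl .C) + a.cnt (.inl .C)) * 2 ^ r = a.cnt (.inl .C) * 2 ^ (r + 1) := by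
      ring
    have h2 := ih (a := { a with
      cnt := Function.update a.cnt (.inl .C) (a.cnt (.inl .C) + a.cnt (.inl .C)) })
      (by simpa [h1] using h)
    refine Run.seq (Run.add (fits_mono h (fun t => ?_) le_rfl)) (h2.of_eq' ?_ ?_)
    · simp only [Function.update_apply]
      split_ifs with ht
      · subst ht; exact Nat.le_mul_of_pos_right _ (by positivity)
      · exact le_rfl
    · simp
    · simp [h1]

/-- Execute `small j` if `G` is a number `j` less than `r`, and `main` otherwise, with `G`
decreased accordingly. -/
noncomputable def dispatch (small : ℕ → Prog κ F) (main : Prog κ F) : ℕ → ℕ → Prog κ F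
  | 0, _ => main
  | r + 1, j => .seq (test (.inl .Z) (.inl .G)) (cond Vars.ok
      (.seq (modify fun v => { v with ok := false }) (.seq (dec (.inl .G))
        (dispatch small main r (j + 1)))) (small j))

theorem Run.dispatch {small : ℕ → Prog κ F} {main : Prog κ F} {r j g : ℕ}
    {a e : Mem 3 (Vars κ) (Name ⊕ F)} (ha : a.Fits L) (hZ : a.cnt (.inl .Z) = 0)
    (hg : a.cnt (.inl .G) = g) (hok : a.ctl.ok = false)
    (h : Run L (if g < r then small (j + g) else main)
      { a with cnt := Function.update a.cnt (.inl .G) (g - r) } e) :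
    Run L (Cmd.dispatch small main r j) a e := by
  induction r generalizing j g a with
  | zero =>
    subst hg
    simpa [Cmd.dispatch] using h
  | succ r ih =>
    subst hg
    have hv : ({ a.ctl with ok := false } : Vars κ) = a.ctl := by rw [← hok]
    refine Run.seq (Run.test ha) ?_
    by_cases hg : 0 < a.cnt (.inl .G)
    · refine Run.cond_true (by simpa [hZ] using hg) (Run.seq
        (Run.modify (fits_congr ha rfl le_rfl)) (Run.seq (Run.dec (fits_congr ha rfl le_rfl) hg)
        (ih (g := a.cnt (.inl .G) - 1) ?_ (by simp [hZ]) (by simp) rfl ?_)))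
      · refine fits_mono ha (fun t => ?_) le_rfl
        simp only [Function.update_apply]
        split_ifs with ht
        · subst ht; omega
        · exact le_rfl
      · have h1 : a.cnt (.inl .G) - 1 < r ↔ a.cnt (.inl .G) < r + 1 := by omega
        have h2 : j + 1 + (a.cnt (.inl .G) - 1) = j + a.cnt (.inl .G) := by omega
        have h3 : a.cnt (.inl .G) - 1 - r = a.cnt (.inl .G) - (r + 1) := by omega
        simpa [h1, h2, h3, hv] using h
    · have h0 : a.cnt (.inl .G) = 0 := by omega
      refine Run.cond_false (by simp [hZ, h0]) ?_
      simp only [h0, Nat.zero_sub, Nat.zero_lt_succ, if_true, Nat.add_zero] at h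
      have h1 : Function.update a.cnt (.inl .G) 0 = a.cnt := by
        rw [← h0, Function.update_eq_self]
      rw [h1] at h
      simpa [hZ, h0, hv] using h

end Cmd

/-! ### The machine that decides complexity -/

namespace Cmd

open Machine

variable {U : Machine 2} {B : ℕ} {L : Limits (Name ⊕ (Bool × U.Node B))}

noncomputable def blank (U : Machine 2) : Vars U.Spot := ⟨false, false, none, false, false, U.rootSpot 0⟩

/-- Decide complexity if the space bound is at least `B`. -/
noncomputable def mainCase (U : Machine 2) (B : ℕ) : Prog U.Spot (Bool × U.Node B) :=
  -- The case distinction has decreased `G` by `B`, which is restored here.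
  .seq (incBy (.inl .G) B) (.seq (copy (.inl .C) (.inl .N)) (.seq (incBy (.inl .C) (B + 1))
    -- The search begins at the accepting vertex of the empty program, where the output position is
    -- at the end of the array.
    (.seq loadBound (.seq (copy (.inl .J) (.inl .N)) searchAll))))

/-- Decide complexity with space bound `j`. -/
noncomputable def smallCase (U : Machine 2) (B j : ℕ) : Prog U.Spot (Bool × U.Node B) :=
  .seq (copy (.inl .C) (.inl .N)) (.seq (inc (.inl .C))
    (.seq (doubleC (Fintype.card (U.Node B)).size) (.seq loadBound (cheapRun (U.transducer B j)))))

theorem Run.mainCase {x : List Bool} {s k : ℕ} {inp : Fin 3 → List Bool} (hL : L.big = .inl .G)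
    (hsmall : 2 * (x.length + B + 1) ≤ L.small) (htotal : s + 2 * x.length + B + 1 ≤ L.total)
    (hk : inp 1 = Nat.bits k) (hs : B ≤ s) :
    ∃ e, Run L (Cmd.mainCase U B) ⟨blank U, regs x.length 0 (s - B) 0 0 0, inp, [], x, []⟩ e ∧
      e.Fits L ∧ e.out = [] ∧ (e.ctl.res = true ↔
        ∃ p : List Bool, p.length < min k (x.length + B + 1) ∧ U.Accepts s x p) := by
  have hfit : ∀ {v : Vars U.Spot} {j g k c p : ℕ} {inp : Fin 3 → List Bool},
      j ≤ x.length → g ≤ s → k ≤ x.length + B + 1 → c ≤ x.length + B + 1 →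
      p ≤ x.length + B + 1 → Mem.Fits L ⟨v, regs x.length j g k c p, inp, [], x, []⟩ :=
    fun hj hg hk hc hp => fits_regs hL (by omega) (by omega) (by omega) (by omega) (by omega)
      (by simp; omega)
  have h1 : Run L (Cmd.incBy (.inl .G) B)
      ⟨blank U, regs x.length 0 (s - B) 0 0 0, inp, [], x, []⟩
      ⟨blank U, regs x.length 0 s 0 0 0, inp, [], x, []⟩ := by
    have h2 : regs (F := Bool × U.Node B) x.length 0 (s - B) 0 0 0 (.inl .G) + B = s :=
      Nat.sub_add_cancel hs
    refine (Run.incBy ?_ (by simp) rfl).of_eq ?_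
    · simp only [h2, update_regs_G]
      exact hfit (by omega) le_rfl (by omega) (by omega) (by omega)
    · simp only [h2, update_regs_G]
  have h2 : Run L (Cmd.copy (.inl .C) (.inl .N))
      ⟨blank U, regs x.length 0 s 0 0 0, inp, [], x, []⟩
      ⟨blank U, regs x.length 0 s 0 x.length 0, inp, [], x, []⟩ := by
    refine (Run.copy (hfit (by omega) le_rfl (by omega) (by omega) (by omega)) rfl).of_eq ?_
    simp only [update_regs_C, regs]
  have h3 : Run L (Cmd.incBy (.inl .C) (B + 1))
      ⟨blank U, regs x.length 0 s 0 x.length 0, inp, [], x, []⟩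
      ⟨blank U, regs x.length 0 s 0 (x.length + B + 1) 0, inp, [], x, []⟩ := by
    refine (Run.incBy ?_ (by simp) rfl).of_eq ?_
    · simp only [update_regs_C]
      exact hfit (by omega) le_rfl (by omega) (by simp [regs]; omega) (by omega)
    · simp only [update_regs_C]; rfl
  obtain ⟨p', hp', h4⟩ := Run.loadBound (v := blank U) (n := x.length) (j := 0) (g := s)
    (c := x.length + B + 1) (inp := inp) (fst := []) (snd := x) (out := []) hL (by omega) (by omega)
    hsmall (by omega) (by simp; omega) hk rfl rfl
  rw [bitsVal_bits] at h4
  let Γ : Env (Bool × U.Node B) := ⟨words [] x, s, min k (x.length + B + 1), x.length + B + 1, p',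
    fun _ => 0, Function.update inp 1 [], []⟩
  have h5 : Run L (Cmd.copy (.inl .J) (.inl .N))
      ⟨blank U, regs x.length 0 s (min k (x.length + B + 1)) (x.length + B + 1) p',
        Function.update inp 1 [], [], x, []⟩ (Γ.ready (blank U) []) := by
    refine (Run.copy (hfit (by omega) le_rfl (min_le_right _ _) (by omega) hp') rfl).of_eq ?_
    rw [Env.ready_eq, update_regs_J]
    refine Mem.ext rfl (funext fun i => ?_) rfl rfl rfl rfl
    rcases i with i | i <;> (try cases i) <;> simp [regs, Env.readyCnt, Γ, words]
  have hΓ : ∀ p : List Bool, p.length ≤ Γ.k → (Γ.withProg p).Fits L := by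
    intro p hp
    have hp2 : p.length ≤ x.length + B + 1 := hp.trans (min_le_right _ _)
    refine ⟨hL, ?_, ?_, ?_, ?_, fun _ => Nat.zero_le _, ?_⟩
    · simp only [Env.withProg, Γ, words]; omega
    · have := min_le_right k (x.length + B + 1)
      simp only [Env.withProg, Γ]; omega
    · simp only [Env.withProg, Γ]; omega
    · simp only [Env.withProg, Γ]; omega
    · simp only [Env.withProg, Γ, words]; omega
  obtain ⟨ctl, h6⟩ := Run.searchAll hΓ (v := blank U) rfl rfl rfl
  refine ⟨_, Run.seq h1 (Run.seq h2 (Run.seq h3 (Run.seq h4 (Run.seq h5 h6)))),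
    (hΓ _ (by simp)).mem (valid_finalDat _ _) _, rfl, ?_⟩
  simp only [Env.ready, Env.mem, blank, Bool.false_or, decide_eq_true_iff]
  rfl

theorem Run.smallCase {x : List Bool} {j k : ℕ} {inp : Fin 3 → List Bool} (hL : L.big = .inl .G)
    (hsmall : 2 * ((x.length + 1) * 2 ^ (Fintype.card (U.Node B)).size) ≤ L.small)
    (htotal : x.length ≤ L.total) (hk : inp 1 = Nat.bits k) (hj : j ≤ B) :
    ∃ e, Run L (Cmd.smallCase U B j) ⟨blank U, regs x.length 0 0 0 0 0, inp, [], x, []⟩ e ∧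
      e.Fits L ∧ e.out = [] ∧ (e.ctl.res = true ↔
        ∃ p : List Bool, p.length < k ∧ U.Accepts j x p) := by
  -- The cap must be at least the number of nodes times `|x| + 1`; a power of two above the number
  -- of nodes allows it to be computed by repeated doubling.
  set C := (x.length + 1) * 2 ^ (Fintype.card (U.Node B)).size with hC
  have hC1 : x.length + 1 ≤ C := Nat.le_mul_of_pos_right _ (by positivity)
  have hfit : ∀ {v : Vars U.Spot} {k c p : ℕ} {inp : Fin 3 → List Bool},
      k ≤ C → c ≤ C → p ≤ C → Mem.Fits L ⟨v, regs x.length 0 0 k c p, inp, [], x, []⟩ :=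
    fun hk hc hp => fits_regs hL (by omega) (by omega) (by omega) (by omega) (by omega)
      (by simp; omega)
  have h2 : Run L (Cmd.copy (.inl .C) (.inl .N))
      ⟨blank U, regs x.length 0 0 0 0 0, inp, [], x, []⟩
      ⟨blank U, regs x.length 0 0 0 x.length 0, inp, [], x, []⟩ := by
    refine (Run.copy (hfit (by omega) (by omega) (by omega)) rfl).of_eq ?_
    simp only [update_regs_C, regs]
  have h3 : Run L (Cmd.inc (.inl .C))
      ⟨blank U, regs x.length 0 0 0 x.length 0, inp, [], x, []⟩
      ⟨blank U, regs x.length 0 0 0 (x.length + 1) 0, inp, [], x, []⟩ := by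
    refine (Run.inc (hfit (by omega) (by omega) (by omega)) rfl).of_eq ?_
    simp only [update_regs_C, regs]
  have h4 : Run L (Cmd.doubleC (Fintype.card (U.Node B)).size)
      ⟨blank U, regs x.length 0 0 0 (x.length + 1) 0, inp, [], x, []⟩
      ⟨blank U, regs x.length 0 0 0 C 0, inp, [], x, []⟩ := by
    refine (Run.doubleC ?_).of_eq ?_
    · simp only [update_regs_C]
      exact hfit (by omega) le_rfl (by omega)
    · simp only [update_regs_C]; rfl
  obtain ⟨p', hp', h5⟩ := Run.loadBound (v := blank U) (n := x.length) (j := 0) (g := 0)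
    (c := C) (inp := inp) (fst := []) (snd := x) (out := []) hL (by omega) (by omega)
    hsmall (by omega) (by simp; omega) hk rfl rfl
  rw [bitsVal_bits] at h5
  have hframe : Frame L (min k C) x ⟨blank U, regs x.length 0 0 (min k C) C p',
      Function.update inp 1 [], [], x, []⟩ :=
    ⟨hfit (min_le_right _ _) le_rfl hp', rfl, rfl, rfl, fun _ _ => Nat.zero_le _, rfl, rfl, rfl⟩
  obtain ⟨e, h6, h7, h8, h9⟩ := Run.cheapRun (U.transducer B j) hL
    (by have := min_le_right k C; omega) hframe
  refine ⟨e, Run.seq h2 (Run.seq h3 (Run.seq h4 (Run.seq h5 h6))), h7, h8, ?_⟩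
  rw [h9, exists_accepts_iff hj]
  constructor
  · rintro ⟨f, hf, m, hm, h⟩
    exact ⟨f, hf, m, hm.trans_le (min_le_left _ _), h⟩
  · rintro ⟨f, hf, m, hm, h⟩
    obtain ⟨m', h10, h11, h12⟩ := h.exists_lt
    refine ⟨f, hf, m', lt_min (h10.trans_lt hm) (h12.trans_le ?_), h11⟩
    rw [hC, Nat.mul_comm]
    exact Nat.mul_le_mul_left _ (Nat.lt_size_self _).le

/-- Decide complexity, given that it exceeds the length by at most `B` if the space bound is at
least `B`. -/
noncomputable def decideComplexity (U : Machine 2) (B : ℕ) : Prog U.Spot (Bool × U.Node B) :=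
  .seq (loadTape 2 false) (.seq horner (.seq (loadTape 0 true) (.seq (moveToSnd (.inl .N))
    (.seq (dispatch (smallCase U B) (mainCase U B) B 0) (emitBit fun v => v.res)))))

/-- The limits for deciding complexity. -/
noncomputable def limits (U : Machine 2) (B n s : ℕ) : Limits (Name ⊕ (Bool × U.Node B)) where
  big := .inl .G
  -- A common bound for twice the cap in both cases.
  small := (n + 2) * (2 * (2 ^ (Fintype.card (U.Node B)).size + B + 1))
  -- Space `s` for the simulated stacks, `n` for the output, and `n + B + 1` for the program.
  total := s + 2 * n + B + 1

-- In the main case a program that is too long for the search can be replaced by the one that `hB`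
-- provides. So capping the bound at `|x| + B + 1` does not change the answer.
open Classical in
theorem Run.decideComplexity {x : List Bool} {k s : ℕ}
    (hB : B ≤ s → ∃ p : List Bool, p.length ≤ x.length + B ∧ U.Accepts s x p) :
    ∃ e, Run (limits U B x.length s) (Cmd.decideComplexity U B)
      ⟨blank U, fun _ => 0, ![x, Nat.bits k, Nat.bits s], [], [], []⟩ e ∧
      e.out = [decide (∃ p : List Bool, p.length < k ∧ U.Accepts s x p)] := by
  set L := limits U B x.length s with hLdef
  have hL : L.big = .inl .G := rfl
  have htot : L.total = s + 2 * x.length + B + 1 := rfl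
  have hsm : L.small = (x.length + 2) * (2 * (2 ^ (Fintype.card (U.Node B)).size + B + 1)) := rfl
  have hsm1 : 2 * (x.length + B + 1) ≤ L.small := by
    rw [hsm]
    have := Nat.one_le_two_pow (n := (Fintype.card (U.Node B)).size)
    nlinarith
  have hsm2 : 2 * ((x.length + 1) * 2 ^ (Fintype.card (U.Node B)).size) ≤ L.small := by
    rw [hsm, Nat.mul_left_comm]
    exact Nat.mul_le_mul (by omega) (by omega)
  -- The digits of `s` lie on the stack before any other space is used, so they may be charged to
  -- `s` itself.
  have hsize : (Nat.bits s).length ≤ s := by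
    rw [Nat.size_eq_bits_len]
    exact Nat.size_le.2 Nat.lt_two_pow_self
  have h0 : regs (F := Bool × U.Node B) 0 0 0 0 0 0 = fun _ => 0 := by
    funext i; rcases i with i | i <;> (try cases i) <;> rfl
  have h1 := Run.loadTape (L := L) (i := 2) (count := false) (n := 0) (j := 0) (g := 0) (k := 0)
    (c := 0) (p := 0) (v := blank U) (inp := ![x, Nat.bits k, Nat.bits s]) (fst := []) (snd := [])
    (out := []) (l := Nat.bits s) hL (by simp) (by simp) (by simp) (by simp) (by simp)
    (by simp; omega) rfl rfl
  have h2 := Run.horner (L := L) (n := 0) (j := 0) (g := 0) (k := 0)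
    (c := 0) (p := 0) (v := blank U) (inp := Function.update ![x, Nat.bits k, Nat.bits s] 2 [])
    (snd := []) (out := []) (l := Nat.bits s) hL (by simp) (by simp) (by simp) (by simp) (by simp)
    (S := s) (by rw [bitsVal_bits]; simp) ?_ (by simp; omega) rfl
  have h3 := Run.loadTape (L := L) (i := 0) (count := true) (n := 0) (j := 0) (g := s) (k := 0)
    (c := 0) (p := 0) (v := blank U) (inp := Function.update ![x, Nat.bits k, Nat.bits s] 2 [])
    (fst := []) (snd := []) (out := []) (l := x) hL (by simp; omega) (by simp) (by simp) (by simp)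
    (by simp) (by simp; omega) rfl rfl
  simp only [h0, Bool.toNat_false, Bool.toNat_true, Nat.zero_mul, Nat.one_mul, Nat.zero_add,
    List.append_nil] at h1 h2 h3
  set inp := Function.update (Function.update ![x, Nat.bits k, Nat.bits s] 2 []) 0 [] with hinp
  have hinp1 : inp 1 = Nat.bits k := rfl
  have hfit : ∀ {fst snd : List Bool}, fst.length + snd.length ≤ x.length →
      Mem.Fits L ⟨blank U, regs x.length 0 s 0 0 0, inp, fst, snd, []⟩ := fun h =>
    fits_regs hL (by omega) (by omega) (by omega) (by omega) (by omega) (by omega)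
  have h4 := Run.moveToSnd (L := L) (i := .inl .N) (v := blank U) (inp := inp) (fst := [])
    (snd := []) (out := []) (c := regs x.length 0 s 0 0 0) (l := x.reverse) (by rw [hL]; simp)
    (by rw [hL]; simp) (hfit (by simp)) rfl rfl (by simp [regs]) rfl
  rw [List.reverse_reverse, List.append_nil, List.append_nil] at h4
  obtain ⟨e, h5, h6, h7, h8⟩ : ∃ e, Run L (if s < B then Cmd.smallCase U B (0 + s)
      else Cmd.mainCase U B) ⟨blank U, regs x.length 0 (s - B) 0 0 0, inp, [], x, []⟩ e ∧
      e.Fits L ∧ e.out = [] ∧ (e.ctl.res = true ↔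
        ∃ p : List Bool, p.length < k ∧ U.Accepts s x p) := by
    by_cases hs : s < B
    · rw [if_pos hs, Nat.zero_add, Nat.sub_eq_zero_of_le hs.le]
      exact Run.smallCase hL hsm2 (by omega) hinp1 hs.le
    · rw [if_neg hs]
      obtain ⟨e, h5, h6, h7, h8⟩ := Run.mainCase (U := U) (x := x) (s := s) hL hsm1 (by omega) hinp1
        (by omega)
      refine ⟨e, h5, h6, h7, h8.trans ⟨?_, ?_⟩⟩
      · rintro ⟨p, h9, h10⟩
        exact ⟨p, h9.trans_le (min_le_left _ _), h10⟩
      · rintro ⟨p, h9, h10⟩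
        obtain ⟨q, h11, h12⟩ := hB (by omega)
        rcases lt_or_ge p.length (x.length + B + 1) with h | h
        · exact ⟨p, lt_min h9 h, h10⟩
        · exact ⟨q, lt_min (by omega) (by omega), h12⟩
  refine ⟨_, Run.seq h1 (Run.seq h2 (Run.seq h3 (Run.seq h4 (Run.seq (Run.dispatch (g := s)
    (hfit (by simp)) rfl rfl rfl ?_) (Run.emitBit h6))))), ?_⟩
  · simp only [update_regs_G]
    exact h5
  · simp only [h7, List.nil_append]
    rw [Bool.eq_iff_iff.2 (h8.trans decide_eq_true_iff.symm)]
  · rcases Nat.eq_zero_or_pos s with rfl | hs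
    · left; simp
    · right
      rw [Nat.size_eq_bits_len]
      have h9 : (s.size - 1) < s.size := by
        have := Nat.size_pos.2 hs; omega
      have h10 := Nat.lt_size.1 h9
      have h11 : 2 ^ s.size = 2 ^ (s.size - 1) * 2 := by
        rw [← pow_succ]; congr 1; omega
      omega

end Cmd

/-! ### The theorem -/

namespace Machine

variable {U : Machine 2}

theorem complexity_lt_iff {s k : ℕ} {x : List Bool} :
    U.complexity s x < (k : ℕ∞) ↔ ∃ p : List Bool, p.length < k ∧ U.Accepts s x p := by
  simp only [complexity, taskComplexity, iInf_lt_iff, Nat.cast_lt, List.mem_singleton,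
    forall_eq, exists_prop, Accepts, and_comm]

/-- The machine that copies its first input to its output. -/
def copier : Machine 2 where
  State := Option (Option Bool)
  finite_state := inferInstance
  init := some none
  request
    | none => .halt
    | some none => .read 0 fun a => a.map some
    | some (some b) => .write b (some none)

theorem copier_spec (p y w : List Bool) :
    ∃ t, copier.step^[t] ⟨some none, ![p, y], fun _ => [], w⟩ =
        ⟨none, ![[], y], fun _ => [], w ++ p⟩ ∧
      ∀ t' ≤ t, (copier.step^[t'] ⟨some none, ![p, y], fun _ => [], w⟩).space ≤ 0 := by
  induction p generalizing w with
  | nil =>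
    have h : copier.step ⟨some none, ![[], y], fun _ => [], w⟩ =
        ⟨none, ![[], y], fun _ => [], w ++ []⟩ := by
      simp [step, copier]
    refine ⟨1, h, fun t' ht' => ?_⟩
    interval_cases t'
    · exact le_rfl
    · rw [Function.iterate_one, h]; exact le_rfl
  | cons b p ih =>
    obtain ⟨t, ht, hs⟩ := ih (w ++ [b])
    have h1 : copier.step ⟨some none, ![b :: p, y], fun _ => [], w⟩ =
        ⟨some (some b), ![p, y], fun _ => [], w⟩ := by
      have : Function.update ![b :: p, y] 0 p = ![p, y] := by
        funext i
        fin_cases i <;> rfl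
      simp [step, copier, this]
    have h2 : copier.step ⟨some (some b), ![p, y], fun _ => [], w⟩ =
        ⟨some none, ![p, y], fun _ => [], w ++ [b]⟩ := rfl
    refine ⟨t + 2, ?_, fun t' ht' => ?_⟩
    · rw [Function.iterate_succ_apply, Function.iterate_succ_apply, h1, h2, ht,
        List.append_assoc]
      rfl
    · match t' with
      | 0 => exact le_rfl
      | 1 => rw [Function.iterate_one, h1]; exact le_rfl
      | t' + 2 =>
        rw [Function.iterate_succ_apply, Function.iterate_succ_apply, h1, h2]
        exact hs t' (by omega)

theorem copier_accepts (s : ℕ) (x : List Bool) : copier.Accepts s x x := by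
  obtain ⟨t, ht, hs⟩ := copier_spec x [] []
  have hfix : copier.step (⟨none, ![[], []], fun _ => [], [] ++ x⟩ : Config 2 copier.State) =
    ⟨none, ![[], []], fun _ => [], [] ++ x⟩ := rfl
  have ht' : copier.configAt ![x, []] t = ⟨none, ![[], []], fun _ => [], [] ++ x⟩ := ht
  refine ⟨⟨t, by rw [ht']; rfl, by rw [ht']; rfl⟩, fun t' => ?_⟩
  rcases le_total t' t with h | h
  · exact (hs t' h).trans (Nat.zero_le _)
  · obtain ⟨r, rfl⟩ := Nat.exists_eq_add_of_le h
    have : copier.configAt ![x, []] (t + r) = ⟨none, ![[], []], fun _ => [], [] ++ x⟩ := by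
      unfold configAt at ht' ⊢
      rw [Nat.add_comm, Function.iterate_add_apply, ht']
      exact Function.iterate_fixed hfix r
    rw [this]
    exact Nat.zero_le _

/-- The copying machine needs no space and outputs its program. The constant of optimality for it
serves both as the additional length and as the least space bound. -/
theorem IsOptimal.exists_accepts (hU : U.IsOptimal) : ∃ B : ℕ, ∀ (s : ℕ) (x : List Bool),
    B ≤ s → ∃ p : List Bool, p.length ≤ x.length + B ∧ U.Accepts s x p := by
  obtain ⟨B, hB⟩ := hU copier
  refine ⟨B, fun s x hs => ?_⟩
  have h1 : copier.complexity (s - B) x < ((x.length + 1 : ℕ) : ℕ∞) :=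
    complexity_lt_iff.2 ⟨x, Nat.lt_succ_self _, copier_accepts _ x⟩
  have h2 : U.complexity s x ≤ copier.complexity (s - B) x + B := by
    have := hB (s - B) [(x, [])]
    rwa [Nat.sub_add_cancel hs] at this
  have h3 : U.complexity s x < ((x.length + B + 1 : ℕ) : ℕ∞) := by
    obtain ⟨a, ha⟩ := ENat.ne_top_iff_exists.1 h1.ne_top
    rw [← ha] at h1 h2
    refine h2.trans_lt ?_
    norm_cast at h1 ⊢
    omega
  obtain ⟨p, hp, h⟩ := complexity_lt_iff.1 h3
  exact ⟨p, by omega, h⟩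

theorem UsesSpace.mono {m : ℕ} {M : Machine m} {input : Fin m → List Bool} {s t : ℕ}
    (h : M.UsesSpace input s) (hst : s ≤ t) : M.UsesSpace input t :=
  fun i => (h i).trans hst

end Machine

namespace Cmd

open Machine

theorem cellsOf_zero {ι : Type} [Fintype ι] : cellsOf (fun _ : ι => 0) = [] :=
  (trimCells_eq_cellsOf [] _ fun _ => rfl).symm

/-- Counters with value zero occupy no cells, but their end mark must be on stack `0`; one push
turns the empty stacks into a valid representation. -/
theorem exec_start {B m : ℕ} {ρ ι : Type} [Fintype ι] (v : ρ) (inp : Fin m → List Bool)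
    (h : 1 ≤ B) :
    Exec B (.act fun s : Store ρ ι => .push 0 false s)
      ⟨⟨v, fun _ => false, false, false⟩, inp, fun _ => [], []⟩
      (Mem.conf ⟨v, fun _ => 0, inp, [], [], []⟩) := by
  have h1 : (Act.push 0 false ⟨v, fun _ => false, false, false⟩ : Act m (Store ρ ι)).run
      (Config.mk (⟨v, fun _ => false, false, false⟩ : Store ρ ι) inp (fun _ => []) []) =
      Mem.conf ⟨v, fun _ => 0, inp, [], [], []⟩ := by
    simp only [Act.run, Mem.conf, cellsOf_zero]
    congr 1
    funext i
    fin_cases i <;> rfl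
  rw [← h1]
  refine Exec.act (r := fun s : Store ρ ι => Act.push 0 false s) (Nat.zero_le _) ?_
  rw [h1]
  simpa [Mem.conf, cellsOf_zero, cellCode] using h

/-- The machine that decides complexity. -/
noncomputable def decider (U : Machine 2) (B : ℕ) : Machine 3 :=
  (Cmd.seq (.act fun s => .push 0 false s) (decideComplexity U B)).toMachine
    ⟨blank U, fun _ => false, false, false⟩

open Classical in
theorem decider_spec {U : Machine 2} {B : ℕ} {x : List Bool} {k s : ℕ}
    (hB : B ≤ s → ∃ p : List Bool, p.length ≤ x.length + B ∧ U.Accepts s x p) :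
    (decider U B).Decides ![x, Nat.bits k, Nat.bits s] (U.complexity s x < (k : ℕ∞)) ∧
      (decider U B).UsesSpace ![x, Nat.bits k, Nat.bits s] (limits U B x.length s).bound := by
  obtain ⟨e, h1, h2⟩ := Run.decideComplexity (k := k) hB
  have h3 : 1 ≤ (limits U B x.length s).bound := by
    simp only [Limits.bound, Limits.overhead]; omega
  obtain ⟨h4, h5⟩ := (Exec.seq (exec_start _ _ h3) h1).outputs_and_usesSpace
  change (decider U B).Outputs _ e.out at h4
  rw [h2] at h4
  rw [complexity_lt_iff]
  refine ⟨⟨fun h => ?_, fun h => ?_⟩, h5⟩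
  · rwa [decide_eq_true h] at h4
  · rwa [decide_eq_false h] at h4

theorem size_mul_le (n d : ℕ) : ((n + 2) * d).size ≤ (d.size + 1) * (Nat.log 2 (n + 2) + 1) := by
  have h1 : n + 2 < 2 ^ (Nat.log 2 (n + 2) + 1) := Nat.lt_pow_succ_log_self (by norm_num) _
  have h2 : ((n + 2) * d).size ≤ Nat.log 2 (n + 2) + 1 + d.size := by
    rw [Nat.size_le, pow_add]
    exact Nat.mul_lt_mul_of_lt_of_le h1 (Nat.lt_size_self d).le (by positivity)
  nlinarith

theorem exists_bound_limits_le (U : Machine 2) (B : ℕ) : ∃ c, ∀ n s : ℕ,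
    (limits U B n s).bound ≤ s + 2 * n + c * Nat.log 2 (n + 2) := by
  set d := 2 * (2 ^ (Fintype.card (U.Node B)).size + B + 1) with hd
  set a := Fintype.card (Name ⊕ (Bool × U.Node B)) + 1 with ha
  set o := Limits.overhead (Name ⊕ (Bool × U.Node B)) with ho
  refine ⟨B + 1 + a * ((d.size + 1) * 2) + o, fun n s => ?_⟩
  -- This is why the logarithm is taken of `n + 2`: being at least one, it absorbs all additive
  -- constants.
  have h1 : 1 ≤ Nat.log 2 (n + 2) := Nat.log_pos (by norm_num) (by omega)
  have h2 := size_mul_le n d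
  have h3 : (limits U B n s).bound = s + 2 * n + B + 1 + a * ((n + 2) * d).size + o := rfl
  rw [h3]
  generalize Nat.log 2 (n + 2) = l at *
  have h4 : a * ((n + 2) * d).size ≤ a * ((d.size + 1) * 2) * l := by
    rw [Nat.mul_assoc, Nat.mul_assoc]
    exact Nat.mul_le_mul_left _ (h2.trans (Nat.mul_le_mul_left _ (by omega)))
  have h5 : B + 1 + o ≤ (B + 1 + o) * l := Nat.le_mul_of_pos_right _ h1
  calc _ ≤ s + 2 * n + ((B + 1 + o) * l + a * ((d.size + 1) * 2) * l) := by omega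
    _ = _ := by ring

end Cmd

/-- The numbers `k` and `s` are given in binary (`Nat.bits`), on tapes of their own. -/
theorem proposition5 (U : Machine 2) (hU : U.IsOptimal) :
    ∃ (M : Machine 3) (c : ℕ), ∀ (x : List Bool) (k s : ℕ),
      M.Decides ![x, Nat.bits k, Nat.bits s] (U.complexity s x < (k : ℕ∞)) ∧
      M.UsesSpace ![x, Nat.bits k, Nat.bits s]
        (s + 2 * x.length + c * Nat.log 2 (x.length + 2)) := by
  obtain ⟨B, hB⟩ := hU.exists_accepts
  obtain ⟨c, hc⟩ := Cmd.exists_bound_limits_le U B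
  refine ⟨Cmd.decider U B, c, fun x k s => ?_⟩
  obtain ⟨h1, h2⟩ := Cmd.decider_spec (k := k) (hB s x)
  exact ⟨h1, h2.mono (hc _ _)⟩
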